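/- Let $\mathcal O_{\mathbb C^n,0}$ be the ring of germs at $0$ of holomorphic functions on $\mathbb C^n$ (convergent power series), and let $g_1,\dots,g_k\in\mathcal O_{\mathbb C^n,0}$ define a complete intersection $(Y,0)$ in $(\mathbb C^n,0)$, i.e. $\mathcal O_{Y,0}=\mathcal O_{\mathbb C^n,0}/(g_1,\dots,g_k)$ has dimension $n-k$. Assume that every $g_i$ is convenient: for each $j=1,\dots,n$ some power of $z_j$ occurs in $g_i$ with non-zero coefficient. Let $\Delta$ be the convex hull of $\operatorname{supp}(g_1\cdots g_k)+\mathbb R_{\ge 0}^n$, and let $p_1,\dots,p_r\in\mathbb N^n$ be the distinct vectors with relatively prime components that are orthogonal to the compact facets (compact $(n-1)$-dimensional faces) of $\Delta$. For $1\le i\le k$, $1\le l\le r$ let $\nu_{il}$ be the minimum of $\langle p_l,q\rangle$ over all monomials $z^q$ occurring in $g_i$. For $g_i=\sum_q c_{iq}z^q$ let $\operatorname{in}_{j_1,\dots,j_s}g_i$ be the sum of the terms $c_{iq}z^q$ with $\langle p_{j_1},q\rangle=\nu_{ij_1},\dots,\langle p_{j_s},q\rangle=\nu_{ij_s}$. For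 $\mu\in\mathbb Z^r$ let $F_\mu\mathcal O_{\mathbb C^n,0}$ be the ideal generated by all $z^q$, $q\in\mathbb N^n$, with $\langle p_l,q\rangle\ge\mu_l$ for all $l$, and let $F_\mu\mathcal O_{Y,0}$ be its image in $\mathcal O_{Y,0}$ (the induced, or Lemahieu, filtration). Let $e_1,\dots,e_r$ be the standard basis of $\mathbb Z^r$. The codimension in $(\mathbb C^n,0)$ of a germ of a subspace is $n$ minus its dimension, and the empty germ has codimension $\infty$. Theorem. Assume that (1) for all $s\ge 1$ and $1\le j_1<\dots<j_s\le r$, the functions $\operatorname{in}_{j_1,\dots,j_s}g_1,\dots,\operatorname{in}_{j_1,\dots,j_s}g_k$ define a subspace of $(\mathbb C^n,0)$ of codimension $\ge k-s+1$; (2) for all $s\ge 2$ and $1\le j_1<\dots<j_s\le r$, they define a subspace of $(\mathbb C^n,0)$ of codimension $\ge k-s+2$. Then for all $\mu\in\mathbb Z^r$ the induced filtration coincides with the Ebeling–Gusein-Zade filtration: $$F_\mu\mathcal O_{Y,0}=F_{\mu_1e_1}\mathcal O_{Y,0}\cap\dots\cap F_{\mu_re_r}\mathcal O_{Y,0}$$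 (the empty intersection being $\mathcal O_{Y,0}$). In the special case $k=1$, $g=g_1$: conditions (1) and (2) together are equivalent to $\operatorname{in}_{j_1,j_2}g\neq 0$ for all $j_1<j_2$, and this holds if and only if the Newton polyhedron $\Delta$ is bistellar, i.e. any two compact facets of $\Delta$ intersect. Hence, if $\Delta$ is bistellar, then $F_\mu\mathcal O_{Y,0}=F_{\mu_1e_1}\mathcal O_{Y,0}\cap\dots\cap F_{\mu_re_r}\mathcal O_{Y,0}$ for all $\mu\in\mathbb Z^r$. -/

import Mathlib

namespace NewtonFiltration

noncomputable section

/-- A formal power series in `n` complex variables is convergent if it converges absolutely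
on some polydisc of positive radius around the origin. -/
def IsConvergent {n : ℕ} (f : MvPowerSeries (Fin n) ℂ) : Prop :=
  ∃ ρ : ℝ, 0 < ρ ∧ Summable fun q : Fin n →₀ ℕ => ‖MvPowerSeries.coeff q f‖ * ρ ^ q.degree

theorem summable_of_le {n : ℕ} {f : MvPowerSeries (Fin n) ℂ} {ρ ρ' : ℝ} (h0 : 0 ≤ ρ')
    (h : ρ' ≤ ρ)
    (hf : Summable fun q : Fin n →₀ ℕ => ‖MvPowerSeries.coeff q f‖ * ρ ^ q.degree) :
    Summable fun q : Fin n →₀ ℕ => ‖MvPowerSeries.coeff q f‖ * ρ' ^ q.degree :=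
  Summable.of_nonneg_of_le (fun _ => by positivity) (fun _ => by gcongr) hf

theorem IsConvergent.of_coeff_le {n : ℕ} {f g : MvPowerSeries (Fin n) ℂ} (hf : IsConvergent f)
    (h : ∀ q, ‖MvPowerSeries.coeff q g‖ ≤ ‖MvPowerSeries.coeff q f‖) : IsConvergent g := by
  obtain ⟨ρ, hρ, hs⟩ := hf
  refine ⟨ρ, hρ, Summable.of_nonneg_of_le (fun _ => by positivity) (fun q => ?_) hs⟩
  have := h q
  gcongr

theorem IsConvergent.monomial {n : ℕ} (q : Fin n →₀ ℕ) (c : ℂ) :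
    IsConvergent (MvPowerSeries.monomial q c) := by
  refine ⟨1, one_pos, summable_of_ne_finset_zero (s := {q}) fun q' hq' => ?_⟩
  classical
  rw [MvPowerSeries.coeff_monomial, if_neg (by simpa using hq')]
  simp

theorem IsConvergent.add {n : ℕ} {f g : MvPowerSeries (Fin n) ℂ} (hf : IsConvergent f)
    (hg : IsConvergent g) : IsConvergent (f + g) := by
  obtain ⟨ρ, hρ, hs⟩ := hf
  obtain ⟨ρ', hρ', hs'⟩ := hg
  have hm : 0 < min ρ ρ' := lt_min hρ hρ'
  refine ⟨min ρ ρ', hm, Summable.of_nonneg_of_le (fun _ => by positivity) (fun q => ?_)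
    ((summable_of_le hm.le (min_le_left _ _) hs).add
      (summable_of_le hm.le (min_le_right _ _) hs'))⟩
  rw [map_add, ← add_mul]
  have := norm_add_le (MvPowerSeries.coeff q f) (MvPowerSeries.coeff q g)
  gcongr

theorem summable_antidiagonal {n : ℕ} {u v : (Fin n →₀ ℕ) → ℝ} (hu : Summable u)
    (hv : Summable v) (hu0 : ∀ q, 0 ≤ u q) (hv0 : ∀ q, 0 ≤ v q) :
    Summable fun q => ∑ x ∈ Finset.HasAntidiagonal.antidiagonal q, u x.1 * v x.2 :=
  summable_sum_mul_antidiagonal_of_summable_mul (hu.mul_of_nonneg hv hu0 hv0)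

theorem norm_coeff_mul_le {n : ℕ} (f g : MvPowerSeries (Fin n) ℂ) (t : ℝ) (ht : 0 ≤ t)
    (q : Fin n →₀ ℕ) :
    ‖MvPowerSeries.coeff q (f * g)‖ * t ^ q.degree ≤
      ∑ x ∈ Finset.HasAntidiagonal.antidiagonal q,
        ‖MvPowerSeries.coeff x.1 f‖ * t ^ x.1.degree *
          (‖MvPowerSeries.coeff x.2 g‖ * t ^ x.2.degree) := by
  rw [MvPowerSeries.coeff_mul]
  refine (mul_le_mul_of_nonneg_right (norm_sum_le _ _) (pow_nonneg ht _)).trans ?_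
  rw [Finset.sum_mul]
  refine Finset.sum_le_sum fun x hx => le_of_eq ?_
  rw [← Finset.HasAntidiagonal.mem_antidiagonal.mp hx, map_add, pow_add, norm_mul]
  ring

theorem summable_coeff_mul {n : ℕ} {f g : MvPowerSeries (Fin n) ℂ} {t : ℝ} (ht : 0 ≤ t)
    (hf : Summable fun q : Fin n →₀ ℕ => ‖MvPowerSeries.coeff q f‖ * t ^ q.degree)
    (hg : Summable fun q : Fin n →₀ ℕ => ‖MvPowerSeries.coeff q g‖ * t ^ q.degree) :
    Summable fun q : Fin n →₀ ℕ => ‖MvPowerSeries.coeff q (f * g)‖ * t ^ q.degree := by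
  have h0 : ∀ (e : MvPowerSeries (Fin n) ℂ) (q : Fin n →₀ ℕ),
      0 ≤ ‖MvPowerSeries.coeff q e‖ * t ^ q.degree :=
    fun e q => mul_nonneg (norm_nonneg _) (pow_nonneg ht _)
  have h3 := summable_antidiagonal hf hg (h0 f) (h0 g)
  refine Summable.of_nonneg_of_le (h0 _) (fun q => ?_) h3
  exact norm_coeff_mul_le f g t ht q

theorem IsConvergent.mul {n : ℕ} {f g : MvPowerSeries (Fin n) ℂ} (hf : IsConvergent f)
    (hg : IsConvergent g) : IsConvergent (f * g) := by
  obtain ⟨ρ, hρ, hs⟩ := hf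
  obtain ⟨σ, hσ, hs'⟩ := hg
  have hm : 0 < min ρ σ := lt_min hρ hσ
  exact ⟨min ρ σ, hm, summable_coeff_mul hm.le (summable_of_le hm.le (min_le_left _ _) hs)
    (summable_of_le hm.le (min_le_right _ _) hs')⟩

/-- The local ring `𝒪_{ℂⁿ,0}` of germs of holomorphic functions at the origin of `ℂⁿ`, as the
ring of convergent power series in `n` variables. -/
def convergentSeries (n : ℕ) : Subalgebra ℂ (MvPowerSeries (Fin n) ℂ) where
  carrier := {f | IsConvergent f}
  mul_mem' := IsConvergent.mul
  add_mem' := IsConvergent.add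
  algebraMap_mem' c := IsConvergent.monomial 0 c

/-- `𝒪_{ℂⁿ,0}` as a type. -/
abbrev O (n : ℕ) : Type := convergentSeries n

/-- The coefficient of `f` at the monomial `z^q`. -/
def coeff {n : ℕ} (q : Fin n →₀ ℕ) (f : O n) : ℂ :=
  MvPowerSeries.coeff q (f : MvPowerSeries (Fin n) ℂ)

/-- The set of exponents of the monomials that occur in `f`. -/
def supp {n : ℕ} (f : O n) : Set (Fin n →₀ ℕ) :=
  {q | coeff q f ≠ 0}

/-- The monomial `z^q`. -/
def mono {n : ℕ} (q : Fin n →₀ ℕ) : O n :=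
  ⟨MvPowerSeries.monomial q 1, IsConvergent.monomial q 1⟩

/-- `f` is convenient: for every variable it contains a power of that variable. -/
def IsConvenient {n : ℕ} (f : O n) : Prop :=
  ∀ i : Fin n, ∃ l : ℕ, Finsupp.single i l ∈ supp f

/-- The ideal generated by a finite family of germs. -/
def idealOf {n k : ℕ} (g : Fin k → O n) : Ideal (O n) :=
  Ideal.span (Set.range g)

/-- The local ring `𝒪_{Y,0}` of the subspace `(Y,0)` of `(ℂⁿ,0)` defined by `g`. -/
abbrev OY {n k : ℕ} (g : Fin k → O n) : Type :=
  O n ⧸ idealOf g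

/-- `g_1, …, g_k` define a complete intersection `(Y,0)` in `(ℂⁿ,0)`: the germ at the origin of
their zero space is non-empty and has dimension `n - k`. The dimension of a germ of a complex
space is the Krull dimension of its local ring (`⊥` for the zero ring, so for the empty germ). -/
def IsCompleteIntersection {n k : ℕ} (g : Fin k → O n) : Prop :=
  ringKrullDim (OY g) + (k : WithBot ℕ∞) = (n : WithBot ℕ∞)

/-- `g_1, …, g_k` define a subspace of `(ℂⁿ,0)` of codimension `n - dim` at least `c`.
The empty germ has codimension at least every `c`. -/
def HasCodimGE {n k : ℕ} (g : Fin k → O n) (c : ℤ) : Prop :=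
  ∀ d : ℕ, (d : WithBot ℕ∞) ≤ ringKrullDim (OY g) → c ≤ (n : ℤ) - d

/-- The Newton polyhedron of `f`: the convex hull of `supp f + ℝ₊ⁿ`. -/
def newtonPolyhedron {n : ℕ} (f : O n) : Set (Fin n → ℝ) :=
  convexHull ℝ {x | ∃ q ∈ supp f, ∃ y : Fin n → ℝ, 0 ≤ y ∧ x = (fun i => (q i : ℝ)) + y}

/-- `σ` is a compact facet of `P ⊆ ℝⁿ`: a non-empty compact face of dimension `n - 1`. -/
def IsCompactFacet {n : ℕ} (P σ : Set (Fin n → ℝ)) : Prop :=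
  IsExposed ℝ P σ ∧ σ.Nonempty ∧ IsCompact σ ∧ Module.finrank ℝ (vectorSpan ℝ σ) + 1 = n

/-- `v ∈ ℕⁿ` has relatively prime components and is orthogonal to a compact facet of `P`. -/
def IsPrimitiveFacetNormal {n : ℕ} (P : Set (Fin n → ℝ)) (v : Fin n → ℕ) : Prop :=
  Finset.univ.gcd v = 1 ∧
    ∃ σ, IsCompactFacet P σ ∧
      ∀ x ∈ σ, ∀ y ∈ σ, ∑ i, (v i : ℝ) * x i = ∑ i, (v i : ℝ) * y i

/-- `P` is bistellar: any two of its compact facets intersect. -/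
def IsBistellar {n : ℕ} (P : Set (Fin n → ℝ)) : Prop :=
  ∀ σ τ, IsCompactFacet P σ → IsCompactFacet P τ → (σ ∩ τ).Nonempty

/-- `p_1, …, p_r` is a list without repetition of all primitive normals in `ℕⁿ` of the compact
facets of `P`. -/
def IsFacetNormalList {n r : ℕ} (P : Set (Fin n → ℝ)) (p : Fin r → Fin n → ℕ) : Prop :=
  Function.Injective p ∧ Set.range p = {v | IsPrimitiveFacetNormal P v}

/-- The pairing `⟨v, q⟩` of a weight vector with an exponent. -/
def pairing {n : ℕ} (v : Fin n → ℕ) (q : Fin n →₀ ℕ) : ℕ :=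
  ∑ i, v i * q i

/-- The maximal `ν` such that `⟨v, q⟩ ≥ ν` for all monomials `z^q` that occur in `f`; for
`f ≠ 0` this is the minimum of `⟨v, q⟩`. -/
def order {n : ℕ} (v : Fin n → ℕ) (f : O n) : ℕ :=
  sInf (pairing v '' supp f)

open Classical in
/-- The initial part `in_J f` for a set `J = {j_1, …, j_s}` of indices: the sum of those terms
`c_q z^q` of `f` for which `⟨p_j, q⟩` is minimal for every `j ∈ J`. -/
def initialPart {n r : ℕ} (p : Fin r → Fin n → ℕ) (J : Finset (Fin r)) (f : O n) : O n :=
  ⟨fun q => if ∀ j ∈ J, pairing (p j) q = order (p j) f then coeff q f else 0,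
    IsConvergent.of_coeff_le f.2 fun q => by
      change ‖(if _ then _ else _ : ℂ)‖ ≤ _
      split_ifs
      · exact le_rfl
      · simp⟩

/-- The ideal `F_μ 𝒪_{ℂⁿ,0}` generated by all `z^q` with `⟨p_l, q⟩ ≥ μ_l` for all `l`. -/
def F {n r : ℕ} (p : Fin r → Fin n → ℕ) (μ : Fin r → ℤ) : Ideal (O n) :=
  Ideal.span (mono '' {q | ∀ l, μ l ≤ (pairing (p l) q : ℤ)})

/-- The induced filtration on `𝒪_{Y,0}`: `F_μ 𝒪_{Y,0}` is the image of `F_μ 𝒪_{ℂⁿ,0}`. -/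
def FY {n k r : ℕ} (g : Fin k → O n) (p : Fin r → Fin n → ℕ) (μ : Fin r → ℤ) : Ideal (OY g) :=
  (F p μ).map (Ideal.Quotient.mk (idealOf g))

/-- The Ebeling–Gusein-Zade filtration on `𝒪_{Y,0}`:
`F_{μ_1 e_1} 𝒪_{Y,0} ∩ … ∩ F_{μ_r e_r} 𝒪_{Y,0}`. -/
def EGY {n k r : ℕ} (g : Fin k → O n) (p : Fin r → Fin n → ℕ) (μ : Fin r → ℤ) : Ideal (OY g) :=
  ⨅ l : Fin r, FY g p (Pi.single l (μ l))

/-- For all `s ≥ s₀` and `j_1 < … < j_s`, the initial parts `in_{j_1, …, j_s} g_i`,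
`i = 1, …, k`, define a subspace of `(ℂⁿ,0)` of codimension at least `k - s + c`. -/
def InitialCodim {n k r : ℕ} (g : Fin k → O n) (p : Fin r → Fin n → ℕ) (s₀ : ℕ) (c : ℤ) : Prop :=
  ∀ J : Finset (Fin r), s₀ ≤ J.card →
    HasCodimGE (fun i => initialPart p J (g i)) ((k : ℤ) - J.card + c)

end

end NewtonFiltration

/-!
# The induced and the Ebeling–Gusein-Zade filtration coincide

The filtration `F_μ` is encoded in its extended Rees ring: the polynomial ring `S = ℂ[z, u]`,
graded by `ℤ^r` through `deg z_i = (p_1i, …, p_ri)` and `deg u_l = -e_l`, has the property that its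
homogeneous elements of degree `μ` are the polynomials in `F_μ` (`hom`, `dehom`). The equations
`g_m` homogenize to elements `G_m` of `S`, and the fibre of `V(G) → ℂ^r` over a point of the stratum
where exactly the coordinates `u_j`, `j ∈ J`, vanish is defined by the initial parts `in_J g_m`,
up to the action of a torus. So the bound on the dimension of `in_J g = 0` for `|J| ≥ 2` says that
`V(G) ∩ {u_i = u_j = 0}` has the expected codimension `k + 2` for `i ≠ j` (`trdeg_rees_le`). As `S`
is Cohen–Macaulay, `u_j, G_1, …, G_k, u_i` is a regular sequence at the origin
(`exists_mul_mem_of_trdeg_le`), and by homogeneity everywhere (`getElem_mul_mem_rees`). Hence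
every `u_j` is a non-zero-divisor modulo `G`, which means that elements of `I ∩ F_μ` are
combinations of the `g_m` compatible with the filtration (`hom_mem_span_of_mem`), and `u_i` is a
non-zero-divisor modulo `(G, u_j)`, which then gives
`(F_{λ + e_i} + I) ∩ (F_{λ + e_j} + I) = F_{λ + e_i + e_j} + I` (`polyF_sup_inf_le`). Walking along
lattice paths one gets the same for the intersection of any `F_α + I` and `F_β + I`
(`inf_le_sup_of_step`), and so the equality of the two filtrations.

The algebra takes place in polynomial rings, whereas the theorem is about convergent power series.
Since the normals `p_l` are positive, every `F_μ` contains a power of the maximal ideal, so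
that the series can be truncated (`FY_eq_EGY_of_initialCodim`). The dimension hypothesis concerns
`𝒪_{ℂⁿ,0}`, which is shown to be Noetherian of dimension at most `n` by the division theorem
(`exists_division`); a system of parameters of a quotient of `𝒪_{ℂⁿ,0}` consists of polynomials up
to higher order, so that the bound carries over to transcendence degrees of quotients of the
polynomial ring (`trdeg_le_of_ringKrullDim_le`).

For `k = 1`, the initial part for `j₁, j₂` is non-zero if and only if some exponent of `g`
minimizes both normals, that is, if and only if the two facets meet (`inter_nonempty_iff`). Every
compact facet does have a primitive normal, because it is spanned by integral points
(`IsCompactFacet.exists_primitive`).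
-/

namespace NewtonFiltration

open Finset

/-! ### Division of convergent power series -/

/-- The multiplicative weight `∏ π_i ^ q_i` of an exponent `q`, where `π_i` is the `i`-th prime.
By unique factorization it is injective, so that `q ↦ log (wt q)` is a positive linear form that
orders the monomials totally. -/
noncomputable def wt {n : ℕ} (q : Fin n →₀ ℕ) : ℕ := ∏ i : Fin n, Nat.nth Nat.Prime i ^ q i

theorem prime_nth (i : ℕ) : (Nat.nth Nat.Prime i).Prime := Nat.prime_nth_prime i

theorem wt_pos {n : ℕ} (q : Fin n →₀ ℕ) : 0 < wt q :=
  Finset.prod_pos fun i _ => pow_pos (prime_nth i).pos _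

theorem wt_add {n : ℕ} (a b : Fin n →₀ ℕ) : wt (a + b) = wt a * wt b := by
  simp [wt, pow_add, Finset.prod_mul_distrib]

theorem wt_injective {n : ℕ} : Function.Injective (wt (n := n)) := by
  intro q q' h
  have key : ∀ (q : Fin n →₀ ℕ) (j : Fin n),
      (wt q).factorization (Nat.nth Nat.Prime j) = q j := by
    intro q j
    rw [wt, Nat.factorization_prod fun (i : Fin n) _ => pow_ne_zero (q i) (prime_nth i).ne_zero]
    simp only [(prime_nth _).factorization_pow, Finsupp.coe_finsetSum, Finset.sum_apply]
    rw [Finset.sum_eq_single j]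
    · simp
    · intro i _ hij
      rw [Finsupp.single_eq_of_ne]
      exact fun h => hij (Fin.ext ((Nat.nth_injective Nat.infinite_setOfPred_prime h).symm))
    · simp
  ext j
  rw [← key q, ← key q', h]

theorem wt_mono {n : ℕ} {a b : Fin n →₀ ℕ} (h : a ≤ b) : wt a ≤ wt b := by
  obtain ⟨c, rfl⟩ := exists_add_of_le h
  rw [wt_add]
  exact Nat.le_mul_of_pos_right _ (wt_pos c)

theorem two_pow_degree_le_wt {n : ℕ} (q : Fin n →₀ ℕ) : 2 ^ q.degree ≤ wt q := by
  rw [Finsupp.degree_eq_sum, ← Finset.prod_pow_eq_pow_sum, wt]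
  exact Finset.prod_le_prod' fun i _ => Nat.pow_le_pow_left (prime_nth i).two_le _

theorem exists_wt_le_pow_degree (n : ℕ) :
    ∃ P : ℕ, 0 < P ∧ ∀ q : Fin n →₀ ℕ, wt q ≤ P ^ q.degree := by
  refine ⟨∏ i : Fin n, Nat.nth Nat.Prime i, Finset.prod_pos fun i _ => (prime_nth i).pos,
    fun q => ?_⟩
  rw [Finsupp.degree_eq_sum, ← Finset.prod_pow_eq_pow_sum, wt]
  refine Finset.prod_le_prod' fun i _ => Nat.pow_le_pow_left ?_ _
  exact Nat.le_of_dvd (Finset.prod_pos fun i _ => (prime_nth i).pos)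
    (Finset.dvd_prod_of_mem _ (Finset.mem_univ i))

/-- The real weight `(wt q)⁻ˢ`; convergence of a power series is summability against it for some
`s`. -/
noncomputable def rwt {n : ℕ} (s : ℕ) (q : Fin n →₀ ℕ) : ℝ := ((wt q : ℝ)⁻¹) ^ s

theorem rwt_pos {n : ℕ} (s : ℕ) (q : Fin n →₀ ℕ) : 0 < rwt s q :=
  pow_pos (inv_pos.mpr (by exact_mod_cast wt_pos q)) s

theorem rwt_add {n : ℕ} (s : ℕ) (a b : Fin n →₀ ℕ) : rwt s (a + b) = rwt s a * rwt s b := by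
  simp [rwt, wt_add, mul_pow, mul_comm]

theorem inv_wt_le_one {n : ℕ} (q : Fin n →₀ ℕ) : ((wt q : ℝ)⁻¹) ≤ 1 :=
  inv_le_one_of_one_le₀ (by exact_mod_cast wt_pos q)

theorem rwt_anti {n : ℕ} {s t : ℕ} (h : s ≤ t) (q : Fin n →₀ ℕ) : rwt t q ≤ rwt s q :=
  pow_le_pow_of_le_one (by positivity) (inv_wt_le_one q) h

theorem IsConvergent.exists_rwt {n : ℕ} {f : MvPowerSeries (Fin n) ℂ} (hf : IsConvergent f) :
    ∃ s₀, ∀ s, s₀ ≤ s → Summable fun q => ‖MvPowerSeries.coeff q f‖ * rwt s q := by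
  obtain ⟨ρ, hρ, hs⟩ := hf
  obtain ⟨s₀, hs₀⟩ := exists_pow_lt_of_lt_one hρ (by norm_num : (2⁻¹ : ℝ) < 1)
  refine ⟨s₀, fun s hs1 => Summable.of_nonneg_of_le
    (fun q => mul_nonneg (norm_nonneg _) (rwt_pos _ _).le) (fun q => ?_) hs⟩
  refine mul_le_mul_of_nonneg_left ?_ (norm_nonneg _)
  refine (rwt_anti hs1 q).trans ?_
  have h1 : (wt q : ℝ)⁻¹ ≤ (2⁻¹ : ℝ) ^ q.degree := by
    rw [inv_pow]
    exact inv_anti₀ (by positivity) (by exact_mod_cast two_pow_degree_le_wt q)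
  calc rwt s₀ q ≤ ((2⁻¹ : ℝ) ^ q.degree) ^ s₀ := pow_le_pow_left₀ (by positivity) h1 _
    _ = ((2⁻¹ : ℝ) ^ s₀) ^ q.degree := by rw [← pow_mul, ← pow_mul, mul_comm]
    _ ≤ ρ ^ q.degree := pow_le_pow_left₀ (by positivity) hs₀.le _

theorem isConvergent_of_rwt {n : ℕ} {f : MvPowerSeries (Fin n) ℂ} {s : ℕ}
    (h : Summable fun q => ‖MvPowerSeries.coeff q f‖ * rwt s q) : IsConvergent f := by
  obtain ⟨P, hP, hle⟩ := exists_wt_le_pow_degree n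
  refine ⟨((P : ℝ)⁻¹) ^ s, by positivity, Summable.of_nonneg_of_le
    (fun q => by positivity) (fun q => ?_) h⟩
  refine mul_le_mul_of_nonneg_left ?_ (norm_nonneg _)
  rw [← pow_mul, mul_comm s, pow_mul, rwt]
  refine pow_le_pow_left₀ (by positivity) ?_ _
  rw [inv_pow]
  refine inv_anti₀ (by exact_mod_cast wt_pos q) (by exact_mod_cast hle q)

@[simp] theorem coeff_add {n : ℕ} (q : Fin n →₀ ℕ) (f g : O n) :
    coeff q (f + g) = coeff q f + coeff q g := by simp [coeff]

@[simp] theorem coeff_sub {n : ℕ} (q : Fin n →₀ ℕ) (f g : O n) :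
    coeff q (f - g) = coeff q f - coeff q g := by simp [coeff]

@[simp] theorem coeff_zero {n : ℕ} (q : Fin n →₀ ℕ) : coeff q (0 : O n) = 0 := by simp [coeff]

@[simp] theorem coeff_smul {n : ℕ} (q : Fin n →₀ ℕ) (c : ℂ) (f : O n) :
    coeff q (c • f) = c * coeff q f := by simp [coeff]

theorem coeff_sum {n : ℕ} {ι : Type*} (q : Fin n →₀ ℕ) (s : Finset ι) (f : ι → O n) :
    coeff q (∑ i ∈ s, f i) = ∑ i ∈ s, coeff q (f i) := by
  classical
  induction s using Finset.induction_on with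
  | empty => simp
  | insert a s ha ih => rw [Finset.sum_insert ha, Finset.sum_insert ha, coeff_add, ih]

theorem coeff_mul {n : ℕ} (q : Fin n →₀ ℕ) (f g : O n) :
    coeff q (f * g) = ∑ x ∈ antidiagonal q, coeff x.1 f * coeff x.2 g := by
  simp [coeff, MvPowerSeries.coeff_mul]

theorem ext_coeff {n : ℕ} {f g : O n} (h : ∀ q, coeff q f = coeff q g) : f = g :=
  Subtype.ext (MvPowerSeries.ext h)

open Classical in
theorem coeff_mono {n : ℕ} (q a : Fin n →₀ ℕ) : coeff q (mono a) = if q = a then 1 else 0 := by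
  simp [coeff, mono, MvPowerSeries.coeff_monomial]

/-- For large `s` the leading term of a series dominates all the other terms together: as the
weight is injective, the quotient of any other weight by the leading one is bounded away from
`1`. -/
theorem exists_tail_le {n : ℕ} (f : O n) (a : Fin n →₀ ℕ)
    (h : ∀ q, coeff q f ≠ 0 → wt a ≤ wt q) :
    ∃ s₀, ∀ s, s₀ ≤ s → ∀ u : Finset (Fin n →₀ ℕ), a ∉ u →
      ∑ q ∈ u, ‖coeff q f‖ * rwt s q ≤ rwt s a / 2 := by
  obtain ⟨s₁, hs₁⟩ := IsConvergent.exists_rwt f.2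
  have hS := hs₁ s₁ le_rfl
  set C := ∑' q, ‖MvPowerSeries.coeff q f.1‖ * rwt s₁ q
  have hC : 0 ≤ C := tsum_nonneg fun q => mul_nonneg (norm_nonneg _) (rwt_pos _ _).le
  have hw : (0 : ℝ) < wt a := by exact_mod_cast wt_pos a
  have hlt : (wt a : ℝ) / (wt a + 1) < 1 := by rw [div_lt_one (by positivity)]; linarith
  have hδ : 0 < rwt s₁ a / (2 * (C + 1)) := div_pos (rwt_pos _ _) (by positivity)
  obtain ⟨t₀, ht₀⟩ := exists_pow_lt_of_lt_one hδ hlt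
  refine ⟨s₁ + t₀, fun s hs u hu => ?_⟩
  obtain ⟨t, rfl, ht⟩ : ∃ t, s = s₁ + t ∧ t₀ ≤ t := ⟨s - s₁, by omega, by omega⟩
  have hterm : ∀ q ∈ u, ‖coeff q f‖ * rwt (s₁ + t) q ≤
      ‖coeff q f‖ * rwt s₁ q * ((wt a + 1 : ℝ)⁻¹) ^ t := by
    intro q hq
    by_cases h0 : coeff q f = 0
    · simp [h0]
    have h1 : wt a < wt q := lt_of_le_of_ne (h q h0) fun h' => hu (wt_injective h' ▸ hq)
    have h2 : ((wt q : ℝ)⁻¹) ^ t ≤ ((wt a + 1 : ℝ)⁻¹) ^ t :=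
      pow_le_pow_left₀ (by positivity) (inv_anti₀ (by positivity) (by exact_mod_cast h1)) _
    rw [rwt, pow_add, ← mul_assoc]
    exact mul_le_mul_of_nonneg_left h2 (mul_nonneg (norm_nonneg _) (rwt_pos s₁ q).le)
  have h3 : ∑ q ∈ u, ‖coeff q f‖ * rwt s₁ q ≤ C :=
    hS.sum_le_tsum u fun q _ => mul_nonneg (norm_nonneg _) (rwt_pos _ _).le
  have h4 : ((wt a + 1 : ℝ)⁻¹) ^ t = ((wt a : ℝ) / (wt a + 1)) ^ t * ((wt a : ℝ)⁻¹) ^ t := by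
    rw [← mul_pow]; congr 1; field_simp
  have h5 : ((wt a : ℝ) / (wt a + 1)) ^ t ≤ rwt s₁ a / (2 * (C + 1)) :=
    (pow_le_pow_of_le_one (by positivity) hlt.le ht).trans ht₀.le
  calc ∑ q ∈ u, ‖coeff q f‖ * rwt (s₁ + t) q
      ≤ ∑ q ∈ u, ‖coeff q f‖ * rwt s₁ q * ((wt a + 1 : ℝ)⁻¹) ^ t := Finset.sum_le_sum hterm
    _ = (∑ q ∈ u, ‖coeff q f‖ * rwt s₁ q) * ((wt a + 1 : ℝ)⁻¹) ^ t := by rw [Finset.sum_mul]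
    _ ≤ C * ((wt a + 1 : ℝ)⁻¹) ^ t := mul_le_mul_of_nonneg_right h3 (by positivity)
    _ ≤ (C + 1) * (rwt s₁ a / (2 * (C + 1)) * ((wt a : ℝ)⁻¹) ^ t) := by
        rw [h4]
        gcongr
        linarith
    _ = rwt (s₁ + t) a / 2 := by
        rw [rwt, rwt, pow_add]; field_simp

/-- Over a set of exponents closed under passing to smaller ones, the sum of a convolution of
non-negative functions is at most the product of the sums. -/
theorem sum_antidiagonal_le {n : ℕ} (U : Finset (Fin n →₀ ℕ)) (hU : ∀ q ∈ U, ∀ q' ≤ q, q' ∈ U)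
    (A B : (Fin n →₀ ℕ) → ℝ) (hA : ∀ q, 0 ≤ A q) (hB : ∀ q, 0 ≤ B q) :
    ∑ q ∈ U, ∑ x ∈ antidiagonal q, A x.1 * B x.2 ≤ (∑ q ∈ U, A q) * ∑ q ∈ U, B q := by
  classical
  rw [Finset.sum_mul_sum, ← Finset.sum_product', Finset.sum_sigma']
  rw [← Finset.sum_image (s := U.sigma fun q => antidiagonal q) (g := fun y => y.2)
    (f := fun x => A x.1 * B x.2)]
  · refine Finset.sum_le_sum_of_subset_of_nonneg ?_ fun x _ _ => mul_nonneg (hA _) (hB _)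
    intro x hx
    obtain ⟨⟨q, y⟩, hy, rfl⟩ := Finset.mem_image.mp hx
    rw [Finset.mem_sigma, Finset.HasAntidiagonal.mem_antidiagonal] at hy
    obtain ⟨h1, h2⟩ := hy
    dsimp at h1 h2 ⊢
    exact Finset.mem_product.mpr ⟨hU q h1 _ (h2 ▸ le_self_add), hU q h1 _ (h2 ▸ le_add_self)⟩
  · rintro ⟨q, y⟩ hy ⟨q', y'⟩ hy' (rfl : y = y')
    rw [Finset.mem_coe, Finset.mem_sigma, Finset.HasAntidiagonal.mem_antidiagonal] at hy hy'
    obtain rfl : q = q' := hy.2.symm.trans hy'.2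
    rfl

section Division

variable {n : ℕ} {ι : Type} [Fintype ι]

open Classical in
/-- A choice, for every exponent `q` divisible by one of the leading exponents `a i`, of such an
index `i`. -/
noncomputable def divisorIndex (a : ι → Fin n →₀ ℕ) (q : Fin n →₀ ℕ) : Option ι :=
  if h : ∃ i, a i ≤ q then some h.choose else none

theorem le_of_divisorIndex {a : ι → Fin n →₀ ℕ} {q : Fin n →₀ ℕ} {i : ι}
    (h : divisorIndex a q = some i) : a i ≤ q := by
  unfold divisorIndex at h
  split_ifs at h with h'
  simp only [Option.some.injEq] at h
  exact h ▸ h'.choose_spec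

theorem divisorIndex_eq_none {a : ι → Fin n →₀ ℕ} {q : Fin n →₀ ℕ} :
    divisorIndex a q = none ↔ ∀ i, ¬ a i ≤ q := by
  simp [divisorIndex]

open Classical in
/-- The coefficients of the series `∑ z^{a i} H i + R` for the division
`h = ∑ H i * f i + R` with remainder, determined recursively along the weight. -/
noncomputable def divisionCoeff (a : ι → Fin n →₀ ℕ) (f : ι → O n) (h : O n)
    (q : Fin n →₀ ℕ) : ℂ :=
  coeff q h - ∑ i, ∑ x ∈ antidiagonal q,
    if _hlt : wt (a i + x.1) < wt q then
      if divisorIndex a (a i + x.1) = some i then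
        divisionCoeff a f h (a i + x.1) * coeff x.2 (f i) else 0
    else 0
termination_by wt q

open Classical in
/-- The coefficients of the quotient `H i`. -/
noncomputable def quotCoeff (a : ι → Fin n →₀ ℕ) (f : ι → O n) (h : O n) (i : ι)
    (b : Fin n →₀ ℕ) : ℂ :=
  if divisorIndex a (a i + b) = some i then divisionCoeff a f h (a i + b) else 0

open Classical in
theorem divisionCoeff_eq (a : ι → Fin n →₀ ℕ) (f : ι → O n) (h : O n) (q : Fin n →₀ ℕ) :
    divisionCoeff a f h q = coeff q h - ∑ i, ∑ x ∈ antidiagonal q,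
      if wt (a i + x.1) < wt q then quotCoeff a f h i x.1 * coeff x.2 (f i) else 0 := by
  rw [divisionCoeff]
  congr 1
  refine Finset.sum_congr rfl fun i _ => Finset.sum_congr rfl fun x _ => ?_
  by_cases h1 : wt (a i + x.1) < wt q
  · simp only [h1, dite_true, if_true, quotCoeff, ite_mul, zero_mul]
  · simp [h1]

open Classical in
/-- Bounding the coefficients of the division: their weighted sum `M` over a finite set satisfies
`M ≤ ‖h‖ + M / 2`. -/
theorem sum_divisionCoeff_le {a : ι → Fin n →₀ ℕ} {f : ι → O n} {h : O n} {s : ℕ} {C : ℝ}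
    (hC : ∀ u : Finset (Fin n →₀ ℕ), ∑ q ∈ u, ‖coeff q h‖ * rwt s q ≤ C)
    (hf : ∀ i, ∀ u : Finset (Fin n →₀ ℕ), a i ∉ u →
      ∑ q ∈ u, ‖coeff q (f i)‖ * rwt s q ≤ rwt s (a i) / 2)
    (u : Finset (Fin n →₀ ℕ)) :
    ∑ q ∈ u, ‖divisionCoeff a f h q‖ * rwt s q ≤ 2 * C := by
  set E := divisionCoeff a f h with hE
  obtain ⟨m, hm⟩ : ∃ m, ∀ q ∈ u, wt q ≤ m :=
    ⟨u.sup wt, fun q hq => Finset.le_sup (f := wt) hq⟩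
  have hfin : {q : Fin n →₀ ℕ | wt q ≤ m}.Finite :=
    (Set.finite_Iic m).preimage wt_injective.injOn
  set U := hfin.toFinset with hUdef
  have hU : ∀ q, q ∈ U ↔ wt q ≤ m := by simp [hUdef]
  have hUd : ∀ q ∈ U, ∀ q' ≤ q, q' ∈ U := fun q hq q' h' =>
    (hU _).mpr ((wt_mono h').trans ((hU _).mp hq))
  set M := ∑ q ∈ U, ‖E q‖ * rwt s q with hM
  set A : ι → (Fin n →₀ ℕ) → ℝ := fun i b =>
    if a i + b ∈ U ∧ divisorIndex a (a i + b) = some i then ‖E (a i + b)‖ * rwt s b else 0 with hA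
  set B : ι → (Fin n →₀ ℕ) → ℝ := fun i c =>
    if c = a i then 0 else ‖coeff c (f i)‖ * rwt s c with hB
  have hA0 : ∀ i q, 0 ≤ A i q := fun i q => by
    simp only [hA]; split_ifs; exacts [mul_nonneg (norm_nonneg _) (rwt_pos _ _).le, le_rfl]
  have hB0 : ∀ i q, 0 ≤ B i q := fun i q => by
    simp only [hB]; split_ifs; exacts [le_rfl, mul_nonneg (norm_nonneg _) (rwt_pos _ _).le]
  have hpt : ∀ q ∈ U, ‖E q‖ * rwt s q ≤ ‖coeff q h‖ * rwt s q +
      ∑ i, ∑ x ∈ antidiagonal q, A i x.1 * B i x.2 := by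
    intro q hq
    have h1 : ‖E q‖ ≤ ‖coeff q h‖ + ∑ i, ∑ x ∈ antidiagonal q,
        ‖if wt (a i + x.1) < wt q then quotCoeff a f h i x.1 * coeff x.2 (f i) else 0‖ := by
      rw [hE, divisionCoeff_eq]
      refine (norm_sub_le _ _).trans (add_le_add le_rfl ?_)
      exact (norm_sum_le _ _).trans (Finset.sum_le_sum fun i _ => norm_sum_le _ _)
    refine (mul_le_mul_of_nonneg_right h1 (rwt_pos s q).le).trans ?_
    rw [add_mul, Finset.sum_mul]
    refine add_le_add le_rfl (Finset.sum_le_sum fun i _ => ?_)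
    rw [Finset.sum_mul]
    refine Finset.sum_le_sum fun x hx => ?_
    rw [Finset.HasAntidiagonal.mem_antidiagonal] at hx
    split_ifs with hlt
    · have hne : x.2 ≠ a i := by
        rintro h'
        rw [← h', add_comm, hx] at hlt
        exact lt_irrefl _ hlt
      by_cases hs : divisorIndex a (a i + x.1) = some i
      · have hmem : a i + x.1 ∈ U := (hU _).mpr (hlt.le.trans ((hU _).mp hq))
        simp only [hA, hB, hs, hmem, hne, and_self, if_true, if_false, quotCoeff]
        rw [← hx, rwt_add, norm_mul]
        exact le_of_eq (by ring)
      · simp only [quotCoeff, hs, if_false, zero_mul, norm_zero]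
        exact mul_nonneg (hA0 _ _) (hB0 _ _)
    · rw [norm_zero, zero_mul]
      exact mul_nonneg (hA0 _ _) (hB0 _ _)
  have hBsum : ∀ i, ∑ c ∈ U, B i c ≤ rwt s (a i) / 2 := by
    intro i
    refine le_trans (le_of_eq ?_) (hf i (U.filter fun c => ¬ c = a i) (by simp))
    rw [Finset.sum_filter]
    exact Finset.sum_congr rfl fun c _ => by by_cases hc : c = a i <;> simp [hB, hc]
  have hAsum : ∑ i, (∑ b ∈ U, A i b) * rwt s (a i) ≤ M := by
    simp_rw [Finset.sum_mul]
    have h1 : ∀ i, ∀ b ∈ U, A i b * rwt s (a i) =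
        if a i + b ∈ U ∧ divisorIndex a (a i + b) = some i then
          ‖E (a i + b)‖ * rwt s (a i + b) else 0 := by
      intro i b _
      simp only [hA]
      split_ifs
      · rw [rwt_add]; ring
      · rw [zero_mul]
    rw [Finset.sum_congr rfl fun i _ => Finset.sum_congr rfl (h1 i), ← Finset.sum_product',
      ← Finset.sum_filter]
    rw [← Finset.sum_image (g := fun y : ι × (Fin n →₀ ℕ) => a y.1 + y.2)
      (f := fun q => ‖E q‖ * rwt s q)]
    · refine Finset.sum_le_sum_of_subset_of_nonneg ?_
        fun x _ _ => mul_nonneg (norm_nonneg _) (rwt_pos _ _).le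
      intro x hx
      obtain ⟨y, hy, rfl⟩ := Finset.mem_image.mp hx
      exact (Finset.mem_filter.mp hy).2.1
    · rintro ⟨i, b⟩ hy ⟨i', b'⟩ hy' heq
      dsimp at heq
      have h2 := (Finset.mem_filter.mp (Finset.mem_coe.mp hy)).2.2
      have h3 := (Finset.mem_filter.mp (Finset.mem_coe.mp hy')).2.2
      dsimp at h2 h3
      rw [heq, h3] at h2
      obtain rfl : i' = i := by simpa using h2
      simpa using heq
  have hMle : M ≤ C + M / 2 := by
    calc M ≤ ∑ q ∈ U, (‖coeff q h‖ * rwt s q + ∑ i, ∑ x ∈ antidiagonal q, A i x.1 * B i x.2) :=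
          Finset.sum_le_sum hpt
      _ = ∑ q ∈ U, ‖coeff q h‖ * rwt s q +
          ∑ i, ∑ q ∈ U, ∑ x ∈ antidiagonal q, A i x.1 * B i x.2 := by
          rw [Finset.sum_add_distrib, Finset.sum_comm (s := U)]
      _ ≤ C + ∑ i, (∑ b ∈ U, A i b) * (rwt s (a i) / 2) := by
          refine add_le_add (hC U) (Finset.sum_le_sum fun i _ => ?_)
          refine (sum_antidiagonal_le U hUd _ _ (hA0 i) (hB0 i)).trans ?_
          exact mul_le_mul_of_nonneg_left (hBsum i) (Finset.sum_nonneg fun _ _ => hA0 _ _)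
      _ = C + (∑ i, (∑ b ∈ U, A i b) * rwt s (a i)) / 2 := by
          rw [Finset.sum_div]; simp_rw [mul_div_assoc]
      _ ≤ C + M / 2 := by linarith
  refine le_trans ?_ (by linarith : M ≤ 2 * C)
  exact Finset.sum_le_sum_of_subset_of_nonneg (fun q hq => (hU q).mpr (hm q hq))
    fun x _ _ => mul_nonneg (norm_nonneg _) (rwt_pos _ _).le

open Classical in
/-- **Division with remainder** of convergent power series. If `z^{a i}` is the leading term of
`f i` with respect to the weight, every `h` is `∑ H i * f i + R` where no monomial of `R` is
divisible by a `z^{a i}`. -/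
theorem exists_division (a : ι → Fin n →₀ ℕ) (f : ι → O n) (hlead : ∀ i, coeff (a i) (f i) = 1)
    (hmin : ∀ i q, coeff q (f i) ≠ 0 → wt (a i) ≤ wt q) (h : O n) :
    ∃ (H : ι → O n) (R : O n), h = ∑ i, H i * f i + R ∧ ∀ q i, a i ≤ q → coeff q R = 0 := by
  obtain ⟨s₁, hs₁⟩ := IsConvergent.exists_rwt h.2
  choose s₂ hs₂ using fun i => exists_tail_le (f i) (a i) (hmin i)
  set s := s₁ + ∑ i, s₂ i with hs
  have hsum := hs₁ s (by omega)
  set C := ∑' q, ‖MvPowerSeries.coeff q h.1‖ * rwt s q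
  have hE : Summable fun q => ‖divisionCoeff a f h q‖ * rwt s q := by
    refine summable_of_sum_le (c := 2 * C) (fun q => mul_nonneg (norm_nonneg _) (rwt_pos _ _).le)
      (sum_divisionCoeff_le (fun u => ?_) fun i => hs₂ i s ?_)
    · exact hsum.sum_le_tsum u fun q _ => mul_nonneg (norm_nonneg _) (rwt_pos _ _).le
    · exact (Finset.single_le_sum (fun _ _ => Nat.zero_le _) (Finset.mem_univ i)).trans
        (Nat.le_add_left _ _)
  have hH : ∀ i, IsConvergent (quotCoeff a f h i : MvPowerSeries (Fin n) ℂ) := by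
    intro i
    refine isConvergent_of_rwt (s := s) ?_
    have h1 := (hE.comp_injective (add_right_injective (a i))).mul_right (rwt s (a i))⁻¹
    refine Summable.of_nonneg_of_le (fun q => mul_nonneg (norm_nonneg _) (rwt_pos _ _).le)
      (fun q => ?_) h1
    change ‖quotCoeff a f h i q‖ * _ ≤ _
    simp only [Function.comp, quotCoeff, rwt_add]
    split_ifs
    · have := (rwt_pos s (a i)).ne'
      exact le_of_eq (by field_simp)
    · rw [norm_zero, zero_mul]
      have := rwt_pos s (a i)
      have := rwt_pos s q
      positivity
  have hR : IsConvergent (fun q => if divisorIndex a q = none then divisionCoeff a f h q else 0 :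
      MvPowerSeries (Fin n) ℂ) := by
    refine isConvergent_of_rwt (s := s) (Summable.of_nonneg_of_le
      (fun q => mul_nonneg (norm_nonneg _) (rwt_pos _ _).le) (fun q => ?_) hE)
    refine mul_le_mul_of_nonneg_right ?_ (rwt_pos _ _).le
    change ‖(if _ then _ else _ : ℂ)‖ ≤ _
    split_ifs <;> simp
  refine ⟨fun i => ⟨_, hH i⟩, ⟨_, hR⟩, ext_coeff fun q => ?_, fun q i hi => ?_⟩
  · rw [coeff_add, coeff_sum]
    have hterm : ∀ i, coeff q ((⟨_, hH i⟩ : O n) * f i) =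
        (∑ x ∈ antidiagonal q,
          if wt (a i + x.1) < wt q then quotCoeff a f h i x.1 * coeff x.2 (f i) else 0) +
        if divisorIndex a q = some i then divisionCoeff a f h q else 0 := by
      intro i
      rw [coeff_mul]
      have h1 : ∀ x ∈ antidiagonal q, coeff x.1 (⟨_, hH i⟩ : O n) * coeff x.2 (f i) =
          (if wt (a i + x.1) < wt q then quotCoeff a f h i x.1 * coeff x.2 (f i) else 0) +
          if x.2 = a i then quotCoeff a f h i x.1 else 0 := by
        intro x hx
        rw [Finset.HasAntidiagonal.mem_antidiagonal] at hx
        change quotCoeff a f h i x.1 * coeff x.2 (f i) = _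
        by_cases hxa : x.2 = a i
        · rw [if_neg, if_pos hxa, hxa, hlead, mul_one, zero_add]
          rw [← hx, hxa, add_comm]
          exact lt_irrefl _
        · rw [if_neg hxa, add_zero]
          by_cases h0 : coeff x.2 (f i) = 0
          · simp [h0]
          · rw [if_pos]
            have h2 : wt (a i) < wt x.2 :=
              lt_of_le_of_ne (hmin i _ h0) fun h' => hxa (wt_injective h'.symm)
            rw [← hx, wt_add, wt_add, mul_comm]
            exact Nat.mul_lt_mul_of_pos_left h2 (wt_pos _)
      rw [Finset.sum_congr rfl h1, Finset.sum_add_distrib]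
      congr 1
      split_ifs with hq
      · have hle := le_of_divisorIndex hq
        rw [Finset.sum_eq_single (q - a i, a i)]
        · simp only [if_true, quotCoeff]
          rw [add_tsub_cancel_of_le hle, if_pos hq]
        · rintro x hx hne
          rw [if_neg]
          rintro h'
          apply hne
          rw [Finset.HasAntidiagonal.mem_antidiagonal, h'] at hx
          exact Prod.ext (by rw [← hx]; simp) h'
        · intro hx
          exact absurd (Finset.HasAntidiagonal.mem_antidiagonal.mpr (tsub_add_cancel_of_le hle)) hx
      · refine Finset.sum_eq_zero fun x hx => ?_
        split_ifs with hxa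
        · rw [Finset.HasAntidiagonal.mem_antidiagonal, hxa, add_comm] at hx
          rw [quotCoeff, hx, if_neg hq]
        · rfl
    rw [Finset.sum_congr rfl fun i _ => hterm i, Finset.sum_add_distrib]
    change _ = _ + (if divisorIndex a q = none then divisionCoeff a f h q else 0)
    have h3 : (∑ i, if divisorIndex a q = some i then divisionCoeff a f h q else 0) +
        (if divisorIndex a q = none then divisionCoeff a f h q else 0) =
        divisionCoeff a f h q := by
      cases hd : divisorIndex a q with
      | none => simp
      | some j => simp
    rw [add_assoc, h3, divisionCoeff_eq a f h q]
    ring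
  · change (if divisorIndex a q = none then divisionCoeff a f h q else 0) = 0
    rw [if_neg]
    exact fun h' => divisorIndex_eq_none.mp h' i hi

end Division

/-! ### The ring of convergent power series -/

theorem exists_coeff_ne_zero {n : ℕ} {f : O n} (hf : f ≠ 0) : ∃ q, coeff q f ≠ 0 := by
  by_contra! h
  exact hf (ext_coeff fun q => by rw [h q, coeff_zero])

/-- The exponent of the leading term, that is, of least weight, of a non-zero series. -/
theorem exists_lead {n : ℕ} {f : O n} (hf : f ≠ 0) :
    ∃ a, coeff a f ≠ 0 ∧ ∀ q, coeff q f ≠ 0 → wt a ≤ wt q := by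
  obtain ⟨q₀, h₀⟩ := exists_coeff_ne_zero hf
  obtain ⟨a, ha, hmin⟩ := (measure (wt (n := n))).wf.has_min {q | coeff q f ≠ 0} ⟨q₀, h₀⟩
  exact ⟨a, ha, fun q hq => not_lt.mp (hmin q hq)⟩

/-- Series whose monomials are all divisible by some `z^{a i}` lie in the ideal generated by the
`z^{a i}`. -/
theorem mem_span_mono {n : ℕ} {ι : Type} [Finite ι] (a : ι → Fin n →₀ ℕ) {f : O n}
    (hf : ∀ q, coeff q f ≠ 0 → ∃ i, a i ≤ q) :
    f ∈ Ideal.span (Set.range fun i => (mono (a i) : O n)) := by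
  classical
  have := Fintype.ofFinite ι
  obtain ⟨H, R, hHR, hR⟩ := exists_division a (fun i => mono (a i))
    (fun i => by rw [coeff_mono, if_pos rfl])
    (fun i q hq => by
      rw [coeff_mono] at hq
      obtain rfl : q = a i := by by_contra h; simp [h] at hq
      exact le_rfl) f
  have hR0 : R = 0 := by
    refine ext_coeff fun q => ?_
    rw [coeff_zero]
    by_cases hq : ∃ i, a i ≤ q
    · exact hR q _ hq.choose_spec
    have h1 : coeff q f = 0 := by
      by_contra h
      exact hq (hf q h)
    rw [hHR, coeff_add, coeff_sum] at h1
    rw [Finset.sum_eq_zero, zero_add] at h1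
    · exact h1
    · intro i _
      rw [coeff_mul]
      refine Finset.sum_eq_zero fun x hx => ?_
      rw [coeff_mono, if_neg, mul_zero]
      rintro h
      rw [Finset.HasAntidiagonal.mem_antidiagonal, h] at hx
      exact hq ⟨i, hx ▸ le_add_self⟩
  rw [hHR, hR0, add_zero]
  exact Ideal.sum_mem _ fun i _ => Ideal.mul_mem_left _ _ (Ideal.subset_span ⟨i, rfl⟩)

theorem mono_add {n : ℕ} (a b : Fin n →₀ ℕ) : (mono (a + b) : O n) = mono a * mono b :=
  Subtype.ext (by simp [mono, MvPowerSeries.monomial_mul_monomial])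

theorem mono_zero {n : ℕ} : (mono 0 : O n) = 1 := rfl

/-- **Rückert's basis theorem**: every ideal is generated by finitely many elements whose leading
exponents generate all leading exponents, by division with remainder. -/
instance isNoetherianRing_O (n : ℕ) : IsNoetherianRing (O n) := by
  classical
  refine (isNoetherianRing_iff_ideal_fg _).mpr fun I => ?_
  set L : Set (Fin n →₀ ℕ) :=
    {a | ∃ f ∈ I, coeff a f = 1 ∧ ∀ q, coeff q f ≠ 0 → wt a ≤ wt q} with hL
  set A : Set (Fin n →₀ ℕ) := {a | Minimal (· ∈ L) a} with hA
  have hfin : A.Finite := by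
    refine WellQuasiOrderedLE.finite_of_isAntichain ?_
    intro a ha b hb hne hle
    exact hne (le_antisymm hle (hb.2 ha.1 hle))
  have := hfin.to_subtype
  have := Fintype.ofFinite A
  choose f hfI hf1 hfmin using fun a : A => a.2.1
  refine ⟨Finset.univ.image f, le_antisymm ?_ fun h hh => ?_⟩
  · rw [Ideal.span_le]
    rintro _ hx
    obtain ⟨a, _, rfl⟩ := Finset.mem_image.mp (Finset.mem_coe.mp hx)
    exact hfI a
  obtain ⟨H, R, hHR, hR⟩ := exists_division (fun a : A => a.1) f hf1 hfmin h
  have hRI : R ∈ I := by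
    have : R = h - ∑ i, H i * f i := by rw [hHR]; ring
    rw [this]
    exact I.sub_mem hh (Ideal.sum_mem _ fun i _ => I.mul_mem_left _ (hfI i))
  have hR0 : R = 0 := by
    by_contra hne
    obtain ⟨a, ha, hmin⟩ := exists_lead hne
    have haL : a ∈ L := by
      refine ⟨(coeff a R)⁻¹ • R, ?_, ?_, fun q hq => hmin q fun h0 => hq ?_⟩
      · rw [Algebra.smul_def]
        exact I.mul_mem_left _ hRI
      · rw [coeff_smul, inv_mul_cancel₀ ha]
      · rw [coeff_smul, h0, mul_zero]
    obtain ⟨b, hba, hb⟩ := exists_minimal_le_of_wellFoundedLT (· ∈ L) a haL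
    exact ha (hR a ⟨b, hb⟩ hba)
  rw [hHR, hR0, add_zero]
  exact Ideal.sum_mem _ fun i _ => Ideal.mul_mem_left _ _
    (Ideal.subset_span (by simp))

/-- The ideal of series all of whose monomials have degree at least `N`. -/
def tail (n N : ℕ) : Ideal (O n) where
  carrier := {f | ∀ q, q.degree < N → coeff q f = 0}
  add_mem' hf hg q hq := by rw [coeff_add, hf q hq, hg q hq, add_zero]
  zero_mem' q _ := coeff_zero q
  smul_mem' c f hf q hq := by
    rw [smul_eq_mul, coeff_mul]
    refine Finset.sum_eq_zero fun x hx => ?_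
    rw [Finset.HasAntidiagonal.mem_antidiagonal] at hx
    rw [hf x.2, mul_zero]
    rw [← hx, map_add] at hq
    omega

theorem mem_tail {n N : ℕ} {f : O n} : f ∈ tail n N ↔ ∀ q, q.degree < N → coeff q f = 0 := Iff.rfl

theorem coeff_zero_mul {n : ℕ} (f g : O n) : coeff 0 (f * g) = coeff 0 f * coeff 0 g := by
  simp [coeff_mul]

theorem coeff_zero_one {n : ℕ} : coeff 0 (1 : O n) = 1 := by
  rw [← mono_zero, coeff_mono, if_pos rfl]

theorem isUnit_iff_coeff_ne_zero {n : ℕ} {f : O n} : IsUnit f ↔ coeff 0 f ≠ 0 := by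
  constructor
  · intro h h0
    obtain ⟨g, hg⟩ := h.exists_right_inv
    have := coeff_zero_mul f g
    rw [hg, h0, zero_mul, coeff_zero_one] at this
    exact one_ne_zero this
  · intro h
    -- divide `1` by `f`: the leading exponent is `0`, so that there is no remainder
    obtain ⟨H, R, hHR, hR⟩ := exists_division (ι := Unit) (fun _ => 0)
      (fun _ => (coeff 0 f)⁻¹ • f) (fun _ => by rw [coeff_smul, inv_mul_cancel₀ h])
      (fun _ q _ => wt_mono (zero_le)) (1 : O n)
    have hR0 : R = 0 := ext_coeff fun q => by rw [hR q () zero_le, coeff_zero]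
    rw [hR0, add_zero, Finset.univ_unique, Finset.sum_singleton] at hHR
    refine IsUnit.of_mul_eq_one ((coeff 0 f)⁻¹ • H default) ?_
    rw [hHR, mul_smul_comm, mul_smul_comm, mul_comm]

instance isLocalRing_O (n : ℕ) : IsLocalRing (O n) := by
  refine IsLocalRing.of_isUnit_or_isUnit_one_sub_self fun f => ?_
  rw [isUnit_iff_coeff_ne_zero, isUnit_iff_coeff_ne_zero, coeff_sub, coeff_zero_one]
  by_cases h : coeff 0 f = 0
  · right; simp [h]
  · exact Or.inl h

theorem mem_maximalIdeal_iff {n : ℕ} {f : O n} :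
    f ∈ IsLocalRing.maximalIdeal (O n) ↔ coeff 0 f = 0 := by
  rw [IsLocalRing.mem_maximalIdeal, mem_nonunits_iff, isUnit_iff_coeff_ne_zero, not_not]

theorem maximalIdeal_eq_span (n : ℕ) : IsLocalRing.maximalIdeal (O n) =
    Ideal.span (Set.range fun i : Fin n => (mono (Finsupp.single i 1) : O n)) := by
  classical
  apply le_antisymm
  · intro f hf
    rw [mem_maximalIdeal_iff] at hf
    refine mem_span_mono _ fun q hq => ?_
    have hq0 : q ≠ 0 := by rintro rfl; exact hq hf
    obtain ⟨i, hi⟩ := Finsupp.ne_iff.mp hq0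
    exact ⟨i, by simpa [Finsupp.single_le_iff, Nat.one_le_iff_ne_zero] using hi⟩
  · rw [Ideal.span_le]
    rintro _ ⟨i, rfl⟩
    rw [SetLike.mem_coe, mem_maximalIdeal_iff, coeff_mono, if_neg]
    intro h
    simpa using (DFunLike.congr_fun h i).symm

/-- The dimension of `𝒪_{ℂⁿ,0}` is at most `n`, by Krull's height theorem. -/
theorem ringKrullDim_O_le (n : ℕ) : ringKrullDim (O n) ≤ n := by
  refine (ringKrullDim_le_spanFinrank_maximalIdeal (O n)).trans ?_
  rw [maximalIdeal_eq_span]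
  have h := Submodule.spanFinrank_span_le_ncard_of_finite (R := O n)
    (Set.finite_range fun i : Fin n => (mono (Finsupp.single i 1) : O n))
  have h2 : (Set.range fun i : Fin n => (mono (Finsupp.single i 1) : O n)).ncard ≤ n := by
    rw [← Set.image_univ]
    exact (Set.ncard_image_le Set.finite_univ).trans (by simp [Set.ncard_univ])
  exact_mod_cast h.trans h2

theorem mono_mem_pow {n : ℕ} (N : ℕ) (a : Fin n →₀ ℕ) (ha : a.degree = N) :
    (mono a : O n) ∈ IsLocalRing.maximalIdeal (O n) ^ N := by
  induction N generalizing a with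
  | zero => simp
  | succ N ih =>
    have ha0 : a ≠ 0 := by rintro rfl; simp at ha
    obtain ⟨i, hi⟩ := Finsupp.ne_iff.mp ha0
    have hle : Finsupp.single i 1 ≤ a := by
      simpa [Finsupp.single_le_iff, Nat.one_le_iff_ne_zero] using hi
    obtain ⟨c, rfl⟩ := exists_add_of_le hle
    rw [map_add, Finsupp.degree_single] at ha
    rw [mono_add, pow_succ']
    refine Ideal.mul_mem_mul ?_ (ih c (by omega))
    rw [maximalIdeal_eq_span]
    exact Ideal.subset_span ⟨i, rfl⟩

theorem exists_le_degree_eq {n : ℕ} {q : Fin n →₀ ℕ} {N : ℕ} (h : N ≤ q.degree) :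
    ∃ a ≤ q, a.degree = N := by
  induction N with
  | zero => exact ⟨0, zero_le, by simp⟩
  | succ N ih =>
    obtain ⟨a, ha, hN⟩ := ih (by omega)
    obtain ⟨c, rfl⟩ := exists_add_of_le ha
    have hc : c ≠ 0 := by rintro rfl; rw [add_zero] at h; omega
    obtain ⟨i, hi⟩ := Finsupp.ne_iff.mp hc
    refine ⟨a + Finsupp.single i 1, add_le_add le_rfl ?_, by simp [hN]⟩
    simpa [Finsupp.single_le_iff, Nat.one_le_iff_ne_zero] using hi

theorem tail_le_span_mono (n N : ℕ) :
    tail n N ≤ Ideal.span (mono '' {a : Fin n →₀ ℕ | a.degree = N}) := by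
  intro f hf
  have hfin : Finite {a : Fin n →₀ ℕ // a.degree = N} :=
    (Finsupp.finite_of_degree_eq (σ := Fin n) N).to_subtype
  have h := mem_span_mono (fun a : {a : Fin n →₀ ℕ // a.degree = N} => a.1) (f := f) ?_
  · refine Ideal.span_mono ?_ h
    rintro _ ⟨a, rfl⟩
    exact ⟨a.1, a.2, rfl⟩
  · intro q hq
    have : N ≤ q.degree := by
      by_contra hlt
      exact hq (hf q (not_le.mp hlt))
    obtain ⟨a, ha, hN⟩ := exists_le_degree_eq this
    exact ⟨⟨a, hN⟩, ha⟩

theorem tail_eq_pow (n N : ℕ) : tail n N = IsLocalRing.maximalIdeal (O n) ^ N := by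
  apply le_antisymm
  · refine (tail_le_span_mono n N).trans ?_
    rw [Ideal.span_le]
    rintro _ ⟨a, ha, rfl⟩
    exact mono_mem_pow N a ha
  · induction N with
    | zero => intro f _ q hq; omega
    | succ N ih =>
      rw [pow_succ', Ideal.mul_le]
      intro f hf g hg q hq
      have hg' := ih hg
      rw [mem_maximalIdeal_iff] at hf
      rw [coeff_mul]
      refine Finset.sum_eq_zero fun x hx => ?_
      rw [Finset.HasAntidiagonal.mem_antidiagonal] at hx
      by_cases h0 : x.1 = 0
      · rw [h0, hf, zero_mul]
      · rw [hg' x.2, mul_zero]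
        have h1 : x.1.degree ≠ 0 := by rwa [Ne, Finsupp.degree_eq_zero_iff]
        rw [← hx, map_add] at hq
        omega

/-! ### Polynomials and truncation -/

open MvPolynomial (idealOfVars)

theorem isConvergent_coe {n : ℕ} (f : MvPolynomial (Fin n) ℂ) :
    IsConvergent (f : MvPowerSeries (Fin n) ℂ) := by
  refine ⟨1, one_pos, summable_of_ne_finset_zero (s := f.support) fun q hq => ?_⟩
  rw [MvPolynomial.coeff_coe, MvPolynomial.notMem_support_iff.mp hq]
  simp

/-- The inclusion of the polynomials into the convergent power series. -/
noncomputable def ofPoly (n : ℕ) : MvPolynomial (Fin n) ℂ →+* O n :=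
  MvPolynomial.coeToMvPowerSeries.ringHom.codRestrict (convergentSeries n) isConvergent_coe

@[simp] theorem coeff_ofPoly {n : ℕ} (q : Fin n →₀ ℕ) (f : MvPolynomial (Fin n) ℂ) :
    coeff q (ofPoly n f) = f.coeff q := MvPolynomial.coeff_coe _ _

/-- The Taylor polynomial consisting of the terms of degree less than `N`. -/
noncomputable def taylor {n : ℕ} (N : ℕ) (f : O n) : MvPolynomial (Fin n) ℂ :=
  MvPowerSeries.truncTotal N f.1

theorem coeff_taylor {n : ℕ} (N : ℕ) (f : O n) (q : Fin n →₀ ℕ) :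
    (taylor N f).coeff q = if q.degree < N then coeff q f else 0 :=
  MvPowerSeries.coeff_truncTotal_eq_ite _

theorem sub_taylor_mem {n : ℕ} (N : ℕ) (f : O n) : f - ofPoly n (taylor N f) ∈ tail n N := by
  intro q hq
  rw [coeff_sub, coeff_ofPoly, coeff_taylor, if_pos hq, sub_self]

theorem ofPoly_mem_tail {n N : ℕ} {f : MvPolynomial (Fin n) ℂ} :
    ofPoly n f ∈ tail n N ↔ f ∈ idealOfVars (Fin n) ℂ ^ N := by
  rw [MvPolynomial.mem_pow_idealOfVars_iff', mem_tail]
  simp only [coeff_ofPoly]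

/-- Polynomials and convergent power series have the same quotients by ideals that contain a
power of the maximal ideal. -/
theorem mem_sup_pow_of_ofPoly_mem {n N : ℕ} {J : Ideal (MvPolynomial (Fin n) ℂ)}
    {f : MvPolynomial (Fin n) ℂ} (h : ofPoly n f ∈ J.map (ofPoly n) ⊔ tail n N) :
    f ∈ J ⊔ idealOfVars (Fin n) ℂ ^ N := by
  let K : Ideal (O n) :=
    { carrier := {h | ∃ f ∈ J, h - ofPoly n f ∈ tail n N}
      add_mem' := by
        rintro a b ⟨f, hf, hf'⟩ ⟨g, hg, hg'⟩
        exact ⟨f + g, J.add_mem hf hg, by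
          rw [map_add, add_sub_add_comm]; exact (tail n N).add_mem hf' hg'⟩
      zero_mem' := ⟨0, J.zero_mem, by simp⟩
      smul_mem' := by
        rintro c a ⟨f, hf, hf'⟩
        refine ⟨taylor N c * f, J.mul_mem_left _ hf, ?_⟩
        have : c • a - ofPoly n (taylor N c * f) =
            c * (a - ofPoly n f) + ofPoly n f * (c - ofPoly n (taylor N c)) := by
          rw [map_mul, smul_eq_mul]; ring
        rw [this]
        exact (tail n N).add_mem ((tail n N).mul_mem_left _ hf')
          ((tail n N).mul_mem_left _ (sub_taylor_mem N c)) }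
  have hle : J.map (ofPoly n) ⊔ tail n N ≤ K := by
    refine sup_le (Ideal.map_le_iff_le_comap.mpr fun f hf => ⟨f, hf, by simp⟩) fun a ha => ?_
    exact ⟨0, J.zero_mem, by simpa using ha⟩
  obtain ⟨g, hg, hg'⟩ := hle h
  rw [← map_sub, ofPoly_mem_tail] at hg'
  rw [← add_sub_cancel g f]
  exact Submodule.add_mem_sup hg hg'

/-! ### Dimension of affine domains and of their analytic counterparts -/

/-- By induction on the number of variables: the contraction of a maximal ideal to one variable
less is again maximal (Nullstellensatz). -/
theorem le_height_of_isMaximal (d : ℕ) (P : Ideal (MvPolynomial (Fin d) ℂ)) [hP : P.IsMaximal] :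
    (d : ℕ∞) ≤ P.height := by
  induction d with
  | zero => simp
  | succ d ih =>
    let e := (MvPolynomial.finSuccEquiv ℂ d).toRingEquiv
    set P' : Ideal (Polynomial (MvPolynomial (Fin d) ℂ)) := P.map e with hP'
    have hmax : P'.IsMaximal := Ideal.map_isMaximal_of_equiv e
    have hheight : P'.height = P.height := e.height_map P
    have hunder : (P'.under (MvPolynomial (Fin d) ℂ)).IsMaximal :=
      Polynomial.isMaximal_comap_C_of_isJacobsonRing P'
    have hlies : P'.LiesOver (P'.under (MvPolynomial (Fin d) ℂ)) := ⟨rfl⟩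
    rw [← hheight, Polynomial.height_eq_height_add_one (P'.under (MvPolynomial (Fin d) ℂ)) P']
    push_cast
    gcongr
    exact ih _

/-- The transcendence degree of an affine domain is finite, bounds the Krull dimension from above,
and bounds the height of every maximal ideal from below. -/
theorem exists_trdeg_eq (A : Type) [CommRing A] [IsDomain A] [Algebra ℂ A]
    [Algebra.FiniteType ℂ A] : ∃ d : ℕ, Algebra.trdeg ℂ A = d ∧ ringKrullDim A ≤ d ∧
      ∀ M : Ideal A, M.IsMaximal → (d : ℕ∞) ≤ M.height := by
  obtain ⟨d, g, hinj, hint⟩ := exists_integral_inj_algHom_of_fg ℂ A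
  have := Algebra.FiniteType.isNoetherianRing ℂ A
  algebraize [g.toRingHom]
  have hInt : Algebra.IsIntegral (MvPolynomial (Fin d) ℂ) A := ⟨hint⟩
  have hfaith : FaithfulSMul (MvPolynomial (Fin d) ℂ) A :=
    (faithfulSMul_iff_algebraMap_injective _ _).mpr hinj
  have htower : IsScalarTower ℂ (MvPolynomial (Fin d) ℂ) A :=
    IsScalarTower.of_algebraMap_eq fun x => (g.commutes x).symm
  refine ⟨d, ?_, ?_, fun M hM => ?_⟩
  · have h := trdeg_add_eq ℂ (MvPolynomial (Fin d) ℂ) (A := A)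
    rw [trdeg_eq_zero (R := MvPolynomial (Fin d) ℂ) (A := A), add_zero,
      MvPolynomial.trdeg_of_isDomain] at h
    rw [← h]
    simp
  · have h1 : ringKrullDim A ≤ ringKrullDim (MvPolynomial (Fin d) ℂ) := by
      refine Order.krullDim_le_of_strictMono
        (PrimeSpectrum.comap (algebraMap (MvPolynomial (Fin d) ℂ) A)) fun P Q hPQ => ?_
      exact Ideal.IsIntegral.comap_lt_comap hPQ
    refine h1.trans ?_
    rw [MvPolynomial.ringKrullDim_of_isNoetherianRing, ringKrullDim_eq_zero_of_field]
    simp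
  · have hmax : (M.under (MvPolynomial (Fin d) ℂ)).IsMaximal :=
      Ideal.isMaximal_comap_of_isIntegral_of_isMaximal M
    have hlies : M.LiesOver (M.under (MvPolynomial (Fin d) ℂ)) := ⟨rfl⟩
    have hgd : Algebra.HasGoingDown (MvPolynomial (Fin d) ℂ) A := inferInstance
    rw [Ideal.height_eq_height_add_of_liesOver_of_hasGoingDown
      (M.under (MvPolynomial (Fin d) ℂ)) M]
    exact (le_height_of_isMaximal d _).trans le_self_add

theorem trdeg_le_of_isAlgebraic {A B ι : Type} [CommRing A] [IsDomain A] [Algebra ℂ A]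
    [CommRing B] [Algebra ℂ B] [Fintype ι] (φ : B →ₐ[ℂ] A) (t : ι → A)
    (h : ∀ x : A, IsAlgebraic (Algebra.adjoin φ.range (Set.range t)) x) :
    Algebra.trdeg ℂ A ≤ Algebra.trdeg ℂ (B ⧸ RingHom.ker φ) + Fintype.card ι := by
  have hfaith : FaithfulSMul ℂ φ.range :=
    (faithfulSMul_iff_algebraMap_injective _ _).mpr (algebraMap ℂ φ.range).injective
  have h1 : Algebra.trdeg ℂ φ.range + Algebra.trdeg φ.range A = Algebra.trdeg ℂ A :=
    trdeg_add_eq ℂ φ.range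
  have h2 : Algebra.trdeg ℂ (B ⧸ RingHom.ker φ) = Algebra.trdeg ℂ φ.range :=
    (Ideal.quotientKerEquivRange φ).trdeg_eq
  have : Algebra.IsAlgebraic (Algebra.adjoin φ.range (Set.range t)) A := ⟨h⟩
  obtain ⟨u, hu, hbasis⟩ := exists_isTranscendenceBasis_subset (R := φ.range) (Set.range t)
  rw [← h1, h2, ← hbasis.cardinalMk_eq_trdeg]
  gcongr
  refine (Cardinal.mk_le_mk_of_subset hu).trans ?_
  refine Cardinal.mk_range_le.trans ?_
  simp

/-- A Noetherian local ring has a system of as many parameters as its dimension. -/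
theorem exists_parameters {B : Type*} [CommRing B] [IsLocalRing B] [IsNoetherianRing B] {D : ℕ}
    (hD : ringKrullDim B ≤ D) : ∃ s : Finset B, s.card ≤ D ∧
      (∀ y ∈ s, y ∈ IsLocalRing.maximalIdeal B) ∧
      ∃ N, IsLocalRing.maximalIdeal B ^ N ≤ Ideal.span (s : Set B) := by
  obtain ⟨s, hs, hcard⟩ :=
    (IsLocalRing.maximalIdeal B).exists_finset_card_eq_height_of_isNoetherianRing
  refine ⟨s, ?_, fun y hy => hs.1.2 (Ideal.subset_span hy), ?_⟩
  · have h1 := IsLocalRing.maximalIdeal_height_eq_ringKrullDim (R := B)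
    rw [← hcard] at h1
    rw [← h1] at hD
    exact_mod_cast hD
  · refine Ideal.exists_pow_le_of_le_radical_of_fg ?_ (IsNoetherian.noetherian _)
    rw [Ideal.radical_eq_sInf]
    refine le_sInf fun P hP => ?_
    have := hP.2
    exact hs.2 ⟨hP.2, hP.1⟩ (IsLocalRing.le_maximalIdeal_of_isPrime P)

/-- By Nakayama's lemma, parameters modulo a higher power of a prime ideal `M` are parameters. -/
theorem height_le_card_of_pow_le {A : Type*} [CommRing A] [IsNoetherianRing A] {M : Ideal A}
    (hM : M.IsPrime) {t : Finset A} (ht : ∀ y ∈ t, y ∈ M) {N : ℕ}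
    (hN : M ^ N ≤ Ideal.span (t : Set A) ⊔ M ^ (N + 1)) : M.height ≤ t.card := by
  refine Ideal.height_le_card_of_mem_minimalPrimes_span_finset
    ⟨⟨hM, Ideal.span_le.mpr ht⟩, fun P hP hPM => ?_⟩
  have hle : M ^ N ≤ P ⊔ M • M ^ N := by
    rw [smul_eq_mul, ← pow_succ']
    exact hN.trans (sup_le_sup_right hP.2 _)
  obtain ⟨x, hx, hxN⟩ := Submodule.exists_sub_one_mem_and_smul_le_of_fg_of_le_sup
    (IsNoetherian.noetherian (M ^ N)) le_rfl hle
  have hxP : x ∉ P := fun h => by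
    have h1 : (1 : A) ∈ M := by
      rw [← sub_sub_cancel x 1]
      exact M.sub_mem (hPM h) hx
    exact hM.ne_top ((Ideal.eq_top_iff_one _).mpr h1)
  have hMN : M ^ N ≤ P := fun y hy =>
    (hP.1.mem_or_mem (hxN (Submodule.smul_mem_pointwise_smul y x _ hy))).resolve_left hxP
  exact hP.1.le_of_pow_le hMN

theorem mem_idealOfVars {σ : Type*} {f : MvPolynomial σ ℂ} :
    f ∈ idealOfVars σ ℂ ↔ MvPolynomial.constantCoeff f = 0 := by
  rw [← pow_one (idealOfVars σ ℂ), MvPolynomial.mem_pow_idealOfVars_iff',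
    MvPolynomial.constantCoeff_eq]
  refine ⟨fun h => h 0 (by simp), fun h x hx => ?_⟩
  rw [Nat.lt_one_iff, Finsupp.degree_eq_zero_iff] at hx
  rwa [hx]

theorem isMaximal_idealOfVars (σ : Type*) : (idealOfVars σ ℂ).IsMaximal := by
  have : idealOfVars σ ℂ = RingHom.ker (MvPolynomial.constantCoeff (σ := σ) (R := ℂ)) := by
    ext f
    exact mem_idealOfVars
  rw [this]
  exact RingHom.ker_isMaximal_of_surjective _ fun c => ⟨MvPolynomial.C c, by simp⟩

/-- A system of parameters of `B = 𝒪_{ℂⁿ,0} / Q` can be replaced by polynomials, so that it is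
also a system of parameters of the local ring of `A = ℂ[z] / Q` at the origin. -/
theorem height_le_of_ringKrullDim_le {n D : ℕ} {Q : Ideal (MvPolynomial (Fin n) ℂ)}
    (hQ : Q ≤ idealOfVars (Fin n) ℂ) {A B : Type*} [CommRing A] [CommRing B]
    (ρ : MvPolynomial (Fin n) ℂ →+* A) (hρ : Function.Surjective ρ) (hρQ : RingHom.ker ρ = Q)
    (π : O n →+* B) (hπ : Function.Surjective π) (hπQ : RingHom.ker π = Q.map (ofPoly n))
    (hD : ringKrullDim B ≤ D) :
    ((idealOfVars (Fin n) ℂ).map ρ).height ≤ D := by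
  classical
  have htail1 : ∀ f ∈ idealOfVars (Fin n) ℂ, ofPoly n f ∈ IsLocalRing.maximalIdeal (O n) := by
    intro f hf
    rw [← pow_one (IsLocalRing.maximalIdeal (O n)), ← tail_eq_pow, ofPoly_mem_tail, pow_one]
    exact hf
  have hIm : RingHom.ker π ≤ IsLocalRing.maximalIdeal (O n) := by
    rw [hπQ]
    exact Ideal.map_le_iff_le_comap.mpr fun f hf => htail1 f (hQ hf)
  have hnt : Nontrivial B := by
    refine not_subsingleton_iff_nontrivial.mp fun h => ?_
    have h1 : (1 : O n) ∈ RingHom.ker π := Subsingleton.elim _ _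
    exact hIm h1 isUnit_one
  have hloc : IsLocalRing B := IsLocalRing.of_surjective' π hπ
  have hnoeth : IsNoetherianRing B := isNoetherianRing_of_surjective _ _ π hπ
  have hnoethA : IsNoetherianRing A := isNoetherianRing_of_surjective _ _ ρ hρ
  obtain ⟨s, hsD, hsm, N, hN⟩ := exists_parameters hD
  choose lift hlift using hπ
  have hliftm : ∀ y ∈ s, lift y ∈ IsLocalRing.maximalIdeal (O n) := by
    intro y hy
    have h1 := hsm y hy
    rw [← hlift y] at h1
    exact fun hu => h1 (hu.map _)
  set t : Finset (MvPolynomial (Fin n) ℂ) := s.image fun y => taylor (N + 1) (lift y) with ht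
  have htm : ∀ f ∈ t, f ∈ idealOfVars (Fin n) ℂ := by
    intro f hf
    obtain ⟨y, hy, rfl⟩ := Finset.mem_image.mp hf
    have h0 := mem_maximalIdeal_iff.mp (hliftm y hy)
    rw [← pow_one (idealOfVars (Fin n) ℂ), MvPolynomial.mem_pow_idealOfVars_iff']
    intro x hx
    rw [Nat.lt_one_iff, Finsupp.degree_eq_zero_iff] at hx
    rw [coeff_taylor, hx, h0, ite_self]
  set J := Q ⊔ Ideal.span (t : Set (MvPolynomial (Fin n) ℂ)) with hJ
  have hO : tail n N ≤ J.map (ofPoly n) ⊔ tail n (N + 1) := by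
    intro f hf
    have h1 : π f ∈ Ideal.span (s : Set B) := by
      apply hN
      have h2 : (IsLocalRing.maximalIdeal (O n)).map π ≤ IsLocalRing.maximalIdeal B := by
        rw [Ideal.map_le_iff_le_comap]
        exact fun x hx hu => hx (by
          obtain ⟨y, hy⟩ := hu.exists_right_inv
          by_contra hx'
          have h3 : x * lift y - 1 ∈ IsLocalRing.maximalIdeal (O n) := hIm (by
            rw [RingHom.mem_ker, map_sub, map_mul, hlift, hy, map_one, sub_self])
          have h4 : (1 : O n) ∈ IsLocalRing.maximalIdeal (O n) := by
            rw [← sub_sub_cancel (x * lift y) 1]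
            exact Ideal.sub_mem _ (Ideal.mul_mem_right _ _ hx) h3
          exact h4 isUnit_one)
      refine Ideal.pow_right_mono h2 N ?_
      rw [← Ideal.map_pow]
      exact Ideal.mem_map_of_mem _ (by rwa [← tail_eq_pow])
    have h3 : Ideal.span (s : Set B) ≤ (J.map (ofPoly n) ⊔ tail n (N + 1)).map π := by
      rw [Ideal.span_le]
      intro y hy
      rw [SetLike.mem_coe, ← hlift y]
      refine Ideal.mem_map_of_mem _ ?_
      rw [← add_sub_cancel (ofPoly n (taylor (N + 1) (lift y))) (lift y)]
      refine Submodule.add_mem_sup (Ideal.mem_map_of_mem _ ?_) (sub_taylor_mem _ _)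
      exact Ideal.mem_sup_right (Ideal.subset_span (Finset.mem_image_of_mem _ hy))
    have h4 : f ∈ ((J.map (ofPoly n) ⊔ tail n (N + 1)).map π).comap π := h3 h1
    rw [Ideal.comap_map_of_surjective _ fun y => ⟨lift y, hlift y⟩, ← RingHom.ker_eq_comap_bot,
      hπQ, sup_eq_left.mpr] at h4
    · exact h4
    · exact le_sup_of_le_left (Ideal.map_mono le_sup_left)
  have hpoly : idealOfVars (Fin n) ℂ ^ N ≤ J ⊔ idealOfVars (Fin n) ℂ ^ (N + 1) := fun f hf =>
    mem_sup_pow_of_ofPoly_mem (hO (ofPoly_mem_tail.mpr hf))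
  have hmax := isMaximal_idealOfVars (Fin n)
  have hM : ((idealOfVars (Fin n) ℂ).map ρ).IsPrime :=
    Ideal.map_isPrime_of_surjective hρ (hρQ.trans_le hQ)
  have hle : (t.image ρ).card ≤ D := (Finset.card_image_le.trans Finset.card_image_le).trans hsD
  refine (height_le_card_of_pow_le (t := t.image ρ) (N := N) hM ?_ ?_).trans
    (by exact_mod_cast hle)
  · intro y hy
    obtain ⟨f, hf, rfl⟩ := Finset.mem_image.mp hy
    exact Ideal.mem_map_of_mem _ (htm f hf)
  · have h1 := Ideal.map_mono (f := ρ) hpoly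
    rw [Ideal.map_sup, hJ, Ideal.map_sup, Ideal.map_pow, Ideal.map_pow, ← hρQ,
      (Ideal.map_eq_bot_iff_le_ker ρ).mpr le_rfl, bot_sup_eq] at h1
    rwa [Finset.coe_image, ← Ideal.map_span]

/-- A quotient replaced by an opaque ring, on which no instances other than the ring structure have
to be unfolded. -/
theorem exists_surjective_of_ringKrullDim_le {R : Type} [CommRing R] {D : ℕ} (K : Ideal R)
    (h : ringKrullDim (R ⧸ K) ≤ D) : ∃ (B : Type) (_ : CommRing B) (π : R →+* B),
      Function.Surjective π ∧ RingHom.ker π = K ∧ ringKrullDim B ≤ D :=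
  ⟨R ⧸ K, inferInstance, Ideal.Quotient.mk K, Ideal.Quotient.mk_surjective, Ideal.mk_ker, h⟩

/-- A bound for the dimension of an analytic germ bounds the dimension of every irreducible
algebraic set through the origin whose germ it contains. -/
theorem trdeg_le_of_ringKrullDim_le {n D : ℕ} (Q : Ideal (MvPolynomial (Fin n) ℂ)) [Q.IsPrime]
    (hQ : Q ≤ idealOfVars (Fin n) ℂ) (I : Ideal (O n)) (hI : I ≤ Q.map (ofPoly n))
    (hD : ringKrullDim (O n ⧸ I) ≤ D) :
    Algebra.trdeg ℂ (MvPolynomial (Fin n) ℂ ⧸ Q) ≤ D := by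
  obtain ⟨d, hd, -, hht⟩ := exists_trdeg_eq (MvPolynomial (Fin n) ℂ ⧸ Q)
  have hmax := isMaximal_idealOfVars (Fin n)
  have hM : ((idealOfVars (Fin n) ℂ).map (Ideal.Quotient.mk Q)).IsMaximal := by
    refine Ideal.IsMaximal.map_of_surjective_of_ker_le Ideal.Quotient.mk_surjective ?_
    rw [Ideal.mk_ker]
    exact hQ
  obtain ⟨B, _, π, hπ, hker, hB⟩ := exists_surjective_of_ringKrullDim_le _
    ((ringKrullDim_le_of_surjective (Ideal.Quotient.factor hI)
      (Ideal.Quotient.factor_surjective hI)).trans hD)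
  have h3 := (hht _ hM).trans
    (height_le_of_ringKrullDim_le (A := MvPolynomial (Fin n) ℂ ⧸ Q) hQ (Ideal.Quotient.mk Q)
      Ideal.Quotient.mk_surjective Ideal.mk_ker π hπ hker hB)
  rw [hd]
  exact_mod_cast h3

/-! ### Systems of parameters and regular sequences -/

open RingTheory.Sequence IsLocalRing Pointwise in
/-- Dividing by a regular element makes every associated prime strictly larger. -/
theorem exists_associatedPrimes_quotSMulTop_gt {R : Type*} [CommRing R] [IsNoetherianRing R]
    [IsLocalRing R] {M : Type*} [AddCommGroup M] [Module R M] [Module.Finite R M] {x : R}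
    (hx : x ∈ maximalIdeal R) (hreg : IsSMulRegular M x) {P : Ideal R}
    (hP : P ∈ associatedPrimes R M) :
    ∃ Q ∈ associatedPrimes R (QuotSMulTop x M), P < Q := by
  set K : Submodule R M := Submodule.torsionBySet R M P with hK
  rw [AssociatedPrimes.mem_iff, isAssociatedPrime_iff] at hP
  obtain ⟨hPp, m₀, hm₀⟩ := hP
  have hm0 : m₀ ≠ 0 := by
    rintro rfl
    exact hPp.ne_top (by rw [hm₀]; ext; simp)
  have hm₀K : m₀ ∈ K := by
    rw [hK, Submodule.mem_torsionBySet_iff]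
    rintro ⟨a, ha⟩
    rw [SetLike.mem_coe, hm₀, Submodule.mem_colon_singleton] at ha
    simpa using ha
  have hxP : x ∉ P := by
    intro h
    rw [hm₀, Submodule.mem_colon_singleton, Submodule.mem_bot] at h
    exact hm0 (hreg (by simpa using h))
  have hnot : ¬ K ≤ x • (⊤ : Submodule R M) := by
    intro hle
    have h1 : K ≤ Ideal.span {x} • K := by
      intro y hy
      obtain ⟨z, -, rfl⟩ := Submodule.mem_smul_pointwise_iff_exists _ _ _ |>.mp (hle hy)
      refine Submodule.smul_mem_smul (Ideal.mem_span_singleton_self x) ?_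
      rw [hK, Submodule.mem_torsionBySet_iff] at hy ⊢
      intro a
      apply hreg
      have := hy a
      simp only [smul_zero]
      rw [smul_comm]
      exact this
    have h2 : K = ⊥ := Submodule.eq_bot_of_le_smul_of_le_jacobson_bot _ _
      (IsNoetherian.noetherian K) h1 (by
        rw [IsLocalRing.jacobson_eq_maximalIdeal _ bot_ne_top, Ideal.span_singleton_le_iff_mem]
        exact hx)
    rw [h2, Submodule.mem_bot] at hm₀K
    exact hm0 hm₀K
  obtain ⟨y, hyK, hyx⟩ := SetLike.not_le_iff_exists.mp hnot
  have hy0 : (Submodule.Quotient.mk y : QuotSMulTop x M) ≠ 0 := by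
    rwa [Ne, Submodule.Quotient.mk_eq_zero]
  obtain ⟨Q, hQ, hle⟩ := exists_le_isAssociatedPrime_of_isNoetherianRing R _ hy0
  have hmem : ∀ a : R, a • y ∈ x • (⊤ : Submodule R M) → a ∈ Q := by
    intro a ha
    apply hle
    rw [Submodule.mem_colon_singleton, Submodule.mem_bot, ← Submodule.Quotient.mk_smul,
      Submodule.Quotient.mk_eq_zero]
    exact ha
  refine ⟨Q, hQ, lt_of_le_of_ne ?_ ?_⟩
  · intro a ha
    apply hmem
    rw [hK, Submodule.mem_torsionBySet_iff] at hyK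
    rw [hyK ⟨a, ha⟩]
    exact zero_mem _
  · rintro rfl
    exact hxP (hmem x (Submodule.smul_mem_pointwise_smul _ _ _ trivial))

open RingTheory.Sequence IsLocalRing in
/-- The length of a regular sequence is at most the dimension of every associated prime. -/
theorem length_le_ringKrullDim_of_mem_associatedPrimes {R : Type*} [CommRing R]
    [IsNoetherianRing R] [IsLocalRing R] (rs : List R) (hrs : ∀ x ∈ rs, x ∈ maximalIdeal R)
    {M : Type*} [AddCommGroup M] [Module R M] [Module.Finite R M] (hreg : IsRegular M rs)
    {P : Ideal R} (hP : P ∈ associatedPrimes R M) :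
    (rs.length : WithBot ℕ∞) ≤ ringKrullDim (R ⧸ P) := by
  induction rs generalizing M P with
  | nil =>
    have : Nontrivial (R ⧸ P) := Ideal.Quotient.nontrivial_iff.mpr hP.isPrime.ne_top
    simpa using ringKrullDim_nonneg_of_nontrivial
  | cons x rs ih =>
    rw [isRegular_cons_iff] at hreg
    obtain ⟨Q, hQ, hlt⟩ := exists_associatedPrimes_quotSMulTop_gt
      (hrs x List.mem_cons_self) hreg.1 hP
    have h1 := ih (fun y hy => hrs y (List.mem_cons_of_mem _ hy)) hreg.2 hQ
    have := hP.isPrime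
    obtain ⟨a, haQ, haP⟩ := SetLike.exists_of_lt hlt
    have h2 : ringKrullDim (R ⧸ Q) + 1 ≤ ringKrullDim (R ⧸ P) :=
      ringKrullDim_succ_le_of_surjective (Ideal.Quotient.factor hlt.le)
        (Ideal.Quotient.factor_surjective hlt.le) (r := Ideal.Quotient.mk P a)
        (mem_nonZeroDivisors_of_ne_zero (by rwa [Ne, Ideal.Quotient.eq_zero_iff_mem]))
        (by simpa [Ideal.Quotient.eq_zero_iff_mem] using haQ)
    rw [List.length_cons]
    push_cast
    exact (add_le_add_left h1 1).trans h2

open RingTheory.Sequence IsLocalRing CategoryTheory Abelian in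
/-- Dividing by a regular element drops the depth by at most one. -/
theorem exists_isRegular_quotSMulTop {R : Type} [CommRing R] [IsNoetherianRing R]
    [IsLocalRing R] {M : Type} [AddCommGroup M] [Module R M] [Module.Finite R M] {x : R}
    (hx : x ∈ maximalIdeal R) (hreg : IsSMulRegular M x) {d : ℕ}
    (h : ∃ rs : List R, rs.length = d + 1 ∧ (∀ r ∈ rs, r ∈ maximalIdeal R) ∧ IsRegular M rs) :
    ∃ rs : List R, rs.length = d ∧ (∀ r ∈ rs, r ∈ maximalIdeal R) ∧
      IsRegular (QuotSMulTop x M) rs := by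
  have hM : Nontrivial M := by
    obtain ⟨rs, -, -, h⟩ := h
    exact h.nontrivial
  have hlt : ∀ (L : Type) [AddCommGroup L] [Module R L] [Module.Finite R L] [Nontrivial L],
      maximalIdeal R • (⊤ : Submodule R L) < ⊤ := fun L _ _ _ _ =>
    (Submodule.top_ne_ideal_smul_of_le_jacobson_annihilator
      (maximalIdeal_le_jacobson _)).symm.lt_top
  have hQ : Nontrivial (QuotSMulTop x M) :=
    nontrivial_quotSMulTop_of_mem_maximalIdeal M hx
  have h1 := ((ModuleCat.exists_isRegular_tfae (maximalIdeal R) (d + 1) (ModuleCat.of R M)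
    (hlt M)).out 1 3).mpr h
  refine ((ModuleCat.exists_isRegular_tfae (maximalIdeal R) d
    (ModuleCat.of R (QuotSMulTop x M)) (hlt _)).out 1 3).mp fun i hi => ?_
  have zero1 := AddCommGrpCat.isZero_of_iff_subsingleton.mpr (h1 i (by omega))
  have zero2 := AddCommGrpCat.isZero_of_iff_subsingleton.mpr (h1 (i + 1) (by omega))
  exact AddCommGrpCat.subsingleton_of_isZero <| ShortComplex.Exact.isZero_of_both_zeros
    ((Ext.covariant_sequence_exact₃' _ (IsSMulRegular.smulShortComplex_shortExact
      (M := ModuleCat.of R M) hreg)) i (i + 1) rfl)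
    (zero1.eq_zero_of_src _) (zero2.eq_zero_of_tgt _)

open RingTheory.Sequence IsLocalRing Module in
theorem supportDim_le_add_length {R : Type*} [CommRing R] [IsNoetherianRing R] [IsLocalRing R]
    (as : List R) (has : ∀ a ∈ as, a ∈ maximalIdeal R) {M : Type*} [AddCommGroup M] [Module R M]
    [Module.Finite R M] :
    supportDim R M ≤ supportDim R (M ⧸ (Ideal.ofList as • ⊤ : Submodule R M)) + as.length := by
  induction as generalizing M with
  | nil =>
    rw [Ideal.ofList_nil, Submodule.bot_smul,
      supportDim_eq_of_equiv (Submodule.quotEquivOfEqBot (⊥ : Submodule R M) rfl)]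
    simp
  | cons a as ih =>
    have h1 := supportDim_le_supportDim_quotSMulTop_succ (M := M) (has a List.mem_cons_self)
    have h2 := ih (fun y hy => has y (List.mem_cons_of_mem _ hy)) (M := QuotSMulTop a M)
    rw [← supportDim_eq_of_equiv
      (Submodule.quotOfListConsSMulTopEquivQuotSMulTopInner M a as)] at h2
    refine h1.trans ((add_le_add_left h2 1).trans ?_)
    rw [List.length_cons, add_assoc]
    push_cast
    rfl

open RingTheory.Sequence IsLocalRing Module in
/-- A sequence that cuts the dimension down to `d` is regular on a module of depth at least `d`
plus the length of the sequence. -/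
theorem isWeaklyRegular_of_supportDim_le {R : Type} [CommRing R] [IsNoetherianRing R]
    [IsLocalRing R] (as : List R) (has : ∀ a ∈ as, a ∈ maximalIdeal R) {d : ℕ} {M : Type}
    [AddCommGroup M] [Module R M] [Module.Finite R M]
    (hdepth : ∃ rs : List R, rs.length = d + as.length ∧ (∀ r ∈ rs, r ∈ maximalIdeal R) ∧
      IsRegular M rs)
    (hdim : supportDim R (M ⧸ (Ideal.ofList as • ⊤ : Submodule R M)) ≤ d) :
    IsWeaklyRegular M as := by
  induction as generalizing M with
  | nil => exact .nil R M
  | cons a as ih =>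
    rw [supportDim_eq_of_equiv (Submodule.quotOfListConsSMulTopEquivQuotSMulTopInner M a as)]
      at hdim
    have hreg : IsSMulRegular M a := by
      by_contra hcon
      have h1 : a ∈ ⋃ p ∈ associatedPrimes R M, (p : Set R) := by
        rw [biUnion_associatedPrimes_eq_compl_regular]
        exact hcon
      simp only [Set.mem_iUnion] at h1
      obtain ⟨P, hP, haP⟩ := h1
      obtain ⟨rs, hlen, hrs, hreg⟩ := hdepth
      have h2 := length_le_ringKrullDim_of_mem_associatedPrimes rs hrs hreg hP
      have h3 := supportDim_le_add_length as
        (fun y hy => has y (List.mem_cons_of_mem _ hy)) (M := QuotSMulTop a M)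
      have h4 : ringKrullDim (R ⧸ P) ≤ supportDim R (QuotSMulTop a M) := by
        rw [← supportDim_quotient_eq_ringKrullDim]
        suffices hsub : ∀ q ∈ support R (R ⧸ P), q ∈ support R (QuotSMulTop a M) from
          Order.krullDim_le_of_strictMono (fun q => ⟨q.1, hsub _ q.2⟩) fun _ _ h => h
        intro q hq
        rw [Module.support_eq_zeroLocus, Ideal.annihilator_quotient,
          PrimeSpectrum.mem_zeroLocus] at hq
        rw [support_quotSMulTop]
        have hPs : ⟨P, hP.isPrime⟩ ∈ support R M := by
          rw [Module.support_eq_zeroLocus, PrimeSpectrum.mem_zeroLocus]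
          rw [← Submodule.annihilator_top]
          exact hP.annihilator_le
        refine ⟨mem_support_mono (p := ⟨P, hP.isPrime⟩) hq hPs, ?_⟩
        rw [PrimeSpectrum.mem_zeroLocus, Set.singleton_subset_iff]
        exact hq haP
      have h5 : ((d + as.length + 1 : ℕ) : WithBot ℕ∞) ≤ ((d + as.length : ℕ) : WithBot ℕ∞) := by
        rw [hlen, List.length_cons, ← add_assoc] at h2
        refine h2.trans (h4.trans (h3.trans ?_))
        push_cast
        exact add_le_add_left hdim _
      have h6 : d + as.length + 1 ≤ d + as.length := by exact_mod_cast h5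
      omega
    rw [isWeaklyRegular_cons_iff]
    refine ⟨hreg, ih (fun y hy => has y (List.mem_cons_of_mem _ hy)) ?_ hdim⟩
    exact exists_isRegular_quotSMulTop (has a List.mem_cons_self) hreg
      (by rwa [List.length_cons, ← add_assoc] at hdepth)

open RingTheory.Sequence in
theorem isWeaklyRegular_X {σ : Type*} (vs : List σ) (hvs : vs.Nodup) :
    IsWeaklyRegular (MvPolynomial σ ℂ) (vs.map (MvPolynomial.X (R := ℂ))) := by
  rw [isWeaklyRegular_iff]
  intro i hi
  rw [List.length_map] at hi
  have h0 : ∀ f : MvPolynomial σ ℂ,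
      f ∈ (Ideal.ofList ((vs.map (MvPolynomial.X (R := ℂ))).take i) • ⊤ :
        Submodule (MvPolynomial σ ℂ) (MvPolynomial σ ℂ)) ↔
      ∀ m ∈ f.support, ∃ j ∈ {j | j ∈ vs.take i}, m j ≠ 0 := by
    intro f
    rw [← MvPolynomial.mem_ideal_span_X_image, smul_eq_mul, Ideal.mul_top, ← List.map_take,
      Ideal.ofList]
    congr! 2
    ext
    simp [-List.map_take]
  intro x y hxy
  obtain ⟨f, rfl⟩ := Submodule.Quotient.mk_surjective _ x
  obtain ⟨g, rfl⟩ := Submodule.Quotient.mk_surjective _ y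
  rw [Submodule.Quotient.eq, h0]
  simp only [← Submodule.Quotient.mk_smul] at hxy
  rw [Submodule.Quotient.eq, h0, ← smul_sub] at hxy
  intro m hm
  rw [List.getElem_map, smul_eq_mul] at hxy
  obtain ⟨j, hj, hmj⟩ := hxy (m + Finsupp.single vs[i] 1) (by
    rwa [MvPolynomial.mem_support_iff, add_comm m, MvPolynomial.coeff_X_mul,
      ← MvPolynomial.mem_support_iff])
  refine ⟨j, hj, ?_⟩
  have hne : vs[i] ≠ j := by
    rintro rfl
    rw [Set.mem_ofPred_eq, List.mem_take_iff_getElem] at hj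
    obtain ⟨l, hl, hlv⟩ := hj
    have := (hvs.getElem_inj_iff).mp hlv
    omega
  rwa [Finsupp.add_apply, Finsupp.single_eq_of_ne hne.symm, add_zero] at hmj

open RingTheory.Sequence MvPolynomial in
/-- A sequence of polynomials vanishing at the origin that cuts out there a set of the expected
dimension is a regular sequence near the origin. -/
theorem exists_mul_mem_of_trdeg_le {σ : Type} [Fintype σ] (as : List (MvPolynomial σ ℂ))
    (has : ∀ a ∈ as, a ∈ idealOfVars σ ℂ) {d : ℕ} (hcard : Fintype.card σ = d + as.length)
    (hdim : ∀ P : Ideal (MvPolynomial σ ℂ), P.IsPrime → P ≤ idealOfVars σ ℂ →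
      (∀ a ∈ as, a ∈ P) → Algebra.trdeg ℂ (MvPolynomial σ ℂ ⧸ P) ≤ d)
    (i : ℕ) (hi : i < as.length) (y : MvPolynomial σ ℂ)
    (hy : as[i] * y ∈ Ideal.ofList (as.take i)) :
    ∃ s ∉ idealOfVars σ ℂ, s * y ∈ Ideal.ofList (as.take i) := by
  have hmax := isMaximal_idealOfVars σ
  let S := MvPolynomial σ ℂ
  let m : Ideal S := idealOfVars σ ℂ
  let L := Localization.AtPrime m
  have hmemL : ∀ a ∈ m, algebraMap S L a ∈ IsLocalRing.maximalIdeal L := fun a ha =>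
    (IsLocalization.AtPrime.to_map_mem_maximal_iff L m a).mpr ha
  have hN : IsNoetherianRing L := IsLocalization.isNoetherianRing m.primeCompl L inferInstance
  have hdepth : ∃ rs : List L, rs.length = d + (as.map (algebraMap S L)).length ∧
      (∀ r ∈ rs, r ∈ IsLocalRing.maximalIdeal L) ∧ IsRegular L rs := by
    refine ⟨((Finset.univ : Finset σ).toList.map X).map (algebraMap S L), ?_, ?_, ?_⟩
    · simp [hcard]
    · intro r hr
      simp only [List.map_map, List.mem_map, Function.comp_apply] at hr
      obtain ⟨v, -, rfl⟩ := hr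
      exact hmemL _ (Ideal.subset_span ⟨v, rfl⟩)
    · refine (isWeaklyRegular_X _ (Finset.nodup_toList _)).isRegular_of_isLocalization_of_mem L m ?_
      intro r hr
      rw [List.mem_map] at hr
      obtain ⟨v, -, rfl⟩ := hr
      exact Ideal.subset_span ⟨v, rfl⟩
  have hdim' : Module.supportDim L
      (L ⧸ (Ideal.ofList (as.map (algebraMap S L)) • ⊤ : Submodule L L)) ≤ d := by
    rw [smul_eq_mul, Ideal.mul_top, Module.supportDim_quotient_eq_ringKrullDim,
      ringKrullDim_quotient]
    refine iSup_le fun p => ?_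
    have hP0 := p.head.1.2
    set P := p.head.1.1.comap (algebraMap S L) with hP
    have hPp : P.IsPrime := Ideal.comap_isPrime _ _
    have hPm : P ≤ m := by
      have := ((IsLocalization.AtPrime.orderIsoOfPrime L m) ⟨p.head.1.1, hP0⟩).2.2
      exact this
    have hPa : ∀ a ∈ as, a ∈ P := fun a ha =>
      p.head.2 (Ideal.subset_span (List.mem_map_of_mem ha))
    obtain ⟨e, he, hde, -⟩ := exists_trdeg_eq (S ⧸ P)
    have h1 := hdim P hPp hPm hPa
    rw [he] at h1
    have h2 : (e : WithBot ℕ∞) ≤ d := by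
      have : e ≤ d := by exact_mod_cast h1
      exact_mod_cast this
    refine le_trans ?_ (hde.trans h2)
    rw [ringKrullDim_quotient]
    let q : LTSeries (PrimeSpectrum.zeroLocus (P : Set S)) :=
      { length := p.length
        toFun := fun j => ⟨PrimeSpectrum.comap (algebraMap S L) (p j).1,
          Ideal.comap_mono (LTSeries.head_le p j)⟩
        step := fun j => by
          have := p.step j
          exact (IsLocalization.orderEmbedding m.primeCompl L).strictMono this }
    exact Order.LTSeries.length_le_krullDim q
  have hreg := isWeaklyRegular_of_supportDim_le (as.map (algebraMap S L)) (by
    intro a ha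
    rw [List.mem_map] at ha
    obtain ⟨b, hb, rfl⟩ := ha
    exact hmemL b (has b hb)) hdepth hdim'
  have h3 := hreg.regular_mod_prev i (by simpa using hi)
  rw [isSMulRegular_iff_right_eq_zero_of_smul] at h3
  have hmap : ∀ f : S, algebraMap S L f ∈ (Ideal.ofList ((as.map (algebraMap S L)).take i) • ⊤ :
        Submodule L L) ↔ ∃ s ∉ m, s * f ∈ Ideal.ofList (as.take i) := by
    intro f
    rw [smul_eq_mul, Ideal.mul_top, ← List.map_take, ← Ideal.map_ofList,
      IsLocalization.algebraMap_mem_map_algebraMap_iff m.primeCompl]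
    rfl
  rw [← hmap]
  have h4 := h3 (Submodule.Quotient.mk (algebraMap S L y)) (by
    have h5 : algebraMap S L as[i] • algebraMap S L y = algebraMap S L (as[i] * y) :=
      (map_mul _ _ _).symm
    rw [← Submodule.Quotient.mk_smul, Submodule.Quotient.mk_eq_zero, List.getElem_map, h5, hmap]
    exact ⟨1, fun h => hmax.ne_top ((Ideal.eq_top_iff_one _).mpr h), by rwa [one_mul]⟩)
  rwa [Submodule.Quotient.mk_eq_zero] at h4

/-! ### The extended Rees ring of the filtration -/

theorem pairing_add {n : ℕ} (v : Fin n → ℕ) (a b : Fin n →₀ ℕ) :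
    pairing v (a + b) = pairing v a + pairing v b := by
  simp [pairing, mul_add, Finset.sum_add_distrib]

/-- The ideal of polynomials all of whose monomials `z^q` satisfy `⟨p_l, q⟩ ≥ μ_l` for all `l`. -/
def polyF {n r : ℕ} (p : Fin r → Fin n → ℕ) (μ : Fin r → ℤ) : Ideal (MvPolynomial (Fin n) ℂ) where
  carrier := {f | ∀ q, f.coeff q ≠ 0 → ∀ l, μ l ≤ (pairing (p l) q : ℤ)}
  zero_mem' q hq := absurd (MvPolynomial.coeff_zero q) hq
  add_mem' {f g} hf hg q hq := by
    by_cases h : f.coeff q = 0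
    · exact hg q fun h' => hq (by rw [MvPolynomial.coeff_add, h, h', add_zero])
    · exact hf q h
  smul_mem' c f hf q hq l := by
    rw [smul_eq_mul, MvPolynomial.coeff_mul] at hq
    obtain ⟨x, hx, hne⟩ := Finset.exists_ne_zero_of_sum_ne_zero hq
    have h1 := hf x.2 (right_ne_zero_of_mul hne) l
    rw [Finset.HasAntidiagonal.mem_antidiagonal] at hx
    rw [← hx, pairing_add]
    push_cast
    omega

theorem polyF_antitone {n r : ℕ} (p : Fin r → Fin n → ℕ) : Antitone (polyF p) :=
  fun _ _ h _ hf q hq l => (h l).trans (hf q hq l)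

/-- The grading by `ℤ^r` of the polynomial ring in variables `z_i` and `u_l`, where `z_i` has
degree `(p_1i, …, p_ri)` and `u_l` has degree `-e_l`. It is the extended Rees ring of the
filtration: its homogeneous elements of degree `μ` correspond to the elements of `F_μ`. -/
def reesWeight {n r : ℕ} (p : Fin r → Fin n → ℕ) : Fin n ⊕ Fin r → Fin r → ℤ :=
  Sum.elim (fun i l => (p l i : ℤ)) fun l => -Pi.single l 1

/-- The part in the variables `z_i` of an exponent. -/
noncomputable def zPart {n r : ℕ} (e : Fin n ⊕ Fin r →₀ ℕ) : Fin n →₀ ℕ :=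
  Finsupp.equivFunOnFinite.symm fun i => e (Sum.inl i)

@[simp]
theorem zPart_apply {n r : ℕ} (e : Fin n ⊕ Fin r →₀ ℕ) (i : Fin n) : zPart e i = e (Sum.inl i) :=
  rfl

theorem weight_reesWeight {n r : ℕ} (p : Fin r → Fin n → ℕ) (e : Fin n ⊕ Fin r →₀ ℕ)
    (l : Fin r) :
    Finsupp.weight (reesWeight p) e l = (pairing (p l) (zPart e) : ℤ) - e (Sum.inr l) := by
  rw [Finsupp.weight_apply, Finsupp.sum_fintype _ _ (by simp), Fintype.sum_sum_type,
    Pi.add_apply, Finset.sum_apply, Finset.sum_apply, sub_eq_add_neg]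
  congr 1
  · simp [reesWeight, pairing, mul_comm]
  · simp [reesWeight, Pi.single_apply, Finset.sum_neg_distrib]

/-- The exponent of the unique monomial of degree `μ` over `z^q`, if `⟨p_l, q⟩ ≥ μ_l` for
all `l`. -/
noncomputable def homExp {n r : ℕ} (p : Fin r → Fin n → ℕ) (μ : Fin r → ℤ) (q : Fin n →₀ ℕ) :
    Fin n ⊕ Fin r →₀ ℕ :=
  Finsupp.equivFunOnFinite.symm
    (Sum.elim q fun l => ((pairing (p l) q : ℤ) - μ l).toNat)

theorem zPart_homExp {n r : ℕ} (p : Fin r → Fin n → ℕ) (μ : Fin r → ℤ) (q : Fin n →₀ ℕ) :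
    zPart (homExp p μ q) = q := by
  ext i
  rfl

theorem homExp_inr {n r : ℕ} (p : Fin r → Fin n → ℕ) (μ : Fin r → ℤ) (q : Fin n →₀ ℕ)
    (l : Fin r) : homExp p μ q (Sum.inr l) = ((pairing (p l) q : ℤ) - μ l).toNat :=
  rfl

theorem homExp_zPart {n r : ℕ} (p : Fin r → Fin n → ℕ) {μ : Fin r → ℤ}
    {e : Fin n ⊕ Fin r →₀ ℕ} (he : Finsupp.weight (reesWeight p) e = μ) :
    homExp p μ (zPart e) = e := by
  ext (i | l)
  · rfl
  · rw [homExp_inr, ← he, weight_reesWeight]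
    omega

/-- Homogenization: the homogeneous element of degree `μ` that corresponds to an element of
`F_μ`. -/
noncomputable def hom {n r : ℕ} (p : Fin r → Fin n → ℕ) (μ : Fin r → ℤ) :
    MvPolynomial (Fin n) ℂ →ₗ[ℂ] MvPolynomial (Fin n ⊕ Fin r) ℂ :=
  (MvPolynomial.basisMonomials (Fin n) ℂ).constr ℂ
    fun q => MvPolynomial.monomial (homExp p μ q) (1 : ℂ)

theorem hom_monomial {n r : ℕ} (p : Fin r → Fin n → ℕ) (μ : Fin r → ℤ) (q : Fin n →₀ ℕ) (c : ℂ) :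
    hom p μ (MvPolynomial.monomial q c) = MvPolynomial.monomial (homExp p μ q) c := by
  have h := (MvPolynomial.basisMonomials (Fin n) ℂ).constr_basis ℂ
    (fun q => MvPolynomial.monomial (homExp p μ q) (1 : ℂ)) q
  rw [MvPolynomial.coe_basisMonomials] at h
  have h2 : MvPolynomial.monomial q c = c • MvPolynomial.monomial q (1 : ℂ) := by
    rw [MvPolynomial.smul_monomial, smul_eq_mul, mul_one]
  rw [h2, map_smul, hom, h, MvPolynomial.smul_monomial, smul_eq_mul, mul_one]

/-- Dehomogenization: all `u_l` are set to `1`. -/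
noncomputable def dehom (n r : ℕ) : MvPolynomial (Fin n ⊕ Fin r) ℂ →ₐ[ℂ] MvPolynomial (Fin n) ℂ :=
  MvPolynomial.aeval (Sum.elim MvPolynomial.X 1)

theorem dehom_monomial {n r : ℕ} (e : Fin n ⊕ Fin r →₀ ℕ) (c : ℂ) :
    dehom n r (MvPolynomial.monomial e c) = MvPolynomial.monomial (zPart e) c := by
  rw [dehom, MvPolynomial.aeval_monomial, Finsupp.prod_fintype _ _ (by simp),
    Fintype.prod_sum_type, MvPolynomial.monomial_eq, Finsupp.prod_fintype _ _ (by simp)]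
  simp [MvPolynomial.algebraMap_eq]

theorem dehom_X_inr {n r : ℕ} (l : Fin r) :
    dehom n r (MvPolynomial.X (Sum.inr l)) = 1 := by
  simp [dehom]

theorem dehom_hom {n r : ℕ} (p : Fin r → Fin n → ℕ) (μ : Fin r → ℤ)
    (f : MvPolynomial (Fin n) ℂ) : dehom n r (hom p μ f) = f := by
  induction f using MvPolynomial.induction_on' with
  | monomial q c => rw [hom_monomial, dehom_monomial, zPart_homExp]
  | add f g hf hg => rw [map_add, map_add, hf, hg]

theorem isWeightedHomogeneous_hom {n r : ℕ} {p : Fin r → Fin n → ℕ} {μ : Fin r → ℤ}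
    {f : MvPolynomial (Fin n) ℂ} (hf : f ∈ polyF p μ) :
    (hom p μ f).IsWeightedHomogeneous (reesWeight p) μ := by
  rw [f.as_sum, map_sum]
  refine MvPolynomial.IsWeightedHomogeneous.sum _ _ _ fun q hq => ?_
  rw [hom_monomial]
  refine MvPolynomial.isWeightedHomogeneous_monomial _ _ _ ?_
  ext l
  have := hf q (MvPolynomial.mem_support_iff.mp hq) l
  rw [weight_reesWeight, zPart_homExp, homExp_inr]
  omega

theorem hom_dehom {n r : ℕ} {p : Fin r → Fin n → ℕ} {μ : Fin r → ℤ}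
    {x : MvPolynomial (Fin n ⊕ Fin r) ℂ} (hx : x.IsWeightedHomogeneous (reesWeight p) μ) :
    hom p μ (dehom n r x) = x := by
  conv_lhs => rw [x.as_sum]
  rw [map_sum, map_sum]
  conv_rhs => rw [x.as_sum]
  refine Finset.sum_congr rfl fun e he => ?_
  rw [dehom_monomial, hom_monomial, homExp_zPart p (hx (MvPolynomial.mem_support_iff.mp he))]

theorem dehom_mem_polyF {n r : ℕ} {p : Fin r → Fin n → ℕ} {μ : Fin r → ℤ}
    {x : MvPolynomial (Fin n ⊕ Fin r) ℂ} (hx : x.IsWeightedHomogeneous (reesWeight p) μ) :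
    dehom n r x ∈ polyF p μ := by
  rw [x.as_sum, map_sum]
  refine Ideal.sum_mem _ fun e he q hq l => ?_
  rw [dehom_monomial, MvPolynomial.coeff_monomial] at hq
  have h1 : zPart e = q := by
    by_contra h
    exact hq (if_neg h)
  have h2 := weight_reesWeight p e l
  rw [hx (MvPolynomial.mem_support_iff.mp he), h1] at h2
  omega

theorem X_mul_hom {n r : ℕ} {p : Fin r → Fin n → ℕ} {μ : Fin r → ℤ} {l : Fin r}
    {f : MvPolynomial (Fin n) ℂ} (hf : f ∈ polyF p (μ + Pi.single l 1)) :
    MvPolynomial.X (Sum.inr l) * hom p (μ + Pi.single l 1) f = hom p μ f := by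
  have h1 : (MvPolynomial.X (Sum.inr l) * hom p (μ + Pi.single l 1) f).IsWeightedHomogeneous
      (reesWeight p) μ := by
    convert (MvPolynomial.isWeightedHomogeneous_X ℂ (reesWeight p) (Sum.inr l)).mul
      (isWeightedHomogeneous_hom hf) using 1
    simp [reesWeight]
  rw [← hom_dehom h1, map_mul, dehom_X_inr, one_mul, dehom_hom]

section Homogeneous

variable {σ M : Type*} [AddCommGroup M] {w : σ → M}

open MvPolynomial

theorem weightedHomogeneousComponent_mul_left {a : MvPolynomial σ ℂ} {α : M}
    (ha : a.IsWeightedHomogeneous w α) (μ : M) (y : MvPolynomial σ ℂ) :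
    weightedHomogeneousComponent w μ (a * y) =
      a * weightedHomogeneousComponent w (μ - α) y := by
  classical
  induction y using MvPolynomial.induction_on' with
  | monomial e c =>
    have hm := isWeightedHomogeneous_monomial w e c rfl
    have h := ha.mul hm
    rw [weightedHomogeneousComponent_of_mem hm, weightedHomogeneousComponent_of_mem h]
    by_cases hμ : μ = α + Finsupp.weight w e
    · rw [if_pos hμ, if_pos (by rw [hμ]; abel)]
    · rw [if_neg hμ, if_neg (fun h' => hμ (by rw [← h']; abel)), mul_zero]
  | add f g hf hg => rw [mul_add, map_add, hf, hg, map_add, mul_add]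

theorem weightedHomogeneousComponent_mem_span {s : Set (MvPolynomial σ ℂ)}
    (hs : ∀ a ∈ s, ∃ α, a.IsWeightedHomogeneous w α) {x : MvPolynomial σ ℂ}
    (hx : x ∈ Ideal.span s) (μ : M) : weightedHomogeneousComponent w μ x ∈ Ideal.span s := by
  induction hx using Submodule.span_induction generalizing μ with
  | mem a ha =>
    obtain ⟨α, hα⟩ := hs a ha
    rw [← mul_one a, weightedHomogeneousComponent_mul_left hα]
    exact Ideal.mul_mem_right _ _ (Ideal.subset_span ha)
  | zero => rw [map_zero]; exact zero_mem _
  | add x y _ _ hx hy => rw [map_add]; exact add_mem (hx μ) (hy μ)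
  | smul c x _ hx =>
    induction c using MvPolynomial.induction_on' with
    | monomial e b =>
      rw [smul_eq_mul, weightedHomogeneousComponent_mul_left
        (isWeightedHomogeneous_monomial w e b rfl)]
      exact Ideal.mul_mem_left _ _ (hx _)
    | add f g hf hg => rw [add_smul, map_add]; exact add_mem hf hg

theorem mem_of_weightedHomogeneousComponent_mem (w : σ → M) {I : Ideal (MvPolynomial σ ℂ)}
    {x : MvPolynomial σ ℂ} (h : ∀ μ, weightedHomogeneousComponent w μ x ∈ I) : x ∈ I := by
  rw [← finsum_weightedHomogeneousComponent w x]
  exact finsum_induction (· ∈ I) I.zero_mem (fun _ _ => I.add_mem) h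

end Homogeneous

/-- The initial part of a polynomial at the level `a_j` for all `j ∈ J`. -/
noncomputable def polyInitial {n r : ℕ} (p : Fin r → Fin n → ℕ) (a : Fin r → ℕ)
    (J : Finset (Fin r)) (f : MvPolynomial (Fin n) ℂ) : MvPolynomial (Fin n) ℂ :=
  ∑ q ∈ f.support with ∀ j ∈ J, pairing (p j) q = a j, MvPolynomial.monomial q (f.coeff q)

theorem coeff_polyInitial {n r : ℕ} (p : Fin r → Fin n → ℕ) (a : Fin r → ℕ)
    (J : Finset (Fin r)) (f : MvPolynomial (Fin n) ℂ) (q : Fin n →₀ ℕ) :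
    (polyInitial p a J f).coeff q =
      if ∀ j ∈ J, pairing (p j) q = a j then f.coeff q else 0 := by
  classical
  rw [polyInitial, MvPolynomial.coeff_sum]
  simp only [MvPolynomial.coeff_monomial, Finset.sum_ite_eq', Finset.mem_filter,
    MvPolynomial.mem_support_iff]
  split_ifs with h1 h2 h2
  · rfl
  · exact absurd h1.2 h2
  · exact (not_not.mp fun h => h1 ⟨h, h2⟩).symm
  · rfl

/-- The substitution `z_i ↦ z_i ∏_{l ∉ J} u_l^{p_li}`. -/
noncomputable def torusSubst {n r : ℕ} (p : Fin r → Fin n → ℕ) (J : Finset (Fin r)) :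
    MvPolynomial (Fin n) ℂ →ₐ[ℂ] MvPolynomial (Fin n ⊕ Fin r) ℂ :=
  MvPolynomial.aeval fun i =>
    MvPolynomial.X (Sum.inl i) * ∏ l ∈ Jᶜ, MvPolynomial.X (Sum.inr l) ^ p l i

open MvPolynomial in
theorem torusSubst_monomial {n r : ℕ} (p : Fin r → Fin n → ℕ) (J : Finset (Fin r))
    (q : Fin n →₀ ℕ) (c : ℂ) :
    torusSubst p J (monomial q c) =
      C c * (∏ i, X (Sum.inl i) ^ q i) * ∏ l ∈ Jᶜ, X (Sum.inr l) ^ pairing (p l) q := by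
  rw [torusSubst, aeval_monomial, Finsupp.prod_fintype _ _ (by simp), algebraMap_eq, mul_assoc]
  congr 1
  simp only [mul_pow, Finset.prod_mul_distrib, pairing, ← Finset.prod_pow_eq_pow_sum,
    ← Finset.prod_pow]
  congr 1
  rw [Finset.prod_comm]
  simp only [pow_mul]

open MvPolynomial in
theorem hom_monomial' {n r : ℕ} (p : Fin r → Fin n → ℕ) (μ : Fin r → ℤ)
    (q : Fin n →₀ ℕ) (c : ℂ) :
    hom p μ (monomial q c) =
      C c * (∏ i, X (Sum.inl i) ^ q i) *
        ∏ l, X (Sum.inr l) ^ ((pairing (p l) q : ℤ) - μ l).toNat := by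
  rw [hom_monomial, monomial_eq, Finsupp.prod_fintype _ _ (by simp), Fintype.prod_sum_type,
    mul_assoc]
  rfl

open MvPolynomial in
/-- Modulo the variables `u_j`, `j ∈ J`, the homogenization of `f` is its initial part, up to the
substitution `torusSubst` and a monomial. -/
theorem torusSubst_polyInitial_mem {n r : ℕ} {p : Fin r → Fin n → ℕ} {J : Finset (Fin r)}
    {a : Fin r → ℕ} {f : MvPolynomial (Fin n) ℂ}
    (hf : ∀ q, f.coeff q ≠ 0 → ∀ l, a l ≤ pairing (p l) q)
    {P : Ideal (MvPolynomial (Fin n ⊕ Fin r) ℂ)} (hP : ∀ j ∈ J, X (Sum.inr j) ∈ P)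
    (hfP : hom p (fun l => (a l : ℤ)) f ∈ P) : torusSubst p J (polyInitial p a J f) ∈ P := by
  have h1 : torusSubst p J (polyInitial p a J f) -
      (∏ l ∈ Jᶜ, X (Sum.inr l) ^ a l) * hom p (fun l => (a l : ℤ)) f ∈ P := by
    have h2 : hom p (fun l => (a l : ℤ)) f =
        ∑ q ∈ f.support, hom p (fun l => (a l : ℤ)) (monomial q (f.coeff q)) := by
      rw [← map_sum, ← f.as_sum]
    rw [h2, polyInitial, map_sum, Finset.sum_filter, Finset.mul_sum, ← Finset.sum_sub_distrib]
    refine Ideal.sum_mem _ fun q hq => ?_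
    have hq' := hf q (mem_support_iff.mp hq)
    rw [hom_monomial']
    have hnat : ∀ l, ((pairing (p l) q : ℤ) - a l).toNat = pairing (p l) q - a l := by
      intro l
      omega
    simp only [hnat]
    split_ifs with hJ
    · rw [torusSubst_monomial, ← Finset.prod_mul_prod_compl J]
      have h3 : ∏ l ∈ J, (X (Sum.inr l) : MvPolynomial (Fin n ⊕ Fin r) ℂ) ^
          (pairing (p l) q - a l) = 1 :=
        Finset.prod_eq_one fun j hj => by rw [hJ j hj, Nat.sub_self, pow_zero]
      have h4 : ∏ l ∈ Jᶜ, (X (Sum.inr l) : MvPolynomial (Fin n ⊕ Fin r) ℂ) ^ pairing (p l) q =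
          (∏ l ∈ Jᶜ, X (Sum.inr l) ^ a l) *
            ∏ l ∈ Jᶜ, X (Sum.inr l) ^ (pairing (p l) q - a l) := by
        rw [← Finset.prod_mul_distrib]
        refine Finset.prod_congr rfl fun l _ => ?_
        rw [← pow_add, Nat.add_sub_cancel' (hq' l)]
      rw [h3, h4]
      convert P.zero_mem using 1
      ring
    · push Not at hJ
      obtain ⟨j, hj, hne⟩ := hJ
      rw [zero_sub]
      refine P.neg_mem (Ideal.mul_mem_left _ _ (Ideal.mul_mem_left _ _ ?_))
      refine P.mem_of_dvd (Finset.dvd_prod_of_mem _ (Finset.mem_univ j)) ?_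
      refine Ideal.pow_mem_of_mem _ (hP j hj) _ ?_
      have := hq' j
      omega
  rw [← sub_add_cancel (torusSubst p J (polyInitial p a J f))
    ((∏ l ∈ Jᶜ, X (Sum.inr l) ^ a l) * hom p (fun l => (a l : ℤ)) f)]
  exact add_mem h1 (Ideal.mul_mem_left _ _ hfP)

open MvPolynomial in
/-- The dimension of the strata of the special fibres of the extended Rees ring: on the stratum
where exactly the `u_j`, `j ∈ J`, vanish, the torus of the remaining `u_l` acts, and a slice is
given by the initial parts for `J`. -/
theorem trdeg_rees_le {n r k : ℕ} {p : Fin r → Fin n → ℕ} {a : Fin k → Fin r → ℕ}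
    {g : Fin k → MvPolynomial (Fin n) ℂ}
    (hg : ∀ m q, (g m).coeff q ≠ 0 → ∀ l, a m l ≤ pairing (p l) q)
    (hdim : ∀ J : Finset (Fin r), 2 ≤ J.card → ∀ Q : Ideal (MvPolynomial (Fin n) ℂ), Q.IsPrime →
      Q ≤ idealOfVars (Fin n) ℂ → (∀ m, polyInitial p (a m) J (g m) ∈ Q) →
      Algebra.trdeg ℂ (MvPolynomial (Fin n) ℂ ⧸ Q) + (k + 2 : ℕ) ≤ (n + J.card : ℕ))
    {i j : Fin r} (hij : i ≠ j) {P : Ideal (MvPolynomial (Fin n ⊕ Fin r) ℂ)} (hP : P.IsPrime)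
    (hPm : P ≤ idealOfVars (Fin n ⊕ Fin r) ℂ) (hi : X (Sum.inr i) ∈ P) (hj : X (Sum.inr j) ∈ P)
    (hgP : ∀ m, hom p (fun l => (a m l : ℤ)) (g m) ∈ P) :
    Algebra.trdeg ℂ (MvPolynomial (Fin n ⊕ Fin r) ℂ ⧸ P) + (k + 2 : ℕ) ≤ (n + r : ℕ) := by
  classical
  set J : Finset (Fin r) := {l | X (Sum.inr l) ∈ P} with hJ
  have hJmem : ∀ l, l ∈ J ↔ X (Sum.inr l) ∈ P := fun l => by rw [hJ]; simp
  have hcard : 2 ≤ J.card := by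
    rw [← Finset.card_pair hij]
    refine Finset.card_le_card fun l hl => ?_
    rw [Finset.mem_insert, Finset.mem_singleton] at hl
    rcases hl with rfl | rfl
    · exact (hJmem _).mpr hi
    · exact (hJmem _).mpr hj
  let φ : MvPolynomial (Fin n) ℂ →ₐ[ℂ] MvPolynomial (Fin n ⊕ Fin r) ℂ ⧸ P :=
    (Ideal.Quotient.mkₐ ℂ P).comp (torusSubst p J)
  have hφ : ∀ f, φ f = Ideal.Quotient.mk P (torusSubst p J f) := fun _ => rfl
  set Q := RingHom.ker φ with hQ
  have hQp : Q.IsPrime := RingHom.ker_isPrime _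
  have hQmem : ∀ f, f ∈ Q ↔ torusSubst p J f ∈ P := fun f => by
    rw [hQ, RingHom.mem_ker, hφ, Ideal.Quotient.eq_zero_iff_mem]
  have hsubst : (constantCoeff (σ := Fin n ⊕ Fin r) (R := ℂ)).comp (torusSubst p J).toRingHom =
      constantCoeff := by
    refine ringHom_ext (fun c => ?_) fun v => ?_
    · simp [torusSubst, algebraMap_eq]
    · simp [torusSubst]
  have hQm : Q ≤ idealOfVars (Fin n) ℂ := by
    intro f hf
    have h1 := hPm ((hQmem f).mp hf)
    rw [mem_idealOfVars] at h1 ⊢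
    rw [← h1, ← hsubst]
    rfl
  have h1 := hdim J hcard Q hQp hQm fun m => (hQmem _).mpr
    (torusSubst_polyInitial_mem (hg m) (fun l hl => (hJmem l).mp hl) (hgP m))
  let t : {l // l ∉ J} → MvPolynomial (Fin n ⊕ Fin r) ℂ ⧸ P :=
    fun l => Ideal.Quotient.mk P (X (Sum.inr l.1))
  have halg : ∀ x : MvPolynomial (Fin n ⊕ Fin r) ℂ ⧸ P,
      IsAlgebraic (Algebra.adjoin φ.range (Set.range t)) x := by
    set D := Algebra.adjoin φ.range (Set.range t) with hD
    have ht : ∀ l (hl : l ∉ J), Ideal.Quotient.mk P (X (Sum.inr l)) ∈ D := fun l hl =>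
      Algebra.subset_adjoin ⟨⟨l, hl⟩, rfl⟩
    have hφD : ∀ f, φ f ∈ D := fun f => D.algebraMap_mem ⟨φ f, f, rfl⟩
    have halgD : ∀ y ∈ D, IsAlgebraic D y := fun y hy => isAlgebraic_algebraMap (⟨y, hy⟩ : D)
    intro x
    obtain ⟨f, rfl⟩ := Ideal.Quotient.mk_surjective x
    induction f using MvPolynomial.induction_on with
    | C c =>
      refine halgD _ ?_
      convert hφD (C c) using 1
      rw [hφ]
      simp [torusSubst, algebraMap_eq]
    | add f g hf hg => rw [map_add]; exact hf.add hg
    | mul_X f v hf =>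
      rw [map_mul]
      refine hf.mul ?_
      rcases v with v | l
      · set U := ∏ l ∈ Jᶜ, (X (Sum.inr l) : MvPolynomial (Fin n ⊕ Fin r) ℂ) ^ p l v with hU
        have hUP : Ideal.Quotient.mk P U ≠ 0 := by
          rw [Ne, Ideal.Quotient.eq_zero_iff_mem, hU, hP.prod_mem_iff]
          rintro ⟨l, hl, hl'⟩
          exact Finset.mem_compl.mp hl ((hJmem l).mpr (hP.mem_of_pow_mem _ hl'))
        have hUD : Ideal.Quotient.mk P U ∈ D := by
          rw [hU, map_prod]
          refine prod_mem fun l hl => ?_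
          rw [map_pow]
          exact pow_mem (ht l (Finset.mem_compl.mp hl)) _
        have h2 : Ideal.Quotient.mk P U * Ideal.Quotient.mk P (X (Sum.inl v)) ∈ D := by
          convert hφD (X v) using 1
          rw [hφ, torusSubst, aeval_X, ← map_mul, mul_comm]
        exact IsAlgebraic.of_mul (mem_nonZeroDivisors_of_ne_zero hUP) (halgD _ hUD) (halgD _ h2)
      · by_cases hl : l ∈ J
        · rw [Ideal.Quotient.eq_zero_iff_mem.mpr ((hJmem l).mp hl)]
          exact isAlgebraic_zero
        · exact halgD _ (ht l hl)
  have h2 := trdeg_le_of_isAlgebraic φ t halg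
  obtain ⟨d, hd, -⟩ := exists_trdeg_eq (MvPolynomial (Fin n) ℂ ⧸ Q)
  rw [← hQ, hd] at h2
  rw [hd] at h1
  have h3 : d + (k + 2) ≤ n + J.card := by exact_mod_cast h1
  have h4 : Fintype.card {l // l ∉ J} = r - J.card := by
    rw [Fintype.card_subtype_compl]
    simp
  have h5 : J.card ≤ r := by simpa using J.card_le_univ
  rw [h4] at h2
  refine (add_le_add_left h2 _).trans ?_
  norm_cast
  omega

/-! ### Regularity of the equations in the Rees ring -/

open MvPolynomial in
/-- For homogeneous elements, regularity near the origin implies regularity: modulo `u_j` an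
element of degree zero is a constant. -/
theorem mem_span_of_locally_regular {n r : ℕ} {p : Fin r → Fin n → ℕ} (hpos : ∀ l i, 0 < p l i)
    {s : Set (MvPolynomial (Fin n ⊕ Fin r) ℂ)}
    (hs : ∀ a ∈ s, ∃ α, a.IsWeightedHomogeneous (reesWeight p) α) {j : Fin r}
    (hj : X (Sum.inr j) ∈ Ideal.span s) {a : MvPolynomial (Fin n ⊕ Fin r) ℂ} {α : Fin r → ℤ}
    (ha : a.IsWeightedHomogeneous (reesWeight p) α)
    (hloc : ∀ y, a * y ∈ Ideal.span s →
      ∃ c ∉ idealOfVars (Fin n ⊕ Fin r) ℂ, c * y ∈ Ideal.span s)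
    {y : MvPolynomial (Fin n ⊕ Fin r) ℂ} (hy : a * y ∈ Ideal.span s) : y ∈ Ideal.span s := by
  classical
  refine mem_of_weightedHomogeneousComponent_mem (reesWeight p) fun μ => ?_
  set z := weightedHomogeneousComponent (reesWeight p) μ y with hz
  have hzh : z.IsWeightedHomogeneous (reesWeight p) μ :=
    weightedHomogeneousComponent_isWeightedHomogeneous _ _
  have h1 := weightedHomogeneousComponent_mem_span hs hy (μ + α)
  rw [weightedHomogeneousComponent_mul_left ha, add_sub_cancel_right, ← hz] at h1
  obtain ⟨c, hc, hcz⟩ := hloc z h1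
  rw [mem_idealOfVars] at hc
  have h2 := weightedHomogeneousComponent_mem_span hs hcz μ
  rw [mul_comm c, weightedHomogeneousComponent_mul_left hzh, sub_self] at h2
  set c₀ := weightedHomogeneousComponent (reesWeight p) 0 c with hc₀
  have h3 : c₀ - C (constantCoeff c) ∈ Ideal.span s := by
    have h4 : c₀ - C (constantCoeff c) ∈
        Ideal.span (X '' {(Sum.inr j : Fin n ⊕ Fin r)}) := by
      rw [mem_ideal_span_X_image]
      intro e he
      refine ⟨_, rfl, fun hej => ?_⟩
      rw [mem_support_iff, MvPolynomial.coeff_sub, hc₀, coeff_weightedHomogeneousComponent,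
        coeff_C] at he
      by_cases hw : Finsupp.weight (reesWeight p) e = 0
      · have h5 := fun l => congrFun hw l
        simp only [weight_reesWeight, Pi.zero_apply] at h5
        have h6 : pairing (p j) (zPart e) = 0 := by
          have := h5 j
          omega
        have h7 : ∀ i, e (Sum.inl i) = 0 := by
          intro i
          rw [pairing, Finset.sum_eq_zero_iff] at h6
          exact (Nat.mul_eq_zero.mp (h6 i (Finset.mem_univ i))).resolve_left (hpos j i).ne'
        have h8 : e = 0 := by
          ext (i | l)
          · exact h7 i
          · have h9 : pairing (p l) (zPart e) = 0 := by simp [pairing, h7]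
            have := h5 l
            rw [Finsupp.zero_apply]
            omega
        apply he
        rw [h8]
        simp [constantCoeff_eq]
      · apply he
        rw [if_neg hw, if_neg (fun h => hw (by rw [← h, map_zero])), sub_zero]
    refine (Ideal.span_le.mpr ?_ : Ideal.span (X '' {(Sum.inr j : Fin n ⊕ Fin r)}) ≤ _) h4
    rw [Set.image_singleton, Set.singleton_subset_iff]
    exact hj
  have h5 : z * C (constantCoeff c) ∈ Ideal.span s := by
    rw [← sub_sub_cancel c₀ (C (constantCoeff c)), mul_sub]
    exact sub_mem h2 (Ideal.mul_mem_left _ _ h3)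
  have h6 := Ideal.mul_mem_right (C (constantCoeff c)⁻¹) _ h5
  rwa [mul_assoc, ← C_mul, mul_inv_cancel₀ hc, C_1, mul_one] at h6

open MvPolynomial in
theorem hom_mem_idealOfVars {n r : ℕ} (p : Fin r → Fin n → ℕ) (μ : Fin r → ℤ)
    {f : MvPolynomial (Fin n) ℂ} (hf : f ∈ idealOfVars (Fin n) ℂ) :
    hom p μ f ∈ idealOfVars (Fin n ⊕ Fin r) ℂ := by
  classical
  rw [mem_idealOfVars, constantCoeff_eq] at hf
  rw [f.as_sum, map_sum]
  refine Ideal.sum_mem _ fun q _ => ?_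
  rw [hom_monomial, mem_idealOfVars, constantCoeff_eq, coeff_monomial]
  refine ite_eq_right_iff.mpr fun h => ?_
  have h1 : q = 0 := by
    rw [← zPart_homExp p μ q, h]
    ext i
    rfl
  rw [h1, hf]

/-- Induction along lattice paths from `κ` up to `κ'`. -/
theorem lattice_induction {r : ℕ} {κ κ' : Fin r → ℤ} (hκ : κ ≤ κ') {motive : (Fin r → ℤ) → Prop}
    (h0 : motive κ)
    (hstep : ∀ lam l, κ ≤ lam → lam ≤ κ' → lam l < κ' l → motive lam →
      motive (lam + Pi.single l 1)) : motive κ' := by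
  suffices h : ∀ N : ℕ, ∀ lam, κ ≤ lam → lam ≤ κ' → motive lam →
      (∑ l, (κ' l - lam l)).toNat = N → motive κ' from h _ κ le_rfl hκ h0 rfl
  intro N
  induction N with
  | zero =>
    intro lam h1 h2 h3 h4
    have h5 : ∀ l ∈ Finset.univ, κ' l - lam l = 0 := by
      rw [← Finset.sum_eq_zero_iff_of_nonneg fun l _ => sub_nonneg.mpr (h2 l)]
      have : 0 ≤ ∑ l, (κ' l - lam l) := Finset.sum_nonneg fun l _ => sub_nonneg.mpr (h2 l)
      omega
    have h6 : lam = κ' := funext fun l => by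
      have := h5 l (Finset.mem_univ l)
      omega
    rwa [← h6]
  | succ N ih =>
    intro lam h1 h2 h3 h4
    obtain ⟨l, hl⟩ : ∃ l, lam l < κ' l := by
      by_contra hcon
      push Not at hcon
      have : ∑ l, (κ' l - lam l) = 0 :=
        Finset.sum_eq_zero fun l _ => sub_eq_zero.mpr (le_antisymm (hcon l) (h2 l))
      rw [this] at h4
      simp at h4
    refine ih (lam + Pi.single l 1) ?_ ?_ (hstep lam l h1 h2 hl h3) ?_
    · refine h1.trans (le_add_of_nonneg_right ?_)
      rw [Pi.single_nonneg]
      exact zero_le_one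
    · intro l'
      by_cases h : l' = l
      · subst h
        simp only [Pi.add_apply, Pi.single_eq_same]
        omega
      · simpa [Pi.single_eq_of_ne h] using h2 l'
    · simp only [Pi.add_apply, ← sub_sub, Finset.sum_sub_distrib, Finset.sum_pi_single',
        Finset.mem_univ, if_true]
      rw [Finset.sum_sub_distrib] at h4
      omega

/-- An antitone family of ideals indexed by `ℤ^r` that satisfies the intersection property for
single steps in two different directions satisfies it for all pairs of indices. -/
theorem inf_le_sup_of_step {A : Type*} [CommRing A] {r : ℕ} {L : (Fin r → ℤ) → Ideal A}
    (hL : Antitone L)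
    (hstep : ∀ (lam : Fin r → ℤ) (i j : Fin r), i ≠ j →
      L (lam + Pi.single i 1) ⊓ L (lam + Pi.single j 1) ≤ L (lam + Pi.single i 1 + Pi.single j 1))
    (α β : Fin r → ℤ) : L α ⊓ L β ≤ L (α ⊔ β) := by
  have hadd : ∀ {γ δ : Fin r → ℤ} {i}, γ ≤ δ → γ i < δ i → γ + Pi.single i 1 ≤ δ := by
    intro γ δ i h hi l
    by_cases hl : l = i
    · subst hl
      simp only [Pi.add_apply, Pi.single_eq_same]
      omega
    · simpa [Pi.single_eq_of_ne hl] using h l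
  have h1 : ∀ (γ δ : Fin r → ℤ) (i : Fin r) (x : A), γ ≤ δ → γ i = δ i →
      x ∈ L (γ + Pi.single i 1) → x ∈ L δ → x ∈ L (δ + Pi.single i 1) := by
    intro γ δ i x hγδ hi hx hxδ
    refine lattice_induction hγδ (motive := fun κ => x ∈ L (κ + Pi.single i 1)) hx ?_
    intro κ l hγκ hκδ hl hκ
    have hli : i ≠ l := by
      rintro rfl
      exact absurd hl (not_lt_of_ge (hi.symm.le.trans (hγκ i)))
    rw [add_right_comm]
    exact hstep κ i l hli ⟨hκ, hL (hadd hκδ hl) hxδ⟩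
  rintro x ⟨hxα, hxβ⟩
  refine lattice_induction (le_sup_right : β ≤ α ⊔ β) (motive := fun κ => x ∈ L κ) hxβ ?_
  intro κ l hβκ hκ hl hxκ
  have hlα : κ l < α l := by
    rw [Pi.sup_apply, lt_sup_iff] at hl
    exact hl.resolve_right (not_lt_of_ge (hβκ l))
  refine h1 (κ ⊓ α) κ l x inf_le_left ?_ (hL (hadd inf_le_right ?_) hxα) hxκ
  · rw [Pi.inf_apply, inf_eq_left]
    exact hlα.le
  · rw [Pi.inf_apply, inf_eq_left.mpr hlα.le]
    exact hlα

/-- Starting from any one of the indices `μ_l e_l` and joining the others one after the other leads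
to an index above `μ`. -/
theorem iInf_single_le_of_step {A : Type*} [CommRing A] {r : ℕ} [NeZero r]
    {L : (Fin r → ℤ) → Ideal A} (hL : Antitone L)
    (hstep : ∀ (lam : Fin r → ℤ) (i j : Fin r), i ≠ j →
      L (lam + Pi.single i 1) ⊓ L (lam + Pi.single j 1) ≤ L (lam + Pi.single i 1 + Pi.single j 1))
    (μ : Fin r → ℤ) : ⨅ l, L (Pi.single l (μ l)) ≤ L μ := by
  intro x hx
  rw [Submodule.mem_iInf] at hx
  have key : ∀ s : Finset (Fin r), ∃ κ, x ∈ L κ ∧ ∀ l ∈ s, Pi.single l (μ l) ≤ κ := by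
    intro s
    induction s using Finset.induction_on with
    | empty => exact ⟨_, hx 0, by simp⟩
    | insert l s _ ih =>
      obtain ⟨κ, hκ, hs⟩ := ih
      refine ⟨κ ⊔ Pi.single l (μ l), inf_le_sup_of_step hL hstep _ _ ⟨hκ, hx l⟩, ?_⟩
      intro l' hl'
      rcases Finset.mem_insert.mp hl' with rfl | h
      · exact le_sup_right
      · exact (hs l' h).trans le_sup_left
  obtain ⟨κ, hκ, hs⟩ := key Finset.univ
  refine hL (fun l => ?_) hκ
  simpa using hs l (Finset.mem_univ l) l

section Regular

open MvPolynomial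

variable {n r k : ℕ} {p : Fin r → Fin n → ℕ} {a : Fin k → Fin r → ℕ}
  {g : Fin k → MvPolynomial (Fin n) ℂ}

/-- The regularity of `u_j, G_1, …, G_k, u_i` in the Rees ring. The sequence starts with `u_j`,
so that the elements of degree zero are constants modulo its members; this is what makes
regularity at the origin global. -/
theorem getElem_mul_mem_rees (hpos : ∀ l i, 0 < p l i)
    (hg : ∀ m q, (g m).coeff q ≠ 0 → ∀ l, a m l ≤ pairing (p l) q)
    (hg0 : ∀ m, g m ∈ idealOfVars (Fin n) ℂ)
    (hdim : ∀ J : Finset (Fin r), 2 ≤ J.card → ∀ Q : Ideal (MvPolynomial (Fin n) ℂ), Q.IsPrime →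
      Q ≤ idealOfVars (Fin n) ℂ → (∀ m, polyInitial p (a m) J (g m) ∈ Q) →
      Algebra.trdeg ℂ (MvPolynomial (Fin n) ℂ ⧸ Q) + (k + 2 : ℕ) ≤ (n + J.card : ℕ))
    {i j : Fin r} (hij : i ≠ j) {as : List (MvPolynomial (Fin n ⊕ Fin r) ℂ)}
    (has : as = X (Sum.inr j) ::
      (List.ofFn (fun m => hom p (fun l => (a m l : ℤ)) (g m)) ++ [X (Sum.inr i)]))
    (t : ℕ) (ht0 : 0 < t) (ht : t < as.length) {y : MvPolynomial (Fin n ⊕ Fin r) ℂ}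
    (hy : as[t] * y ∈ Ideal.ofList (as.take t)) : y ∈ Ideal.ofList (as.take t) := by
  have hmem : ∀ x, x ∈ as ↔ x = X (Sum.inr j) ∨
      (∃ m, hom p (fun l => (a m l : ℤ)) (g m) = x) ∨ x = X (Sum.inr i) := by
    intro x
    rw [has]
    simp [List.mem_ofFn]
  have hhom : ∀ x ∈ as, ∃ α, x.IsWeightedHomogeneous (reesWeight p) α := by
    intro x hx
    rcases (hmem x).mp hx with rfl | ⟨m, rfl⟩ | rfl
    · exact ⟨_, isWeightedHomogeneous_X _ _ _⟩
    · exact ⟨_, isWeightedHomogeneous_hom fun q hq l => Nat.cast_le.mpr (hg m q hq l)⟩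
    · exact ⟨_, isWeightedHomogeneous_X _ _ _⟩
  have hvars : ∀ x ∈ as, x ∈ idealOfVars (Fin n ⊕ Fin r) ℂ := by
    intro x hx
    rcases (hmem x).mp hx with rfl | ⟨m, rfl⟩ | rfl
    · simp [mem_idealOfVars]
    · exact hom_mem_idealOfVars p _ (hg0 m)
    · simp [mem_idealOfVars]
  have hlen : as.length = k + 2 := by
    rw [has]
    simp
  have htr : ∀ P : Ideal (MvPolynomial (Fin n ⊕ Fin r) ℂ), P.IsPrime →
      P ≤ idealOfVars (Fin n ⊕ Fin r) ℂ → (∀ x ∈ as, x ∈ P) →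
      Algebra.trdeg ℂ (MvPolynomial (Fin n ⊕ Fin r) ℂ ⧸ P) + (k + 2 : ℕ) ≤ (n + r : ℕ) :=
    fun P hP hPm h => trdeg_rees_le hg hdim hij hP hPm (h _ ((hmem _).mpr (Or.inr (Or.inr rfl))))
      (h _ ((hmem _).mpr (Or.inl rfl))) fun m => h _ ((hmem _).mpr (Or.inr (Or.inl ⟨m, rfl⟩)))
  have hle : k + 2 ≤ n + r := by
    have h1 := le_add_self.trans (htr _ (isMaximal_idealOfVars _).isPrime le_rfl hvars)
    exact_mod_cast h1
  obtain ⟨α, hα⟩ := hhom _ (List.getElem_mem ht)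
  refine mem_span_of_locally_regular hpos (fun x hx => hhom x (List.mem_of_mem_take hx)) (j := j)
    (Ideal.subset_span ?_) hα (fun y hy => ?_) hy
  · obtain ⟨t, rfl⟩ := Nat.exists_eq_succ_of_ne_zero ht0.ne'
    have h1 : X (Sum.inr j) ∈ as.take (t + 1) := by
      rw [has, List.take_succ_cons]
      exact List.mem_cons_self
    exact h1
  · refine exists_mul_mem_of_trdeg_le as hvars (d := n + r - (k + 2)) ?_ ?_ t ht y hy
    · rw [hlen, Fintype.card_sum, Fintype.card_fin, Fintype.card_fin]
      omega
    · intro P hP hPm h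
      have h1 := htr P hP hPm h
      obtain ⟨d, hd, -⟩ := exists_trdeg_eq (MvPolynomial (Fin n ⊕ Fin r) ℂ ⧸ P)
      rw [hd] at h1 ⊢
      have h2 : d + (k + 2) ≤ n + r := by exact_mod_cast h1
      exact_mod_cast Nat.le_sub_of_add_le h2

/-- In the quotient of the Rees ring by the homogenized equations, `u_i` is a non-zero-divisor
modulo `u_j`. -/
theorem mem_of_X_mul_mem_sup (hpos : ∀ l i, 0 < p l i)
    (hg : ∀ m q, (g m).coeff q ≠ 0 → ∀ l, a m l ≤ pairing (p l) q)
    (hg0 : ∀ m, g m ∈ idealOfVars (Fin n) ℂ)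
    (hdim : ∀ J : Finset (Fin r), 2 ≤ J.card → ∀ Q : Ideal (MvPolynomial (Fin n) ℂ), Q.IsPrime →
      Q ≤ idealOfVars (Fin n) ℂ → (∀ m, polyInitial p (a m) J (g m) ∈ Q) →
      Algebra.trdeg ℂ (MvPolynomial (Fin n) ℂ ⧸ Q) + (k + 2 : ℕ) ≤ (n + J.card : ℕ))
    {i j : Fin r} (hij : i ≠ j) {y : MvPolynomial (Fin n ⊕ Fin r) ℂ}
    (hy : X (Sum.inr i) * y ∈ Ideal.span {X (Sum.inr j)} ⊔
      Ideal.span (Set.range fun m => hom p (fun l => (a m l : ℤ)) (g m))) :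
    y ∈ Ideal.span {X (Sum.inr j)} ⊔
      Ideal.span (Set.range fun m => hom p (fun l => (a m l : ℤ)) (g m)) := by
  set Gs := List.ofFn (fun m => hom p (fun l => (a m l : ℤ)) (g m)) with hGs
  have hspan : Ideal.ofList Gs =
      Ideal.span (Set.range fun m => hom p (fun l => (a m l : ℤ)) (g m)) := by
    rw [Ideal.ofList]
    congr 1
    ext x
    simp [hGs, List.mem_ofFn]
  have hlen : Gs.length = k := by simp [hGs]
  have htake : (X (Sum.inr j) :: (Gs ++ [X (Sum.inr i)])).take (k + 1) =
      X (Sum.inr j) :: Gs := by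
    rw [List.take_succ_cons, ← hlen, List.take_left]
  have h := getElem_mul_mem_rees (as := X (Sum.inr j) :: (Gs ++ [X (Sum.inr i)]))
    hpos hg hg0 hdim hij rfl (k + 1) (by omega) (by simp [hlen]) (y := y)
  rw [htake, Ideal.ofList_cons, hspan] at h
  refine h ?_
  simpa [List.getElem_append, hlen] using hy

/-- In the quotient of the Rees ring by the homogenized equations, every `u_j` is a
non-zero-divisor, since the equations form a regular sequence modulo `u_j`. -/
theorem mem_of_X_mul_mem (hpos : ∀ l i, 0 < p l i)
    (hg : ∀ m q, (g m).coeff q ≠ 0 → ∀ l, a m l ≤ pairing (p l) q)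
    (hg0 : ∀ m, g m ∈ idealOfVars (Fin n) ℂ)
    (hdim : ∀ J : Finset (Fin r), 2 ≤ J.card → ∀ Q : Ideal (MvPolynomial (Fin n) ℂ), Q.IsPrime →
      Q ≤ idealOfVars (Fin n) ℂ → (∀ m, polyInitial p (a m) J (g m) ∈ Q) →
      Algebra.trdeg ℂ (MvPolynomial (Fin n) ℂ ⧸ Q) + (k + 2 : ℕ) ≤ (n + J.card : ℕ))
    {i j : Fin r} (hij : i ≠ j) {y : MvPolynomial (Fin n ⊕ Fin r) ℂ}
    (hy : X (Sum.inr j) * y ∈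
      Ideal.span (Set.range fun m => hom p (fun l => (a m l : ℤ)) (g m))) :
    y ∈ Ideal.span (Set.range fun m => hom p (fun l => (a m l : ℤ)) (g m)) := by
  set Gs := List.ofFn (fun m => hom p (fun l => (a m l : ℤ)) (g m)) with hGs
  have hspan : Ideal.ofList Gs =
      Ideal.span (Set.range fun m => hom p (fun l => (a m l : ℤ)) (g m)) := by
    rw [Ideal.ofList]
    congr 1
    ext x
    simp [hGs, List.mem_ofFn]
  have hlen : Gs.length = k := by simp [hGs]
  have key : ∀ t, t ≤ k → ∀ y, X (Sum.inr j) * y ∈ Ideal.ofList (Gs.take t) →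
      y ∈ Ideal.ofList (Gs.take t) := by
    intro t
    induction t with
    | zero =>
      intro _ y hy
      rw [List.take_zero, Ideal.ofList_nil, Ideal.mem_bot] at hy ⊢
      exact (mul_eq_zero.mp hy).resolve_left (X_ne_zero _)
    | succ t ih =>
      intro ht y hy
      have ht' : t < Gs.length := by omega
      rw [List.take_succ_eq_append_getElem ht', Ideal.ofList_append, Ideal.ofList_singleton]
        at hy ⊢
      obtain ⟨w, hw, z, hz, hwz⟩ := Submodule.mem_sup.mp hy
      obtain ⟨b, rfl⟩ := Ideal.mem_span_singleton'.mp hz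
      have htake : (X (Sum.inr j) :: (Gs ++ [X (Sum.inr i)])).take (t + 1) =
          X (Sum.inr j) :: Gs.take t := by
        rw [List.take_succ_cons, List.take_append_of_le_length (by omega)]
      have h := getElem_mul_mem_rees (as := X (Sum.inr j) :: (Gs ++ [X (Sum.inr i)]))
        hpos hg hg0 hdim hij rfl (t + 1) (by omega) (by simp; omega) (y := b)
      rw [htake, Ideal.ofList_cons] at h
      have h1 := h (by
        simp only [List.getElem_cons_succ]
        rw [List.getElem_append_left ht', mul_comm, ← add_sub_cancel_left w (b * Gs[t]), hwz]
        exact sub_mem (Ideal.mem_sup_left (Ideal.mul_mem_right _ _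
          (Ideal.mem_span_singleton_self _))) (Ideal.mem_sup_right hw))
      obtain ⟨x, hx, v, hv, hxv⟩ := Submodule.mem_sup.mp h1
      obtain ⟨x, rfl⟩ := Ideal.mem_span_singleton'.mp hx
      have h2 : y - x * Gs[t] ∈ Ideal.ofList (Gs.take t) := by
        refine ih (by omega) _ ?_
        have h3 : X (Sum.inr j) * (y - x * Gs[t]) = w + v * Gs[t] := by
          rw [mul_sub, ← hwz, ← hxv]
          ring
        rw [h3]
        exact add_mem hw (Ideal.mul_mem_right _ _ hv)
      rw [← sub_add_cancel y (x * Gs[t])]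
      exact Submodule.add_mem_sup h2 (Ideal.mul_mem_left _ _ (Ideal.mem_span_singleton_self _))
  rw [← hspan] at hy ⊢
  have h := key k le_rfl y
  rw [← hlen, List.take_length] at h
  exact h hy

/-- Every element of `F_λ` in the ideal of the `g_m` is a combination of the `g_m` that
respects the filtration. -/
theorem hom_mem_span_of_mem (hpos : ∀ l i, 0 < p l i)
    (hg : ∀ m q, (g m).coeff q ≠ 0 → ∀ l, a m l ≤ pairing (p l) q)
    (hg0 : ∀ m, g m ∈ idealOfVars (Fin n) ℂ)
    (hdim : ∀ J : Finset (Fin r), 2 ≤ J.card → ∀ Q : Ideal (MvPolynomial (Fin n) ℂ), Q.IsPrime →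
      Q ≤ idealOfVars (Fin n) ℂ → (∀ m, polyInitial p (a m) J (g m) ∈ Q) →
      Algebra.trdeg ℂ (MvPolynomial (Fin n) ℂ ⧸ Q) + (k + 2 : ℕ) ≤ (n + J.card : ℕ))
    [Nontrivial (Fin r)] {lam : Fin r → ℤ} {f : MvPolynomial (Fin n) ℂ} (hf : f ∈ polyF p lam)
    (hfI : f ∈ Ideal.span (Set.range g)) :
    hom p lam f ∈ Ideal.span (Set.range fun m => hom p (fun l => (a m l : ℤ)) (g m)) := by
  obtain ⟨h, rfl⟩ := (Ideal.mem_span_range_iff_exists_fun).mp hfI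
  set f := ∑ m, h m * g m with hfdef
  have hκ : (fun l => min (lam l) 0) ≤ lam := fun l => min_le_left _ _
  refine lattice_induction hκ (motive := fun κ => hom p κ f ∈ Ideal.span _) ?_ ?_
  · set κ : Fin r → ℤ := fun l => min (lam l) 0 with hκdef
    set H : MvPolynomial (Fin n ⊕ Fin r) ℂ :=
      ∑ m, hom p (fun l => κ l - a m l) (h m) * hom p (fun l => (a m l : ℤ)) (g m) with hH
    have hHhom : H.IsWeightedHomogeneous (reesWeight p) κ := by
      refine IsWeightedHomogeneous.sum _ _ _ fun m _ => ?_
      have h1 : h m ∈ polyF p fun l => κ l - a m l := by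
        intro q _ l
        have : κ l ≤ 0 := min_le_right _ _
        show κ l - a m l ≤ _
        omega
      have h2 : g m ∈ polyF p fun l => (a m l : ℤ) := fun q hq l => Nat.cast_le.mpr (hg m q hq l)
      convert (isWeightedHomogeneous_hom h1).mul (isWeightedHomogeneous_hom h2) using 1
      ext l
      simp
    have hdH : dehom n r H = f := by
      rw [hH, map_sum]
      simp only [map_mul, dehom_hom, hfdef]
    rw [← hdH, hom_dehom hHhom]
    exact Ideal.sum_mem _ fun m _ => Ideal.mul_mem_left _ _ (Ideal.subset_span ⟨m, rfl⟩)
  · intro κ l _ hκl hl hmem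
    obtain ⟨i, hi⟩ := exists_ne l
    refine mem_of_X_mul_mem hpos hg hg0 hdim hi ?_
    rwa [X_mul_hom]
    refine polyF_antitone p (fun l' => ?_) hf
    by_cases h : l' = l
    · subst h
      simp only [Pi.add_apply, Pi.single_eq_same]
      omega
    · simpa [Pi.single_eq_of_ne h] using hκl l'

/-- The intersection property of the induced filtration for steps in two directions. -/
theorem polyF_sup_inf_le (hpos : ∀ l i, 0 < p l i)
    (hg : ∀ m q, (g m).coeff q ≠ 0 → ∀ l, a m l ≤ pairing (p l) q)
    (hg0 : ∀ m, g m ∈ idealOfVars (Fin n) ℂ)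
    (hdim : ∀ J : Finset (Fin r), 2 ≤ J.card → ∀ Q : Ideal (MvPolynomial (Fin n) ℂ), Q.IsPrime →
      Q ≤ idealOfVars (Fin n) ℂ → (∀ m, polyInitial p (a m) J (g m) ∈ Q) →
      Algebra.trdeg ℂ (MvPolynomial (Fin n) ℂ ⧸ Q) + (k + 2 : ℕ) ≤ (n + J.card : ℕ))
    (lam : Fin r → ℤ) {i j : Fin r} (hij : i ≠ j) :
    (polyF p (lam + Pi.single i 1) ⊔ Ideal.span (Set.range g)) ⊓
      (polyF p (lam + Pi.single j 1) ⊔ Ideal.span (Set.range g)) ≤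
      polyF p (lam + Pi.single i 1 + Pi.single j 1) ⊔ Ideal.span (Set.range g) := by
  have hnt : Nontrivial (Fin r) := ⟨i, j, hij⟩
  have hsingle : ∀ l : Fin r, lam ≤ lam + Pi.single l 1 := fun l =>
    le_add_of_nonneg_right (by rw [Pi.single_nonneg]; exact zero_le_one)
  rintro f ⟨hf1, hf2⟩
  obtain ⟨b, hb, x, hx, rfl⟩ := Submodule.mem_sup.mp hf1
  obtain ⟨c, hc, y, hy, hcy⟩ := Submodule.mem_sup.mp hf2
  have h1 : b - c ∈ Ideal.span (Set.range g) := by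
    have : b - c = y - x := by linear_combination -hcy
    rw [this]
    exact sub_mem hy hx
  have h2 := hom_mem_span_of_mem hpos hg hg0 hdim
    (sub_mem (polyF_antitone p (hsingle i) hb) (polyF_antitone p (hsingle j) hc)) h1
  rw [map_sub, ← X_mul_hom hb, ← X_mul_hom hc] at h2
  set G := Ideal.span (Set.range fun m => hom p (fun l => (a m l : ℤ)) (g m)) with hG
  have h3 : hom p (lam + Pi.single i 1) b ∈ Ideal.span {X (Sum.inr j)} ⊔ G := by
    refine mem_of_X_mul_mem_sup hpos hg hg0 hdim hij ?_
    rw [← sub_add_cancel (X (Sum.inr i) * hom p (lam + Pi.single i 1) b)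
      (X (Sum.inr j) * hom p (lam + Pi.single j 1) c), ← hG]
    exact add_mem (Ideal.mem_sup_right h2) (Ideal.mem_sup_left
      (Ideal.mul_mem_right _ _ (Ideal.mem_span_singleton_self _)))
  obtain ⟨w, hw, z, hz, hwz⟩ := Submodule.mem_sup.mp h3
  obtain ⟨v, rfl⟩ := Ideal.mem_span_singleton.mp hw
  set μ := lam + Pi.single i 1 with hμ
  have hsame := (isWeightedHomogeneous_hom hb).weightedHomogeneousComponent_same
  rw [← hwz, map_add, weightedHomogeneousComponent_mul_left
    (isWeightedHomogeneous_X ℂ (reesWeight p) (Sum.inr j)), hwz] at hsame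
  set v' := weightedHomogeneousComponent (reesWeight p) (μ - reesWeight p (Sum.inr j)) v with hv'
  have hv'F : dehom n r v' ∈ polyF p (μ + Pi.single j 1) := by
    have := dehom_mem_polyF
      (weightedHomogeneousComponent_isWeightedHomogeneous (w := reesWeight p)
        (μ - reesWeight p (Sum.inr j)) v)
    rwa [← hv', show μ - reesWeight p (Sum.inr j) = μ + Pi.single j 1 by simp [reesWeight]]
      at this
  have hGhom : ∀ x ∈ Set.range fun m => hom p (fun l => (a m l : ℤ)) (g m),
      ∃ α, x.IsWeightedHomogeneous (reesWeight p) α := by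
    rintro _ ⟨m, rfl⟩
    exact ⟨_, isWeightedHomogeneous_hom fun q hq l => Nat.cast_le.mpr (hg m q hq l)⟩
  have hz' := weightedHomogeneousComponent_mem_span hGhom hz μ
  have hdG : G ≤ (Ideal.span (Set.range g)).comap (dehom n r) := by
    rw [hG, Ideal.span_le]
    rintro _ ⟨m, rfl⟩
    rw [SetLike.mem_coe, Ideal.mem_comap, dehom_hom]
    exact Ideal.subset_span ⟨m, rfl⟩
  have h4 : b = dehom n r v' +
      dehom n r (weightedHomogeneousComponent (reesWeight p) μ z) := by
    conv_lhs => rw [← dehom_hom p μ b, ← hsame]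
    rw [map_add, map_mul, dehom_X_inr, one_mul]
  rw [h4, add_assoc (dehom n r v')]
  exact Submodule.add_mem_sup hv'F (add_mem (hdG hz') hx)

end Regular

/-! ### From polynomials to convergent power series -/

theorem degree_le_pairing {n : ℕ} {v : Fin n → ℕ} (hv : ∀ i, 0 < v i) (q : Fin n →₀ ℕ) :
    q.degree ≤ pairing v q := by
  rw [Finsupp.degree_eq_sum, pairing]
  exact Finset.sum_le_sum fun i _ => Nat.le_mul_of_pos_left _ (hv i)

theorem order_le_pairing {n : ℕ} (v : Fin n → ℕ) {f : O n} {q : Fin n →₀ ℕ}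
    (hq : coeff q f ≠ 0) : order v f ≤ pairing v q :=
  Nat.sInf_le ⟨q, hq, rfl⟩

open Classical in
theorem coeff_initialPart {n r : ℕ} (p : Fin r → Fin n → ℕ) (J : Finset (Fin r)) (f : O n)
    (q : Fin n →₀ ℕ) : coeff q (initialPart p J f) =
      if ∀ j ∈ J, pairing (p j) q = order (p j) f then coeff q f else 0 :=
  rfl

theorem ofPoly_monomial {n : ℕ} (q : Fin n →₀ ℕ) :
    ofPoly n (MvPolynomial.monomial q 1) = mono q := by
  classical
  refine ext_coeff fun x => ?_
  rw [coeff_ofPoly, MvPolynomial.coeff_monomial, coeff_mono]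
  simp only [eq_comm]

theorem F_eq_map {n r : ℕ} (p : Fin r → Fin n → ℕ) (μ : Fin r → ℤ) :
    F p μ = (polyF p μ).map (ofPoly n) := by
  apply le_antisymm
  · rw [F, Ideal.span_le]
    rintro _ ⟨q, hq, rfl⟩
    rw [← ofPoly_monomial]
    refine Ideal.mem_map_of_mem _ fun x hx l => ?_
    rw [MvPolynomial.coeff_monomial] at hx
    have : q = x := by
      by_contra h
      exact hx (if_neg h)
    rw [← this]
    exact hq l
  · rw [Ideal.map_le_iff_le_comap]
    intro f hf
    rw [Ideal.mem_comap, f.as_sum, map_sum]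
    refine Ideal.sum_mem _ fun q hq => ?_
    rw [← mul_one (f.coeff q), ← MvPolynomial.C_mul_monomial, map_mul, ofPoly_monomial]
    exact Ideal.mul_mem_left _ _ (Ideal.subset_span
      ⟨q, hf q (MvPolynomial.mem_support_iff.mp hq), rfl⟩)

theorem pow_idealOfVars_le_polyF {n r N : ℕ} {p : Fin r → Fin n → ℕ} (hpos : ∀ l i, 0 < p l i)
    {μ : Fin r → ℤ} (hN : ∀ l, μ l ≤ N) : idealOfVars (Fin n) ℂ ^ N ≤ polyF p μ := by
  intro f hf q hq l
  rw [MvPolynomial.mem_pow_idealOfVars_iff'] at hf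
  have h1 : N ≤ q.degree := by
    by_contra h
    exact hq (hf q (by omega))
  have h2 := degree_le_pairing (hpos l) q
  have h3 := hN l
  omega

theorem tail_le_F {n r N : ℕ} {p : Fin r → Fin n → ℕ} (hpos : ∀ l i, 0 < p l i)
    {μ : Fin r → ℤ} (hN : ∀ l, μ l ≤ N) : tail n N ≤ F p μ := by
  refine (tail_le_span_mono n N).trans (Ideal.span_mono (Set.image_mono ?_))
  intro q hq l
  have h1 : q.degree = N := hq
  have h2 := degree_le_pairing (hpos l) q
  have h3 := hN l
  omega

theorem coeff_zero_eq_zero_of_isCompleteIntersection {n k : ℕ} {g : Fin k → O n}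
    (hg : IsCompleteIntersection g) (m : Fin k) : coeff 0 (g m) = 0 := by
  by_contra hne
  have h1 : idealOf g = ⊤ :=
    Ideal.eq_top_of_isUnit_mem _ (Ideal.subset_span ⟨m, rfl⟩) (isUnit_iff_coeff_ne_zero.mpr hne)
  have h2 : Subsingleton (OY g) := Ideal.Quotient.subsingleton_iff.mpr h1
  rw [IsCompleteIntersection, ringKrullDim_eq_bot_of_subsingleton, WithBot.bot_add] at hg
  exact WithBot.bot_ne_coe hg

theorem initialPart_eq_ofPoly {n r N : ℕ} {p : Fin r → Fin n → ℕ} (hpos : ∀ l i, 0 < p l i)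
    {J : Finset (Fin r)} (hJ : J.Nonempty) {f : O n} (hN : ∀ l, order (p l) f < N) :
    initialPart p J f = ofPoly n (polyInitial p (fun l => order (p l) f) J (taylor N f)) := by
  refine ext_coeff fun q => ?_
  rw [coeff_initialPart, coeff_ofPoly, coeff_polyInitial, coeff_taylor]
  split_ifs with h1 h2
  · rfl
  · obtain ⟨j, hj⟩ := hJ
    exact absurd ((degree_le_pairing (hpos j) q).trans_lt ((h1 j hj).trans_lt (hN j))) h2
  · rfl

/-- The codimension hypothesis on the initial parts, for polynomials. -/
theorem trdeg_le_of_hasCodimGE {n k r N : ℕ} {g : Fin k → O n} {p : Fin r → Fin n → ℕ}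
    (hpos : ∀ l i, 0 < p l i) (hN : ∀ m l, order (p l) (g m) < N) {J : Finset (Fin r)}
    (hJ : J.Nonempty)
    (hcod : HasCodimGE (fun i => initialPart p J (g i)) ((k : ℤ) - J.card + 2))
    (Q : Ideal (MvPolynomial (Fin n) ℂ)) (hQ : Q.IsPrime) (hQm : Q ≤ idealOfVars (Fin n) ℂ)
    (hgQ : ∀ m, polyInitial p (fun l => order (p l) (g m)) J (taylor N (g m)) ∈ Q) :
    Algebra.trdeg ℂ (MvPolynomial (Fin n) ℂ ⧸ Q) + (k + 2 : ℕ) ≤ (n + J.card : ℕ) := by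
  set I := idealOf fun i => initialPart p J (g i) with hI
  have hIQ : I ≤ Q.map (ofPoly n) := by
    rw [hI, idealOf, Ideal.span_le]
    rintro _ ⟨m, rfl⟩
    simp only
    rw [initialPart_eq_ofPoly hpos hJ (hN m)]
    exact Ideal.mem_map_of_mem _ (hgQ m)
  have hImax : I ≠ ⊤ := by
    intro h
    have h1 : Q.map (ofPoly n) ≤ IsLocalRing.maximalIdeal (O n) := by
      rw [Ideal.map_le_iff_le_comap]
      intro f hf
      have h2 := hQm hf
      rw [Ideal.mem_comap, mem_maximalIdeal_iff, coeff_ofPoly]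
      rwa [mem_idealOfVars, MvPolynomial.constantCoeff_eq] at h2
    exact (IsLocalRing.maximalIdeal.isMaximal (O n)).ne_top (top_le_iff.mp (h ▸ hIQ.trans h1))
  have hnt : Nontrivial (O n ⧸ I) := Ideal.Quotient.nontrivial_iff.mpr hImax
  have hle : ringKrullDim (O n ⧸ I) ≤ n :=
    (ringKrullDim_le_of_surjective (Ideal.Quotient.mk I) Ideal.Quotient.mk_surjective).trans
      (ringKrullDim_O_le n)
  obtain ⟨D, hD⟩ : ∃ D : ℕ, ringKrullDim (O n ⧸ I) = D := by
    have h0 : 0 ≤ ringKrullDim (O n ⧸ I) := ringKrullDim_nonneg_of_nontrivial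
    generalize ringKrullDim (O n ⧸ I) = e at h0 hle
    induction e with
    | bot => simp at h0
    | coe e =>
      induction e with
      | top => exact absurd (top_le_iff.mp (WithBot.coe_le_coe.mp hle)) (ENat.natCast_ne_top n)
      | coe e => exact ⟨e, rfl⟩
  have h1 := trdeg_le_of_ringKrullDim_le Q hQm I hIQ hD.le
  have h2 := hcod D hD.ge
  refine (add_le_add_left h1 _).trans ?_
  norm_cast
  omega

theorem FY_le_EGY {n k r : ℕ} (g : Fin k → O n) (p : Fin r → Fin n → ℕ) (μ : Fin r → ℤ) :
    FY g p μ ≤ EGY g p μ := by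
  refine le_iInf fun l => Ideal.map_mono (Ideal.span_mono (Set.image_mono ?_))
  intro q hq l'
  by_cases h : l' = l
  · subst h
    simpa using hq l'
  · simp [Pi.single_eq_of_ne h]

/-- If the normals are positive and the initial parts satisfy the second codimension condition,
the induced filtration coincides with the Ebeling–Gusein-Zade filtration. -/
theorem FY_eq_EGY_of_initialCodim {n k r : ℕ} {g : Fin k → O n} {p : Fin r → Fin n → ℕ}
    (hg : IsCompleteIntersection g) (hpos : ∀ l i, 0 < p l i) (h2 : InitialCodim g p 2 2)
    (μ : Fin r → ℤ) : FY g p μ = EGY g p μ := by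
  refine le_antisymm (FY_le_EGY g p μ) ?_
  rcases Nat.eq_zero_or_pos r with rfl | hr
  · have h1 : (1 : O n) ∈ F p μ := by
      rw [← mono_zero]
      exact Ideal.subset_span ⟨0, fun l => l.elim0, rfl⟩
    rw [FY, (Ideal.eq_top_iff_one _).mpr h1, Ideal.map_top]
    exact le_top
  have hr0 : NeZero r := ⟨hr.ne'⟩
  obtain ⟨N, hN1, hN2⟩ : ∃ N : ℕ, (∀ l, μ l ≤ N) ∧ ∀ m l, order (p l) (g m) < N := by
    refine ⟨∑ l, (μ l).toNat + (∑ m, ∑ l, order (p l) (g m) + 1), fun l => ?_, fun m l => ?_⟩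
    · have h1 := Finset.single_le_sum (f := fun l => (μ l).toNat) (fun _ _ => Nat.zero_le _)
        (Finset.mem_univ l)
      omega
    · have h1 := Finset.single_le_sum (f := fun l => order (p l) (g m)) (fun _ _ => Nat.zero_le _)
        (Finset.mem_univ l)
      have h2 := Finset.single_le_sum (f := fun m => ∑ l, order (p l) (g m))
        (fun _ _ => Nat.zero_le _) (Finset.mem_univ m)
      omega
  set g' : Fin k → MvPolynomial (Fin n) ℂ := fun m => taylor N (g m) with hg'
  set I' := Ideal.span (Set.range g') with hI'
  have hI1 : idealOf g ≤ I'.map (ofPoly n) ⊔ tail n N := by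
    rw [idealOf, Ideal.span_le]
    rintro _ ⟨m, rfl⟩
    rw [← add_sub_cancel (ofPoly n (taylor N (g m))) (g m)]
    exact Submodule.add_mem_sup (Ideal.mem_map_of_mem _ (Ideal.subset_span ⟨m, rfl⟩))
      (sub_taylor_mem N (g m))
  have hI2 : I'.map (ofPoly n) ≤ idealOf g ⊔ tail n N := by
    rw [Ideal.map_le_iff_le_comap, hI', Ideal.span_le]
    rintro _ ⟨m, rfl⟩
    rw [SetLike.mem_coe, Ideal.mem_comap, ← sub_sub_cancel (g m) (ofPoly n (g' m))]
    exact sub_mem (Ideal.mem_sup_left (Ideal.subset_span ⟨m, rfl⟩))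
      (Ideal.mem_sup_right (sub_taylor_mem N (g m)))
  have hN3 : ∀ l l', (Pi.single l (μ l) : Fin r → ℤ) l' ≤ N := by
    intro l l'
    by_cases h : l' = l
    · subst h
      simpa using hN1 l'
    · simp [Pi.single_eq_of_ne h]
  intro y hy
  obtain ⟨f, rfl⟩ := Ideal.Quotient.mk_surjective y
  have hfl : ∀ l, f ∈ F p (Pi.single l (μ l)) ⊔ idealOf g := by
    intro l
    have h1 : Ideal.Quotient.mk (idealOf g) f ∈ FY g p (Pi.single l (μ l)) :=
      (Submodule.mem_iInf _).mp hy l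
    obtain ⟨x, hx, hxf⟩ := (Ideal.mem_map_iff_of_surjective _ Ideal.Quotient.mk_surjective).mp h1
    rw [← add_sub_cancel x f]
    exact Submodule.add_mem_sup hx (Ideal.Quotient.eq.mp hxf.symm)
  set P := taylor N f with hP
  have hPl : ∀ l, P ∈ polyF p (Pi.single l (μ l)) ⊔ I' := by
    intro l
    have h1 : ofPoly n P ∈ (polyF p (Pi.single l (μ l)) ⊔ I').map (ofPoly n) ⊔ tail n N := by
      rw [← sub_sub_cancel f (ofPoly n P), Ideal.map_sup, ← F_eq_map]
      refine sub_mem ?_ (Ideal.mem_sup_right (sub_taylor_mem N f))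
      rw [sup_assoc]
      exact sup_le_sup_left hI1 _ (hfl l)
    have h3 : polyF p (Pi.single l (μ l)) ⊔ I' ⊔ idealOfVars (Fin n) ℂ ^ N ≤
        polyF p (Pi.single l (μ l)) ⊔ I' :=
      sup_le le_rfl (le_sup_of_le_left (pow_idealOfVars_le_polyF hpos (hN3 l)))
    exact h3 (mem_sup_pow_of_ofPoly_mem h1)
  have hcoeff : ∀ m q, (g' m).coeff q ≠ 0 → coeff q (g m) ≠ 0 := by
    intro m q hq
    rw [hg', coeff_taylor] at hq
    exact fun h => hq (by rw [h, ite_self])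
  have hPμ : P ∈ polyF p μ ⊔ I' := by
    refine iInf_single_le_of_step (L := fun κ => polyF p κ ⊔ I')
      (fun _ _ h => sup_le_sup_right (polyF_antitone p h) _) (fun lam i j hij => ?_) μ
      ((Submodule.mem_iInf _).mpr hPl)
    refine polyF_sup_inf_le (a := fun m l => order (p l) (g m)) hpos
      (fun m q hq l => order_le_pairing _ (hcoeff m q hq)) (fun m => ?_)
      (fun J hJ Q hQ hQm hgQ => ?_)
      lam hij
    · rw [mem_idealOfVars, MvPolynomial.constantCoeff_eq]
      by_contra h
      exact hcoeff m 0 h (coeff_zero_eq_zero_of_isCompleteIntersection hg m)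
    · exact trdeg_le_of_hasCodimGE hpos hN2 (Finset.card_pos.mp (by omega)) (h2 J hJ) Q hQ hQm hgQ
  have hf : f ∈ F p μ ⊔ idealOf g := by
    have h1 : ofPoly n P ∈ F p μ ⊔ idealOf g := by
      have h3 := Ideal.mem_map_of_mem (ofPoly n) hPμ
      rw [Ideal.map_sup, ← F_eq_map] at h3
      refine sup_le le_sup_left (hI2.trans (sup_le le_sup_right ?_)) h3
      exact le_sup_of_le_left (tail_le_F hpos hN1)
    rw [← sub_add_cancel f (ofPoly n P)]
    exact add_mem (Ideal.mem_sup_left (tail_le_F hpos hN1 (sub_taylor_mem N f))) h1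
  obtain ⟨x, hx, z, hz, rfl⟩ := Submodule.mem_sup.mp hf
  rw [map_add, Ideal.Quotient.eq_zero_iff_mem.mpr hz, add_zero]
  exact Ideal.mem_map_of_mem _ hx

/-! ### Facets of the Newton polyhedron -/

/-- The linear functional `x ↦ ∑ w_i x_i`. -/
noncomputable def dotFunctional {n : ℕ} (w : Fin n → ℝ) : (Fin n → ℝ) →ₗ[ℝ] ℝ :=
  ∑ i, w i • LinearMap.proj i

theorem dotFunctional_apply {n : ℕ} (w x : Fin n → ℝ) :
    dotFunctional w x = ∑ i, w i * x i := by
  simp [dotFunctional]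

theorem dotFunctional_nonneg {n : ℕ} {w y : Fin n → ℝ} (hw : 0 ≤ w) (hy : 0 ≤ y) :
    0 ≤ dotFunctional w y := by
  rw [dotFunctional_apply]
  exact Finset.sum_nonneg fun i _ => mul_nonneg (hw i) (hy i)

/-- The point of `ℝⁿ` given by an exponent. -/
def toReal {n : ℕ} (q : Fin n →₀ ℕ) : Fin n → ℝ := fun i => (q i : ℝ)

theorem dotFunctional_natCast_toReal {n : ℕ} (v : Fin n → ℕ) (q : Fin n →₀ ℕ) :
    dotFunctional (fun i => (v i : ℝ)) (toReal q) = pairing v q := by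
  rw [dotFunctional_apply, pairing]
  push_cast
  rfl

theorem toReal_mem_newtonPolyhedron {n : ℕ} {f : O n} {q : Fin n →₀ ℕ} (hq : q ∈ supp f) :
    toReal q ∈ newtonPolyhedron f :=
  subset_convexHull _ _ ⟨q, hq, 0, le_rfl, (add_zero _).symm⟩

theorem add_mem_newtonPolyhedron {n : ℕ} {f : O n} {x y : Fin n → ℝ}
    (hx : x ∈ newtonPolyhedron f) (hy : 0 ≤ y) : x + y ∈ newtonPolyhedron f := by
  have h1 : Convex ℝ ((fun z => z + y) ⁻¹' newtonPolyhedron f) :=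
    (convex_convexHull ℝ _).translate_preimage_left y
  refine convexHull_min ?_ h1 hx
  rintro _ ⟨q, hq, y', hy', rfl⟩
  exact subset_convexHull _ _ ⟨q, hq, y' + y, add_nonneg hy' hy, add_assoc _ _ _⟩

theorem exists_eq_of_mem_convexHull {E : Type*} [AddCommGroup E] [Module ℝ E] {S : Set E}
    {ℓ ℓ' : E →ₗ[ℝ] ℝ} {m m' : ℝ} (h : ∀ s ∈ S, m ≤ ℓ s) (h' : ∀ s ∈ S, m' ≤ ℓ' s) {x : E}
    (hx : x ∈ convexHull ℝ S) (hm : ℓ x ≤ m) (hm' : ℓ' x ≤ m') :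
    ∃ s ∈ S, ℓ s = m ∧ ℓ' s = m' := by
  by_contra! hcon
  have h1 : convexHull ℝ S ⊆ {y | m + m' < (ℓ + ℓ') y} := by
    refine convexHull_min (fun s hs => ?_) (convex_halfSpace_gt (ℓ + ℓ').isLinear _)
    have h2 := h s hs
    have h3 := h' s hs
    have h4 := hcon s hs
    change m + m' < ℓ s + ℓ' s
    rcases h2.lt_or_eq with h5 | h5
    · linarith
    · have h6 := lt_of_le_of_ne h3 (h4 h5.symm).symm
      linarith
  have h2 : m + m' < ℓ x + ℓ' x := h1 hx
  linarith

/-- If two functionals with non-negative coefficients are minimal at the same point of the Newton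
polyhedron, they are minimal at the same exponent. -/
theorem exists_supp_of_isMinOn {n : ℕ} {f : O n} {w w' x : Fin n → ℝ} (hw : 0 ≤ w) (hw' : 0 ≤ w')
    (hx : x ∈ newtonPolyhedron f)
    (h : ∀ y ∈ newtonPolyhedron f, dotFunctional w x ≤ dotFunctional w y)
    (h' : ∀ y ∈ newtonPolyhedron f, dotFunctional w' x ≤ dotFunctional w' y) :
    ∃ q ∈ supp f, dotFunctional w (toReal q) = dotFunctional w x ∧
      dotFunctional w' (toReal q) = dotFunctional w' x := by
  obtain ⟨_, ⟨q, hq, y, hy, rfl⟩, h1, h2⟩ := exists_eq_of_mem_convexHull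
    (fun s hs => h s (subset_convexHull _ _ hs)) (fun s hs => h' s (subset_convexHull _ _ hs))
    hx le_rfl le_rfl
  have h3 := h _ (toReal_mem_newtonPolyhedron hq)
  have h4 := h' _ (toReal_mem_newtonPolyhedron hq)
  have h5 := dotFunctional_nonneg hw hy
  have h6 := dotFunctional_nonneg hw' hy
  rw [map_add] at h1 h2
  change dotFunctional w (toReal q) + _ = _ at h1
  change dotFunctional w' (toReal q) + _ = _ at h2
  exact ⟨q, hq, by linarith, by linarith⟩

/-- A compact facet is the face on which a functional with positive coefficients is minimal, and
every functional that is constant on it is a multiple of this one. -/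
theorem IsCompactFacet.exists_normal {n : ℕ} {f : O n} {σ : Set (Fin n → ℝ)}
    (hσ : IsCompactFacet (newtonPolyhedron f) σ) :
    ∃ w : Fin n → ℝ, (∀ i, 0 < w i) ∧
      (∀ x, x ∈ σ ↔ x ∈ newtonPolyhedron f ∧
        ∀ y ∈ newtonPolyhedron f, dotFunctional w x ≤ dotFunctional w y) ∧
      ∀ ψ : (Fin n → ℝ) →ₗ[ℝ] ℝ, (∀ x ∈ σ, ∀ y ∈ σ, ψ x = ψ y) →
        ∃ c : ℝ, ψ = c • dotFunctional w := by
  classical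
  obtain ⟨hexp, hne, hcomp, hdim⟩ := hσ
  obtain ⟨l, hl⟩ := hexp hne
  set w : Fin n → ℝ := fun i => -l (Pi.single i 1) with hw
  have hlw : ∀ x, dotFunctional w x = -l x := by
    intro x
    conv_rhs => rw [← Finset.univ_sum_single x]
    rw [map_sum, dotFunctional_apply, ← Finset.sum_neg_distrib]
    refine Finset.sum_congr rfl fun i _ => ?_
    have h1 : (Pi.single i (x i) : Fin n → ℝ) = x i • Pi.single i 1 := by
      rw [← Pi.single_smul, smul_eq_mul, mul_one]
    rw [h1, map_smul, smul_eq_mul]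
    ring
  have hmem : ∀ x, x ∈ σ ↔ x ∈ newtonPolyhedron f ∧
      ∀ y ∈ newtonPolyhedron f, dotFunctional w x ≤ dotFunctional w y := by
    intro x
    conv_lhs => rw [hl]
    simp only [hlw, neg_le_neg_iff]
    rfl
  obtain ⟨x₀, hx₀⟩ := hne
  have hx₀' := (hmem x₀).mp hx₀
  have hadd : ∀ i, ∀ t : ℝ, 0 ≤ t → x₀ + t • Pi.single i 1 ∈ newtonPolyhedron f ∧
      dotFunctional w (x₀ + t • Pi.single i 1) = dotFunctional w x₀ + t * w i := by
    intro i t ht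
    refine ⟨add_mem_newtonPolyhedron hx₀'.1
      (smul_nonneg ht (Pi.single_nonneg.mpr zero_le_one)), ?_⟩
    rw [map_add, map_smul, hlw (Pi.single i 1), smul_eq_mul]
  have hw0 : ∀ i, 0 ≤ w i := by
    intro i
    have h1 := hadd i 1 zero_le_one
    have h2 := hx₀'.2 _ h1.1
    linarith [h1.2]
  have hwpos : ∀ i, 0 < w i := by
    intro i
    refine lt_of_le_of_ne (hw0 i) fun h0 => ?_
    obtain ⟨C, hC⟩ := hcomp.isBounded.exists_norm_le
    have hC0 : 0 ≤ C := (norm_nonneg _).trans (hC x₀ hx₀)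
    have ht : 0 ≤ C + 1 + |x₀ i| := by positivity
    have h1 := hadd i _ ht
    rw [← h0, mul_zero, add_zero] at h1
    have h2 := hC _ ((hmem _).mpr ⟨h1.1, fun y hy => h1.2.trans_le (hx₀'.2 y hy)⟩)
    have h3 := (norm_le_pi_norm _ i).trans h2
    rw [Pi.add_apply, Pi.smul_apply, Pi.single_eq_same, smul_eq_mul, mul_one, Real.norm_eq_abs]
      at h3
    have h4 := neg_abs_le (x₀ i)
    have h5 := le_abs_self (x₀ i + (C + 1 + |x₀ i|))
    linarith
  refine ⟨w, hwpos, hmem, fun ψ hψ => ?_⟩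
  have hconst : ∀ x ∈ σ, ∀ y ∈ σ, dotFunctional w x = dotFunctional w y := fun x hx y hy =>
    le_antisymm (((hmem x).mp hx).2 y ((hmem y).mp hy).1)
      (((hmem y).mp hy).2 x ((hmem x).mp hx).1)
  have hker : ∀ φ : (Fin n → ℝ) →ₗ[ℝ] ℝ, (∀ x ∈ σ, ∀ y ∈ σ, φ x = φ y) →
      vectorSpan ℝ σ ≤ LinearMap.ker φ := by
    intro φ hφ
    rw [vectorSpan_def, Submodule.span_le]
    rintro _ ⟨x, hx, y, hy, rfl⟩
    change φ (x - y) = 0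
    rw [map_sub, hφ x hx y hy, sub_self]
  have hpos : 0 < n := by omega
  have hw1 : dotFunctional w ≠ 0 := by
    intro h
    have h1 := hlw (Pi.single ⟨0, hpos⟩ 1)
    rw [h, LinearMap.zero_apply] at h1
    exact (hwpos ⟨0, hpos⟩).ne h1
  have heq : vectorSpan ℝ σ = LinearMap.ker (dotFunctional w) := by
    refine Submodule.eq_of_le_of_finrank_le (hker _ hconst) ?_
    have h1 := Module.Dual.finrank_ker_add_one_of_ne_zero (f := dotFunctional w) hw1
    rw [Module.finrank_fin_fun] at h1
    omega
  have h1 := mem_span_of_iInf_ker_le_ker (ι := Unit) (L := fun _ => dotFunctional w) (K := ψ)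
    (by rw [iInf_const, ← heq]; exact hker ψ hψ)
  rw [Set.range_const, Submodule.mem_span_singleton] at h1
  obtain ⟨c, hc⟩ := h1
  exact ⟨c, hc.symm⟩

/-- A primitive normal of a compact facet is positive, and the facet is the face on which it is
minimal. -/
theorem IsCompactFacet.pos_and_mem_iff {n : ℕ} {f : O n} {σ : Set (Fin n → ℝ)}
    (hσ : IsCompactFacet (newtonPolyhedron f) σ) {v : Fin n → ℕ} (hv : Finset.univ.gcd v = 1)
    (hvσ : ∀ x ∈ σ, ∀ y ∈ σ, ∑ i, (v i : ℝ) * x i = ∑ i, (v i : ℝ) * y i) :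
    (∀ i, 0 < v i) ∧ ∀ x, x ∈ σ ↔ x ∈ newtonPolyhedron f ∧ ∀ y ∈ newtonPolyhedron f,
      dotFunctional (fun i => (v i : ℝ)) x ≤ dotFunctional (fun i => (v i : ℝ)) y := by
  obtain ⟨w, hw, hmem, huniq⟩ := hσ.exists_normal
  obtain ⟨c, hc⟩ := huniq (dotFunctional fun i => (v i : ℝ)) fun x hx y hy => by
    rw [dotFunctional_apply, dotFunctional_apply]
    exact hvσ x hx y hy
  have hvi : ∀ i, (v i : ℝ) = c * w i := by
    intro i
    have h1 := LinearMap.congr_fun hc (Pi.single i 1)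
    simpa [dotFunctional_apply, Pi.single_apply] using h1
  obtain ⟨i₀, hi₀⟩ : ∃ i, v i ≠ 0 := by
    by_contra! h
    rw [Finset.gcd_eq_zero_iff.mpr fun i _ => h i] at hv
    exact zero_ne_one hv
  have hc0 : 0 < c := by
    have h1 : (0 : ℝ) < v i₀ := Nat.cast_pos.mpr (Nat.pos_of_ne_zero hi₀)
    rw [hvi] at h1
    exact pos_of_mul_pos_left h1 (hw i₀).le
  refine ⟨fun i => ?_, fun x => ?_⟩
  · have : (0 : ℝ) < v i := by rw [hvi]; exact mul_pos hc0 (hw i)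
    exact_mod_cast this
  · rw [hmem, hc]
    simp only [LinearMap.smul_apply, smul_eq_mul, mul_le_mul_iff_right₀ hc0]

/-- Compact facets are spanned by points with integral coordinates, so they have a primitive
normal. -/
theorem IsCompactFacet.exists_primitive {n : ℕ} {f : O n} {σ : Set (Fin n → ℝ)}
    (hσ : IsCompactFacet (newtonPolyhedron f) σ) :
    ∃ v : Fin n → ℕ, Finset.univ.gcd v = 1 ∧
      ∀ x ∈ σ, ∀ y ∈ σ, ∑ i, (v i : ℝ) * x i = ∑ i, (v i : ℝ) * y i := by
  classical
  obtain ⟨w, hw, hmem, huniq⟩ := hσ.exists_normal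
  have hn : 0 < n := by
    have := hσ.2.2.2
    omega
  obtain ⟨x₀, hx₀⟩ := hσ.2.1
  have hx₀' := (hmem x₀).mp hx₀
  set m := dotFunctional w x₀ with hm
  obtain ⟨q₀, hq₀, hq₀m, -⟩ := exists_supp_of_isMinOn (fun i => (hw i).le) (fun i => (hw i).le)
    hx₀'.1 hx₀'.2 hx₀'.2
  -- A rational functional `u` that is constant on the exponents at which `w` is minimal.
  let L : (Fin n → ℚ) →ₗ[ℚ] ℝ :=
    { toFun := fun x => dotFunctional w fun i => (x i : ℝ)
      map_add' := fun x y => by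
        rw [← map_add]
        congr 1
        ext i
        simp
      map_smul' := fun c x => by
        rw [RingHom.id_apply, Rat.smul_def, ← smul_eq_mul, ← map_smul]
        congr 1
        ext i
        simp }
  have hL : LinearMap.ker L < ⊤ := by
    rw [lt_top_iff_ne_top]
    intro h
    have h1 : (Pi.single ⟨0, hn⟩ 1 : Fin n → ℚ) ∈ LinearMap.ker L := h ▸ Submodule.mem_top
    rw [LinearMap.mem_ker] at h1
    have h2 : L (Pi.single ⟨0, hn⟩ 1) = w ⟨0, hn⟩ := by
      change dotFunctional w _ = _
      rw [dotFunctional_apply, Finset.sum_eq_single ⟨0, hn⟩]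
      · simp
      · intro i _ hi
        simp [Pi.single_eq_of_ne hi]
      · simp
    exact (hw _).ne' (h2.symm.trans h1)
  obtain ⟨φ, hφ0, hφ⟩ := Submodule.exists_le_ker_of_lt_top _ hL
  set u : Fin n → ℚ := fun i => φ (Pi.single i 1) with hu
  have hφu : ∀ x, φ x = ∑ i, u i * x i := by
    intro x
    conv_lhs => rw [← Finset.univ_sum_single x]
    rw [map_sum]
    refine Finset.sum_congr rfl fun i _ => ?_
    have h1 : (Pi.single i (x i) : Fin n → ℚ) = x i • Pi.single i 1 := by
      rw [← Pi.single_smul, smul_eq_mul, mul_one]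
    rw [h1, map_smul, smul_eq_mul, mul_comm]
  set ψ := dotFunctional fun i => (u i : ℝ) with hψ
  have hψq : ∀ q : Fin n →₀ ℕ, dotFunctional w (toReal q) = m → ψ (toReal q) = ψ (toReal q₀) := by
    intro q hq
    have h1 : (fun i => (q i : ℚ) - q₀ i) ∈ LinearMap.ker L := by
      rw [LinearMap.mem_ker]
      change dotFunctional w (fun i => (((q i : ℚ) - q₀ i : ℚ) : ℝ)) = 0
      have h2 : (fun i => (((q i : ℚ) - q₀ i : ℚ) : ℝ)) = toReal q - toReal q₀ := by
        ext i
        simp [toReal]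
      rw [h2, map_sub, hq, hq₀m, sub_self]
    have h2 := hφ h1
    rw [LinearMap.mem_ker, hφu] at h2
    rw [← sub_eq_zero, ← map_sub, hψ, dotFunctional_apply]
    have h3 : ((∑ i, u i * ((q i : ℚ) - q₀ i) : ℚ) : ℝ) = 0 := by rw [h2, Rat.cast_zero]
    push_cast at h3
    exact h3
  have hψσ : ∀ x ∈ σ, ψ x = ψ (toReal q₀) := by
    have hconv : Convex ℝ {x : Fin n → ℝ | m < dotFunctional w x ∨
        (dotFunctional w x = m ∧ ψ x = ψ (toReal q₀))} := by
      intro x hx y hy a b ha hb hab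
      rcases ha.eq_or_lt with rfl | ha
      · rw [zero_add] at hab
        rw [hab, zero_smul, zero_add, one_smul]
        exact hy
      rcases hb.eq_or_lt with rfl | hb
      · rw [add_zero] at hab
        rw [hab, zero_smul, add_zero, one_smul]
        exact hx
      have hm' : m = a * m + b * m := by rw [← add_mul, hab, one_mul]
      change m < dotFunctional w (a • x + b • y) ∨ dotFunctional w (a • x + b • y) = m ∧
        ψ (a • x + b • y) = ψ (toReal q₀)
      simp only [map_add, map_smul, smul_eq_mul]
      rcases hx with hx | ⟨hx, hx'⟩
      · left
        have h1 := mul_lt_mul_of_pos_left hx ha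
        have h2 : b * m ≤ b * dotFunctional w y :=
          mul_le_mul_of_nonneg_left (hy.elim le_of_lt fun h => h.1.ge) hb.le
        linarith
      · rcases hy with hy | ⟨hy, hy'⟩
        · left
          have h1 := mul_lt_mul_of_pos_left hy hb
          rw [hx]
          linarith
        · right
          rw [hx, hy, hx', hy', ← add_mul, ← add_mul, hab, one_mul, one_mul]
          exact ⟨rfl, rfl⟩
    intro x hx
    have h1 : newtonPolyhedron f ⊆ _ := convexHull_min ?_ hconv
    · have h2 := (hmem x).mp hx
      rcases h1 h2.1 with h3 | h3
      · exact absurd (h2.2 x₀ hx₀'.1) (not_le_of_gt h3)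
      · exact h3.2
    · rintro _ ⟨q, hq, y, hy, rfl⟩
      change m < dotFunctional w (toReal q + y) ∨ dotFunctional w (toReal q + y) = m ∧
        ψ (toReal q + y) = ψ (toReal q₀)
      have h2 := hx₀'.2 _ (toReal_mem_newtonPolyhedron hq)
      rw [map_add]
      rcases h2.lt_or_eq with h2 | h2
      · left
        have h3 := dotFunctional_nonneg (fun i => (hw i).le) hy
        linarith
      by_cases hy0 : y = 0
      · right
        subst hy0
        rw [map_zero, add_zero, add_zero]
        exact ⟨h2.symm, hψq q h2.symm⟩
      · left
        obtain ⟨i, hi⟩ := Function.ne_iff.mp hy0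
        have h3 : 0 < dotFunctional w y := by
          rw [dotFunctional_apply]
          refine Finset.sum_pos' (fun i _ => mul_nonneg (hw i).le (hy i)) ⟨i, Finset.mem_univ i, ?_⟩
          exact mul_pos (hw i) (lt_of_le_of_ne (hy i) (Ne.symm hi))
        linarith
  obtain ⟨c, hc⟩ := huniq ψ fun x hx y hy => (hψσ x hx).trans (hψσ y hy).symm
  have hui : ∀ i, (u i : ℝ) = c * w i := by
    intro i
    have h1 := LinearMap.congr_fun hc (Pi.single i 1)
    simpa [hψ, dotFunctional_apply, Pi.single_apply] using h1
  have hc0 : c ≠ 0 := by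
    rintro rfl
    refine hφ0 (LinearMap.ext fun x => ?_)
    rw [hφu, LinearMap.zero_apply]
    refine Finset.sum_eq_zero fun i _ => ?_
    have := hui i
    rw [zero_mul, Rat.cast_eq_zero] at this
    rw [this, zero_mul]
  -- Clearing denominators and signs, and dividing by the greatest common divisor.
  set d : ℕ := ∏ i, (u i).den with hd
  have hd0 : 0 < d := Finset.prod_pos fun i _ => (u i).den_pos
  have hdi : ∀ i, ∃ e : ℕ, (e : ℝ) = d * |c| * w i := by
    intro i
    obtain ⟨b, hb⟩ : (u i).den ∣ d := Finset.dvd_prod_of_mem _ (Finset.mem_univ i)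
    refine ⟨b * (u i).num.natAbs, ?_⟩
    have h1 : (u i : ℝ) * (u i).den = (u i).num := by
      exact_mod_cast Rat.mul_den_eq_num (u i)
    have h2 : |(u i : ℝ)| = |c| * w i := by rw [hui, abs_mul, abs_of_pos (hw i)]
    rw [mul_assoc, ← h2, hb]
    push_cast
    rw [Nat.cast_natAbs, Int.cast_abs, ← h1, abs_mul, Nat.abs_cast]
    ring
  choose e he using hdi
  obtain ⟨v, hv, hv1⟩ := Finset.extract_gcd e (s := Finset.univ) ⟨⟨0, hn⟩, Finset.mem_univ _⟩
  refine ⟨v, hv1, fun x hx y hy => ?_⟩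
  set D := Finset.univ.gcd e with hD
  have hD0 : (D : ℝ) ≠ 0 := by
    intro h
    have h1 := he ⟨0, hn⟩
    rw [hv _ (Finset.mem_univ _), Nat.cast_mul, h, zero_mul] at h1
    have : 0 < (d : ℝ) * |c| * w ⟨0, hn⟩ :=
      mul_pos (mul_pos (Nat.cast_pos.mpr hd0) (abs_pos.mpr hc0)) (hw _)
    exact this.ne h1
  have hsum : ∀ x : Fin n → ℝ, (D : ℝ) * ∑ i, (v i : ℝ) * x i =
      d * |c| * dotFunctional w x := by
    intro x
    rw [dotFunctional_apply, Finset.mul_sum, Finset.mul_sum]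
    refine Finset.sum_congr rfl fun i _ => ?_
    have h1 := he i
    rw [hv i (Finset.mem_univ i), Nat.cast_mul] at h1
    rw [← mul_assoc, h1]
    ring
  apply mul_left_cancel₀ hD0
  rw [hsum, hsum, le_antisymm (((hmem x).mp hx).2 y ((hmem y).mp hy).1)
    (((hmem y).mp hy).2 x ((hmem x).mp hx).1)]

theorem pos_of_isPrimitiveFacetNormal {n : ℕ} {f : O n} {v : Fin n → ℕ}
    (hv : IsPrimitiveFacetNormal (newtonPolyhedron f) v) (i : Fin n) : 0 < v i := by
  obtain ⟨hv1, σ, hσ, hvσ⟩ := hv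
  exact (hσ.pos_and_mem_iff hv1 hvσ).1 i

theorem order_le_dotFunctional {n : ℕ} {f : O n} (v : Fin n → ℕ) {x : Fin n → ℝ}
    (hx : x ∈ newtonPolyhedron f) :
    (order v f : ℝ) ≤ dotFunctional (fun i => (v i : ℝ)) x := by
  have h1 : newtonPolyhedron f ⊆ {x | (order v f : ℝ) ≤ dotFunctional (fun i => (v i : ℝ)) x} := by
    refine convexHull_min ?_ (convex_halfSpace_ge (dotFunctional _).isLinear _)
    rintro _ ⟨q, hq, y, hy, rfl⟩
    change _ ≤ dotFunctional _ (toReal q + y)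
    rw [map_add, dotFunctional_natCast_toReal]
    have h2 : (order v f : ℝ) ≤ pairing v q := Nat.cast_le.mpr (order_le_pairing v hq)
    have h3 := dotFunctional_nonneg (w := fun i => (v i : ℝ)) (fun i => Nat.cast_nonneg _) hy
    linarith
  exact h1 hx

theorem initialPart_ne_zero_iff {n r : ℕ} {p : Fin r → Fin n → ℕ} {J : Finset (Fin r)} {f : O n} :
    initialPart p J f ≠ 0 ↔ ∃ q ∈ supp f, ∀ j ∈ J, pairing (p j) q = order (p j) f := by
  constructor
  · intro h
    obtain ⟨q, hq⟩ := exists_coeff_ne_zero h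
    rw [coeff_initialPart] at hq
    by_cases hJ : ∀ j ∈ J, pairing (p j) q = order (p j) f
    · rw [if_pos hJ] at hq
      exact ⟨q, hq, hJ⟩
    · exact absurd (if_neg hJ) hq
  · rintro ⟨q, hq, hJ⟩ h0
    have h1 := coeff_initialPart p J f q
    rw [if_pos hJ, h0, coeff_zero] at h1
    exact hq h1.symm

/-- Two compact facets meet if and only if the initial part for their two normals does not
vanish. -/
theorem inter_nonempty_iff {n r : ℕ} {p : Fin r → Fin n → ℕ} {f : O n} {σ τ : Set (Fin n → ℝ)}
    (hσ : IsCompactFacet (newtonPolyhedron f) σ) (hτ : IsCompactFacet (newtonPolyhedron f) τ)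
    {j₁ j₂ : Fin r} (h1 : Finset.univ.gcd (p j₁) = 1) (h2 : Finset.univ.gcd (p j₂) = 1)
    (hσ1 : ∀ x ∈ σ, ∀ y ∈ σ, ∑ i, (p j₁ i : ℝ) * x i = ∑ i, (p j₁ i : ℝ) * y i)
    (hτ2 : ∀ x ∈ τ, ∀ y ∈ τ, ∑ i, (p j₂ i : ℝ) * x i = ∑ i, (p j₂ i : ℝ) * y i) :
    (σ ∩ τ).Nonempty ↔ initialPart p {j₁, j₂} f ≠ 0 := by
  have hmemσ := (hσ.pos_and_mem_iff h1 hσ1).2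
  have hmemτ := (hτ.pos_and_mem_iff h2 hτ2).2
  rw [initialPart_ne_zero_iff]
  constructor
  · rintro ⟨x, hxσ, hxτ⟩
    have hxσ' := (hmemσ x).mp hxσ
    have hxτ' := (hmemτ x).mp hxτ
    obtain ⟨q, hq, hq1, hq2⟩ := exists_supp_of_isMinOn (fun i => Nat.cast_nonneg _)
      (fun i => Nat.cast_nonneg _) hxσ'.1 hxσ'.2 hxτ'.2
    have key : ∀ v : Fin n → ℕ, (∀ y ∈ newtonPolyhedron f,
        dotFunctional (fun i => (v i : ℝ)) (toReal q) ≤ dotFunctional (fun i => (v i : ℝ)) y) →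
        pairing v q = order v f := by
      intro v hv
      refine le_antisymm (le_csInf ⟨_, q, hq, rfl⟩ ?_) (order_le_pairing v hq)
      rintro _ ⟨q', hq', rfl⟩
      have h3 := hv _ (toReal_mem_newtonPolyhedron hq')
      rw [dotFunctional_natCast_toReal, dotFunctional_natCast_toReal] at h3
      exact_mod_cast h3
    refine ⟨q, hq, fun j hj => ?_⟩
    rcases Finset.mem_insert.mp hj with rfl | hj
    · exact key _ fun y hy => hq1.trans_le (hxσ'.2 y hy)
    · rw [Finset.mem_singleton.mp hj]
      exact key _ fun y hy => hq2.trans_le (hxτ'.2 y hy)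
  · rintro ⟨q, hq, hJ⟩
    have hqP := toReal_mem_newtonPolyhedron hq
    have hle : ∀ j ∈ ({j₁, j₂} : Finset (Fin r)), ∀ y ∈ newtonPolyhedron f,
        dotFunctional (fun i => (p j i : ℝ)) (toReal q) ≤
          dotFunctional (fun i => (p j i : ℝ)) y := by
      intro j hj y hy
      rw [dotFunctional_natCast_toReal, hJ j hj]
      exact order_le_dotFunctional _ hy
    exact ⟨toReal q, (hmemσ _).mpr ⟨hqP, hle j₁ (by simp)⟩, (hmemτ _).mpr ⟨hqP, hle j₂ (by simp)⟩⟩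

/-- The Newton polyhedron is bistellar if and only if the initial parts for all pairs of normals
are non-zero. -/
theorem isBistellar_iff {n r : ℕ} {p : Fin r → Fin n → ℕ} {f : O n}
    (hp : IsFacetNormalList (newtonPolyhedron f) p) :
    (∀ j₁ j₂ : Fin r, j₁ < j₂ → initialPart p {j₁, j₂} f ≠ 0) ↔
      IsBistellar (newtonPolyhedron f) := by
  constructor
  · intro h σ τ hσ hτ
    obtain ⟨v₁, h1, hσ1⟩ := hσ.exists_primitive
    obtain ⟨v₂, h2, hτ2⟩ := hτ.exists_primitive
    obtain ⟨j₁, rfl⟩ : v₁ ∈ Set.range p :=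
      hp.2.symm ▸ (⟨h1, σ, hσ, hσ1⟩ : IsPrimitiveFacetNormal _ _)
    obtain ⟨j₂, rfl⟩ : v₂ ∈ Set.range p :=
      hp.2.symm ▸ (⟨h2, τ, hτ, hτ2⟩ : IsPrimitiveFacetNormal _ _)
    rcases lt_trichotomy j₁ j₂ with hlt | rfl | hlt
    · exact (inter_nonempty_iff hσ hτ h1 h2 hσ1 hτ2).mpr (h _ _ hlt)
    · have hστ : σ = τ := by
        ext x
        rw [(hσ.pos_and_mem_iff h1 hσ1).2, (hτ.pos_and_mem_iff h2 hτ2).2]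
      rw [hστ, Set.inter_self]
      exact hτ.2.1
    · refine (inter_nonempty_iff hσ hτ h1 h2 hσ1 hτ2).mpr ?_
      rw [Finset.pair_comm]
      exact h _ _ hlt
  · intro h j₁ j₂ _
    have hmem : ∀ j, IsPrimitiveFacetNormal (newtonPolyhedron f) (p j) := fun j => by
      have h1 : p j ∈ Set.range p := ⟨j, rfl⟩
      rw [hp.2] at h1
      exact h1
    obtain ⟨h1, σ, hσ, hσ1⟩ := hmem j₁
    obtain ⟨h2, τ, hτ, hτ2⟩ := hmem j₂
    exact (inter_nonempty_iff hσ hτ h1 h2 hσ1 hτ2).mp (h σ τ hσ hτ)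

/-! ### Hypersurfaces -/

theorem ringKrullDim_quotient_span_add_one_le {n : ℕ} {f : O n} (hf : f ≠ 0) :
    ringKrullDim (O n ⧸ Ideal.span {f}) + 1 ≤ ringKrullDim (O n) :=
  ringKrullDim_quotient_succ_le_of_nonZeroDivisor (mem_nonZeroDivisors_of_ne_zero hf)

theorem idealOf_fin_one {n : ℕ} (f : Fin 1 → O n) : idealOf f = Ideal.span {f 0} := by
  rw [idealOf, Set.range_unique]
  rfl

theorem ringKrullDim_OY_fin_one {n : ℕ} (f : Fin 1 → O n) :
    ringKrullDim (OY f) = ringKrullDim (O n ⧸ Ideal.span {f 0}) := by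
  change ringKrullDim (O n ⧸ idealOf f) = _
  rw [idealOf_fin_one]

theorem hasCodimGE_of_nonpos {n k : ℕ} (g : Fin k → O n) {c : ℤ} (hc : c ≤ 0) :
    HasCodimGE g c := by
  intro d hd
  have h1 : (d : WithBot ℕ∞) ≤ n := hd.trans ((ringKrullDim_le_of_surjective
    (Ideal.Quotient.mk (idealOf g)) Ideal.Quotient.mk_surjective).trans (ringKrullDim_O_le n))
  have h2 : d ≤ n := by exact_mod_cast h1
  omega

theorem hasCodimGE_one {n : ℕ} {f : Fin 1 → O n} (hf : f 0 ≠ 0) : HasCodimGE f 1 := by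
  intro d hd
  have h1 : ringKrullDim (OY f) + 1 ≤ n := by
    rw [ringKrullDim_OY_fin_one]
    exact (ringKrullDim_quotient_span_add_one_le hf).trans (ringKrullDim_O_le n)
  have h2 : ((d + 1 : ℕ) : WithBot ℕ∞) ≤ n := by
    push_cast
    exact (add_le_add_left hd 1).trans h1
  have h3 : d + 1 ≤ n := by exact_mod_cast h2
  omega

theorem ne_zero_of_isCompleteIntersection {n : ℕ} {g : Fin 1 → O n}
    (hg : IsCompleteIntersection g) (hconv : IsConvenient (g 0)) : g 0 ≠ 0 := by
  have hn : n ≠ 0 := by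
    rintro rfl
    rw [IsCompleteIntersection] at hg
    generalize ringKrullDim (OY g) = e at hg
    induction e with
    | bot => simp at hg
    | coe e =>
      norm_cast at hg
      simp at hg
  intro h0
  obtain ⟨l, hl⟩ := hconv ⟨0, Nat.pos_of_ne_zero hn⟩
  rw [h0] at hl
  exact hl (coeff_zero _)

theorem le_ringKrullDim_of_isCompleteIntersection {n : ℕ} {g : Fin 1 → O n}
    (hg : IsCompleteIntersection g) (hg0 : g 0 ≠ 0) : (n : WithBot ℕ∞) ≤ ringKrullDim (O n) := by
  rw [← hg, ringKrullDim_OY_fin_one]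
  exact_mod_cast ringKrullDim_quotient_span_add_one_le hg0

theorem initialPart_singleton_ne_zero {n r : ℕ} (p : Fin r → Fin n → ℕ) (j : Fin r) {f : O n}
    (hf : f ≠ 0) : initialPart p {j} f ≠ 0 := by
  rw [initialPart_ne_zero_iff]
  obtain ⟨q₀, hq₀⟩ := exists_coeff_ne_zero hf
  obtain ⟨q, hq, hqo⟩ := Nat.sInf_mem (s := pairing (p j) '' supp f) ⟨_, q₀, hq₀, rfl⟩
  refine ⟨q, hq, fun i hi => ?_⟩
  rw [Finset.mem_singleton.mp hi]
  exact hqo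

/-- For a hypersurface the codimension conditions only say that the initial parts for pairs of
normals are non-zero. -/
theorem initialCodim_iff {n r : ℕ} {g : Fin 1 → O n} {p : Fin r → Fin n → ℕ}
    (hg : IsCompleteIntersection g) (hg0 : g 0 ≠ 0) :
    InitialCodim g p 1 1 ∧ InitialCodim g p 2 2 ↔
      ∀ j₁ j₂ : Fin r, j₁ < j₂ → initialPart p {j₁, j₂} (g 0) ≠ 0 := by
  constructor
  · rintro ⟨-, h⟩ j₁ j₂ hlt h0
    have hcard : ({j₁, j₂} : Finset (Fin r)).card = 2 := Finset.card_pair hlt.ne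
    have h1 := h {j₁, j₂} hcard.ge n (by
      rw [ringKrullDim_OY_fin_one, h0, Ideal.span_singleton_zero]
      refine (le_ringKrullDim_of_isCompleteIntersection hg hg0).trans ?_
      exact (ringKrullDim_eq_of_ringEquiv (RingEquiv.quotientBot (O n))).ge)
    rw [hcard] at h1
    norm_num at h1
  · intro h
    constructor
    · intro J hJ
      rcases hJ.eq_or_lt with hJ | hJ
      · obtain ⟨j, rfl⟩ := Finset.card_eq_one.mp hJ.symm
        simpa using hasCodimGE_one (f := fun i => initialPart p {j} (g i))
          (initialPart_singleton_ne_zero p j hg0)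
      · refine hasCodimGE_of_nonpos _ ?_
        push_cast
        omega
    · intro J hJ
      rcases hJ.eq_or_lt with hJ | hJ
      · obtain ⟨j₁, j₂, hne, rfl⟩ := Finset.card_eq_two.mp hJ.symm
        have h1 : initialPart p {j₁, j₂} (g 0) ≠ 0 := by
          rcases hne.lt_or_gt with hlt | hlt
          · exact h _ _ hlt
          · rw [Finset.pair_comm]
            exact h _ _ hlt
        rw [← hJ]
        exact hasCodimGE_one (f := fun i => initialPart p {j₁, j₂} (g i)) h1
      · refine hasCodimGE_of_nonpos _ ?_
        push_cast
        omega

end NewtonFiltration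

theorem theorem1p4 {n k r : ℕ} (g : Fin k → NewtonFiltration.O n) (p : Fin r → Fin n → ℕ)
    (hg : NewtonFiltration.IsCompleteIntersection g)
    (hconv : ∀ i, NewtonFiltration.IsConvenient (g i))
    (hp : NewtonFiltration.IsFacetNormalList
      (NewtonFiltration.newtonPolyhedron (∏ i, g i)) p) :
    (NewtonFiltration.InitialCodim g p 1 1 → NewtonFiltration.InitialCodim g p 2 2 →
      ∀ μ : Fin r → ℤ, NewtonFiltration.FY g p μ = NewtonFiltration.EGY g p μ) ∧
    (k = 1 →
      (NewtonFiltration.InitialCodim g p 1 1 ∧ NewtonFiltration.InitialCodim g p 2 2 ↔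
        ∀ i, ∀ j₁ j₂ : Fin r, j₁ < j₂ →
          NewtonFiltration.initialPart p {j₁, j₂} (g i) ≠ 0) ∧
      ((∀ i, ∀ j₁ j₂ : Fin r, j₁ < j₂ →
          NewtonFiltration.initialPart p {j₁, j₂} (g i) ≠ 0) ↔
        NewtonFiltration.IsBistellar (NewtonFiltration.newtonPolyhedron (∏ i, g i))) ∧
      (NewtonFiltration.IsBistellar (NewtonFiltration.newtonPolyhedron (∏ i, g i)) →
        ∀ μ : Fin r → ℤ, NewtonFiltration.FY g p μ = NewtonFiltration.EGY g p μ)) := by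
  have hpos : ∀ l i, 0 < p l i := fun l =>
    NewtonFiltration.pos_of_isPrimitiveFacetNormal (hp.2.subset ⟨l, rfl⟩)
  refine ⟨fun _ h2 μ => NewtonFiltration.FY_eq_EGY_of_initialCodim hg hpos h2 μ, ?_⟩
  rintro rfl
  have hg0 := NewtonFiltration.ne_zero_of_isCompleteIntersection hg (hconv 0)
  have hA := NewtonFiltration.initialCodim_iff (p := p) hg hg0
  rw [Fin.prod_univ_one] at hp ⊢
  have hB := NewtonFiltration.isBistellar_iff hp
  rw [Fin.forall_fin_one]
  exact ⟨hA, hB, fun h μ =>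
    NewtonFiltration.FY_eq_EGY_of_initialCodim hg hpos (hA.mpr (hB.mpr h)).2 μ⟩
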